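/- Let $0<q<1$ and let $m\ge 1$ be an integer. For $1\le i\le m$ put $i'=m+1-i$, and let $(\rho_1,\dots,\rho_m)=(n-\frac12,\dots,\frac12,0,-\frac12,\dots,\frac12-n)$ if $m=2n+1$ and $(n-1,\dots,1,0,0,-1,\dots,1-n)$ if $m=2n$. Let $C_{ij}=C^{ij}=\delta_{j,i'}q^{-\rho_i}$ be the metric and let $\hat R$ be the $\hat R$-matrix of the quantum orthogonal group, $$\hat R^{ij}_{kl}=a_{ij}\,\delta_{il}\delta_{jk}+(q-q^{-1})\,[i<j]\,\delta_{ik}\delta_{jl}-(q-q^{-1})\,[k<j]\,C^{ij}C_{kl},$$ where $[\cdot]$ is $1$ or $0$ according to whether the condition holds, $a_{ij}=q$ if $i=j\neq i'$, $a_{ij}=q^{-1}$ if $j=i'\ne i$, and $a_{ij}=1$ otherwise. In its spectral decomposition $\hat R=q\mathcal P_S-q^{-1}\mathcal P_A+q^{1-m}\mathcal P_1$, let $\mathcal P_A$ be the projection belonging to the eigenvalue $-q^{-1}$. Repeated indices are summed over. Let $\mathcal P$ be the algebra of polynomials on the quantum Euclidean space $\mathbb R^m_q$, that is, the unital $\mathbb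 C$-algebra generated by $x^1,\dots,x^m$ with the relations $(\mathcal P_A)^{ij}_{kl}x^kx^l=0$. Put $\mathbf x^2=x^iC_{ij}x^j$, and let $R\mapsto R(0)$ be the algebra morphism $\mathcal P\to\mathbb C$ with $x^i\mapsto 0$. Let $O_q(m)$ be the unital $\mathbb C$-algebra generated by $t^i_j$ ($1\le i,j\le m$) with the relations $\hat R^{ij}_{ab}t^a_kt^b_l=t^i_at^j_b\hat R^{ab}_{kl}$, $t^i_kt^j_lC^{kl}=C^{ij}$ and $C_{kl}t^k_it^l_j=C_{ij}$. It coacts on $\mathcal P$ by the algebra morphism $\delta:\mathcal P\to O_q(m)\otimes\mathcal P$, $\delta(x^i)=t^i_j\otimes x^j$. A linear functional $J:\mathcal P\to\mathbb C$ is called coinvariant if $(\mathrm{id}\otimes J)(\delta(R))=J(R)\,1$ for all $R\in\mathcal P$. Let $[u]_{q^2}=\frac{q^{2u}-1}{q^2-1}$, $[k]_{q^2}!=\prod_{j=1}^k[j]_{q^2}$, $\mu=1+q^{2-m}$, and let $\Gamma_{q^2}$ be the $q^2$-Gamma function, where for $0<p<1$ and $t>0$ $$\Gamma_p(t)=(1-p)^{1-t}\prod_{k\ge0}\frac{1-p^{k+1}}{1-p^{k+t}}.$$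 **Theorem.** There are unique linear operators $\partial^1,\dots,\partial^m$ on $\mathcal P$ with $\partial^i(1)=0$ and $\partial^i(x^jf)=C^{ij}f+q(\hat R^{-1})^{ij}_{kl}x^k\,\partial^l(f)$ for all $i,j$ and all $f\in\mathcal P$. Let $\Delta=\partial^iC_{ij}\partial^j$. Then for each $R\in\mathcal P$ only finitely many of the numbers $(\Delta^kR)(0)$ are non-zero, and the Pizzetti formula $$\int_{\mathbb S^{m-1}_q}R=\sum_{k=0}^\infty\frac{2\left(\Gamma_{q^2}(\frac12)\right)^m}{\mu^{2k}\,[k]_{q^2}!\,\Gamma_{q^2}(k+\frac m2)}\,(\Delta^kR)(0)$$ defines a non-zero linear functional on $\mathcal P$. A linear functional $J:\mathcal P\to\mathbb C$ is coinvariant under $O_q(m)$ and satisfies $J(\mathbf x^2R)=J(R)$ for all $R\in\mathcal P$ if and only if $J=c\int_{\mathbb S^{m-1}_q}$ for some $c\in\mathbb C$. -/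

import Mathlib

open scoped TensorProduct

noncomputable section

namespace QuantumEuclidean

/-! ### `q`-calculus -/

/-- The `q`-number `[u]_q = (q ^ u - 1) / (q - 1)` of a natural number `u`. -/
def qNumber (q : ℝ) (u : ℕ) : ℝ := (q ^ u - 1) / (q - 1)

/-- The `q`-factorial `[k]_q! = [k]_q [k-1]_q ⋯ [1]_q`. -/
def qFactorial (q : ℝ) (k : ℕ) : ℝ := ∏ j ∈ Finset.range k, qNumber q (j + 1)

/-- The infinite `q`-shifted factorial `(u; q)_∞ = ∏_{k ≥ 0} (1 - u q ^ k)`; the product converges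
for `0 < q < 1`. -/
def qPochhammerInf (u q : ℝ) : ℝ := ∏' k : ℕ, (1 - u * q ^ k)

/-- Jackson's `q`-Gamma function `Γ_q(t) = (q; q)_∞ / (q ^ t; q)_∞ * (1 - q) ^ (1 - t)`, for
`0 < q < 1` and `t > 0`. -/
def qGamma (q t : ℝ) : ℝ :=
  qPochhammerInf q q / qPochhammerInf (q ^ t) q * (1 - q) ^ (1 - t)

/-! ### The braid matrix and the metric of the quantum orthogonal group

The indices `1, …, m` are represented by `Fin m`, and `i' = m + 1 - i` is `Fin.rev i`. -/

/-- The tuple `ρ`: it is `(n - 1/2, …, 1/2, 0, -1/2, …, 1/2 - n)` for `m = 2 n + 1` and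
`(n - 1, …, 1, 0, 0, -1, …, 1 - n)` for `m = 2 n`. -/
def rho (m : ℕ) (i : Fin m) : ℝ :=
  if 2 * (i : ℕ) + 1 < m then (m : ℝ) / 2 - 1 - (i : ℕ)
  else if 2 * (i : ℕ) + 1 = m then 0
  else (m : ℝ) / 2 - (i : ℕ)

/-- The metric `C_{ij} = C^{ij} = δ_{j i'} q ^ (-ρ_i)`. -/
def metric (q : ℝ) (m : ℕ) : Matrix (Fin m) (Fin m) ℝ :=
  fun i j => if j = i.rev then q ^ (-rho m i) else 0

/-- The braid matrix `R̂^{ij}_{kl}` of `O_q(m)` (row `(i, j)`, column `(k, l)`). With matrix units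
`e_{ab}` and the flip `τ`, it is `τ R` for the Faddeev-Reshetikhin-Takhtajan matrix
`R = ∑_{i ≠ i'} (q e_{ii} ⊗ e_{ii} + q⁻¹ e_{i'i'} ⊗ e_{ii}) + e_{cc} ⊗ e_{cc}`
`  + ∑_{i ≠ j, j'} e_{ii} ⊗ e_{jj} + (q - q⁻¹) ∑_{i > j} e_{ij} ⊗ e_{ji}`
`  - (q - q⁻¹) ∑_{i > j} q ^ (ρ_i - ρ_j) e_{ij} ⊗ e_{i'j'}`,
where the term with the central index `c = c'` is present only for odd `m`.
Note `C^{ij} C_{kl} = δ_{j i'} δ_{l k'} q ^ (ρ_j - ρ_k)`. -/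
def braid (q : ℝ) (m : ℕ) : Matrix (Fin m × Fin m) (Fin m × Fin m) ℝ :=
  fun ij kl =>
    (if ij.1 = kl.2 ∧ ij.2 = kl.1 then
      (if ij.1 = ij.2 ∧ ij.1 ≠ ij.2.rev then q
        else if ij.1 = ij.2.rev ∧ ij.1 ≠ ij.2 then q⁻¹
        else 1)
      else 0)
    + (if ij.1 = kl.1 ∧ ij.2 = kl.2 ∧ ij.1 < ij.2 then q - q⁻¹ else 0)
    - (if kl.1 < ij.2 then (q - q⁻¹) * (metric q m ij.1 ij.2 * metric q m kl.1 kl.2) else 0)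

/-- The `q`-antisymmetrizer `P_A`: the projection on the `(-q⁻¹)`-eigenspace in the spectral
decomposition `R̂ = q P_S - q⁻¹ P_A + q ^ (1 - m) P_1`, written as the Lagrange interpolation
polynomial of `R̂`. -/
def antisymmetrizer (q : ℝ) (m : ℕ) : Matrix (Fin m × Fin m) (Fin m × Fin m) ℝ :=
  ((q⁻¹ + q) * (q⁻¹ + q ^ (1 - (m : ℤ))))⁻¹ •
    ((braid q m - q • (1 : Matrix (Fin m × Fin m) (Fin m × Fin m) ℝ)) *
      (braid q m - q ^ (1 - (m : ℤ)) • (1 : Matrix (Fin m × Fin m) (Fin m × Fin m) ℝ)))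

/-! ### The polynomials on quantum Euclidean space -/

/-- The defining relations `(P_A)^{ij}_{kl} x^k x^l = 0`. -/
inductive PolyRel (q : ℝ) (m : ℕ) :
    FreeAlgebra ℂ (Fin m) → FreeAlgebra ℂ (Fin m) → Prop
  | antisymm (i j : Fin m) : PolyRel q m
      (∑ k, ∑ l, (antisymmetrizer q m (i, j) (k, l) : ℂ) •
        (FreeAlgebra.ι ℂ k * FreeAlgebra.ι ℂ l)) 0

/-- The algebra `𝒫` of polynomials on quantum Euclidean space `ℝ^m_q`. -/
abbrev Poly (q : ℝ) (m : ℕ) : Type := RingQuot (PolyRel q m)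

/-- The coordinate `x^i`. -/
def coord (q : ℝ) (m : ℕ) (i : Fin m) : Poly q m :=
  RingQuot.mkAlgHom ℂ (PolyRel q m) (FreeAlgebra.ι ℂ i)

/-- The generalized norm squared `𝐱² = x^i C_{ij} x^j`. -/
def normSq (q : ℝ) (m : ℕ) : Poly q m :=
  ∑ i, ∑ j, (metric q m i j : ℂ) • (coord q m i * coord q m j)

/-- Evaluation at the origin, `R ↦ R(0)`: the algebra morphism with `x^i ↦ 0`. -/
def evalZero (q : ℝ) (m : ℕ) : Poly q m →ₐ[ℂ] ℂ :=
  RingQuot.liftAlgHom ℂ ⟨FreeAlgebra.lift ℂ (fun _ : Fin m => (0 : ℂ)), by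
    rintro _ _ ⟨i, j⟩
    simp only [map_sum, map_smul, map_mul, FreeAlgebra.lift_ι_apply, mul_zero, smul_zero,
      Finset.sum_const_zero, map_zero]⟩

/-! ### The quantum orthogonal group and its coaction -/

/-- The defining relations of `O_q(m)` for the matrix of generators `t^i_j`:
`R̂^{ij}_{ab} t^a_k t^b_l = t^i_a t^j_b R̂^{ab}_{kl}`, `t^i_k t^j_l C^{kl} = C^{ij}` and
`C_{kl} t^k_i t^l_j = C_{ij}`. -/
inductive OrthRel (q : ℝ) (m : ℕ) :
    FreeAlgebra ℂ (Fin m × Fin m) → FreeAlgebra ℂ (Fin m × Fin m) → Prop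
  | rtt (i j k l : Fin m) : OrthRel q m
      (∑ a, ∑ b, (braid q m (i, j) (a, b) : ℂ) •
        (FreeAlgebra.ι ℂ (a, k) * FreeAlgebra.ι ℂ (b, l)))
      (∑ a, ∑ b, (braid q m (a, b) (k, l) : ℂ) •
        (FreeAlgebra.ι ℂ (i, a) * FreeAlgebra.ι ℂ (j, b)))
  | metric_upper (i j : Fin m) : OrthRel q m
      (∑ k, ∑ l, (metric q m k l : ℂ) •
        (FreeAlgebra.ι ℂ (i, k) * FreeAlgebra.ι ℂ (j, l)))
      (algebraMap ℂ _ (metric q m i j : ℂ))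
  | metric_lower (i j : Fin m) : OrthRel q m
      (∑ k, ∑ l, (metric q m k l : ℂ) •
        (FreeAlgebra.ι ℂ (k, i) * FreeAlgebra.ι ℂ (l, j)))
      (algebraMap ℂ _ (metric q m i j : ℂ))

/-- The (coordinate algebra of the) quantum group `O_q(m)`. -/
abbrev OrthGroup (q : ℝ) (m : ℕ) : Type := RingQuot (OrthRel q m)

/-- The generator `t^i_j`. -/
def gen (q : ℝ) (m : ℕ) (i j : Fin m) : OrthGroup q m :=
  RingQuot.mkAlgHom ℂ (OrthRel q m) (FreeAlgebra.ι ℂ (i, j))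

/-- The matrix `t ⊗ t` with entries `t^i_k t^j_l`. -/
def genTensor (q : ℝ) (m : ℕ) : Matrix (Fin m × Fin m) (Fin m × Fin m) (OrthGroup q m) :=
  fun ij kl => gen q m ij.1 kl.1 * gen q m ij.2 kl.2

/-- A real matrix seen as a matrix of scalars in `O_q(m)`. -/
def scalarMatrix (q : ℝ) (m : ℕ) :
    Matrix (Fin m × Fin m) (Fin m × Fin m) ℝ →+*
      Matrix (Fin m × Fin m) (Fin m × Fin m) (OrthGroup q m) :=
  ((algebraMap ℂ (OrthGroup q m)).comp Complex.ofRealHom).mapMatrix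

theorem commute_braid (q : ℝ) (m : ℕ) :
    Commute (scalarMatrix q m (braid q m)) (genTensor q m) := by
  ext ⟨i, j⟩ ⟨k, l⟩
  have h := RingQuot.mkAlgHom_rel ℂ (OrthRel.rtt (q := q) i j k l)
  simp only [map_sum, map_smul, map_mul] at h
  simpa [Matrix.mul_apply, Fintype.sum_prod_type, scalarMatrix, genTensor, gen,
    Algebra.smul_def, ← Algebra.commutes] using h

theorem scalarMatrix_smul (q : ℝ) (m : ℕ) (c : ℝ)
    (A : Matrix (Fin m × Fin m) (Fin m × Fin m) ℝ) :
    scalarMatrix q m (c • A) = (c : ℂ) • scalarMatrix q m A := by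
  ext a b
  change algebraMap ℂ (OrthGroup q m) ((c * A a b : ℝ) : ℂ) =
    (c : ℂ) • algebraMap ℂ (OrthGroup q m) (A a b : ℂ)
  rw [Complex.ofReal_mul, map_mul, Algebra.smul_def]

theorem commute_antisymmetrizer (q : ℝ) (m : ℕ) :
    Commute (scalarMatrix q m (antisymmetrizer q m)) (genTensor q m) := by
  have key : ∀ c : ℝ, Commute
      (scalarMatrix q m (braid q m - c • (1 : Matrix (Fin m × Fin m) (Fin m × Fin m) ℝ)))
      (genTensor q m) := by
    intro c
    rw [map_sub, scalarMatrix_smul, map_one]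
    exact (commute_braid q m).sub_left ((Commute.one_left _).smul_left _)
  unfold antisymmetrizer
  rw [scalarMatrix_smul, map_mul]
  exact ((key _).mul_left (key _)).smul_left _

theorem antisymm_coord (q : ℝ) (m : ℕ) (i j : Fin m) :
    ∑ k, ∑ l, (antisymmetrizer q m (i, j) (k, l) : ℂ) • (coord q m k * coord q m l) = 0 := by
  have h := RingQuot.mkAlgHom_rel ℂ (PolyRel.antisymm (q := q) i j)
  simp only [map_sum, map_smul, map_mul, map_zero] at h
  exact h

theorem antisymm_gen (q : ℝ) (m : ℕ) (i j a b : Fin m) :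
    ∑ k, ∑ l, (antisymmetrizer q m (i, j) (k, l) : ℂ) • (gen q m k a * gen q m l b) =
      ∑ k, ∑ l, (antisymmetrizer q m (k, l) (a, b) : ℂ) • (gen q m i k * gen q m j l) := by
  have h := congrFun (congrFun (commute_antisymmetrizer q m).eq (i, j)) (a, b)
  simpa [Matrix.mul_apply, Fintype.sum_prod_type, scalarMatrix, genTensor,
    Algebra.smul_def, ← Algebra.commutes] using h

theorem sum_swap {m : ℕ} {A : Type*} [AddCommMonoid A] (F : Fin m → Fin m → Fin m → Fin m → A) :
    ∑ k, ∑ l, ∑ a, ∑ b, F k l a b = ∑ a, ∑ b, ∑ k, ∑ l, F k l a b := by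
  calc
    _ = ∑ k, ∑ a, ∑ l, ∑ b, F k l a b := Finset.sum_congr rfl fun _ _ => Finset.sum_comm
    _ = ∑ a, ∑ k, ∑ l, ∑ b, F k l a b := Finset.sum_comm
    _ = ∑ a, ∑ k, ∑ b, ∑ l, F k l a b :=
      Finset.sum_congr rfl fun _ _ => Finset.sum_congr rfl fun _ _ => Finset.sum_comm
    _ = _ := Finset.sum_congr rfl fun _ _ => Finset.sum_comm

theorem coaction_rel (q : ℝ) (m : ℕ) (i j : Fin m) :
    FreeAlgebra.lift ℂ (fun i : Fin m => ∑ j, gen q m i j ⊗ₜ[ℂ] coord q m j)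
      (∑ k, ∑ l, (antisymmetrizer q m (i, j) (k, l) : ℂ) •
        (FreeAlgebra.ι ℂ k * FreeAlgebra.ι ℂ l)) =
    FreeAlgebra.lift ℂ (fun i : Fin m => ∑ j, gen q m i j ⊗ₜ[ℂ] coord q m j) 0 := by
  simp only [map_sum, map_smul, map_mul, map_zero, FreeAlgebra.lift_ι_apply]
  calc
    _ = ∑ a, ∑ b, (∑ k, ∑ l, (antisymmetrizer q m (i, j) (k, l) : ℂ) •
          (gen q m k a * gen q m l b)) ⊗ₜ[ℂ] (coord q m a * coord q m b) := by
      simp only [Finset.sum_mul_sum, Algebra.TensorProduct.tmul_mul_tmul, Finset.smul_sum,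
        TensorProduct.sum_tmul, TensorProduct.smul_tmul']
      exact sum_swap _
    _ = ∑ k, ∑ l, (gen q m i k * gen q m j l) ⊗ₜ[ℂ]
          (∑ a, ∑ b, (antisymmetrizer q m (k, l) (a, b) : ℂ) •
            (coord q m a * coord q m b)) := by
      simp only [antisymm_gen, TensorProduct.sum_tmul, TensorProduct.tmul_sum,
        TensorProduct.smul_tmul]
      exact (sum_swap _).symm
    _ = 0 := by simp only [antisymm_coord, TensorProduct.tmul_zero, Finset.sum_const_zero]

/-- The left coaction `𝒫 → O_q(m) ⊗ 𝒫`: the algebra morphism with `x^i ↦ t^i_j ⊗ x^j`. -/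
def coaction (q : ℝ) (m : ℕ) : Poly q m →ₐ[ℂ] OrthGroup q m ⊗[ℂ] Poly q m :=
  RingQuot.liftAlgHom ℂ
    ⟨FreeAlgebra.lift ℂ (fun i : Fin m => ∑ j, gen q m i j ⊗ₜ[ℂ] coord q m j), by
      rintro _ _ ⟨i, j⟩
      exact coaction_rel q m i j⟩

/-- A linear functional `J` on `𝒫` is invariant under the coaction `δ` of `O_q(m)` if
`(id ⊗ J) (δ R) = J(R) 1` in `O_q(m) ⊗ ℂ = O_q(m)` for all `R`. -/
def IsCoinvariant (q : ℝ) (m : ℕ) (J : Poly q m →ₗ[ℂ] ℂ) : Prop :=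
  ∀ R : Poly q m,
    TensorProduct.rid ℂ (OrthGroup q m)
      (LinearMap.lTensor (OrthGroup q m) J (coaction q m R)) = J R • (1 : OrthGroup q m)

/-! ### The differential calculus -/

/-- The operators `∂^i` on `𝒫` are the partial derivatives of the calculus on `ℝ^m_q`:
`∂^i(1) = 0` and `∂^i x^j = C^{ij} + q (R̂⁻¹)^{ij}_{kl} x^k ∂^l` as operators on `𝒫`. -/
def IsPartialDerivatives (q : ℝ) (m : ℕ) (D : Fin m → Module.End ℂ (Poly q m)) : Prop :=
  (∀ i, D i 1 = 0) ∧
    ∀ (i j : Fin m) (f : Poly q m),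
      D i (coord q m j * f) = (metric q m i j : ℂ) • f
        + (q : ℂ) • ∑ k, ∑ l, ((braid q m)⁻¹ (i, j) (k, l) : ℂ) • (coord q m k * D l f)

/-- The Laplace operator `Δ = ∂^i C_{ij} ∂^j`. -/
def laplacian (q : ℝ) (m : ℕ) (D : Fin m → Module.End ℂ (Poly q m)) :
    Module.End ℂ (Poly q m) :=
  ∑ i, ∑ j, (metric q m i j : ℂ) • (D i * D j)

/-- The constant `μ = 1 + q ^ (2 - m)`. -/
def mu (q : ℝ) (m : ℕ) : ℝ := 1 + q ^ (2 - (m : ℤ))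

/-- The coefficient `2 Γ_{q²}(1/2) ^ m / (μ ^ (2 k) [k]_{q²}! Γ_{q²}(k + m / 2))` of the
Pizzetti formula. -/
def pizzettiCoeff (q : ℝ) (m k : ℕ) : ℝ :=
  2 * qGamma (q ^ 2) (1 / 2) ^ m /
    (mu q m ^ (2 * k) * qFactorial (q ^ 2) k * qGamma (q ^ 2) (k + (m : ℝ) / 2))

end QuantumEuclidean

end

open scoped TensorProduct

noncomputable section

namespace QuantumEuclidean

/-! Write ν = q - q⁻¹, ζ = q^(1-m) and K for the rank one matrix C^{ij} C_{kl}. Then R̂² = νR̂ + 1 -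
νζK and R̂K = ζK. Everything rests on the braid relation (`braid_relation`) and on the crossing
symmetry (`braidInv_crossing`), which rotates R̂⁻¹ into R̂ at the price of metric coefficients.
Together they show that t^b_c ↦ (R̂⁻¹)^{ab}_{cd} is a representation of O_q(m) (`braidRep`).
Composed with the coaction it gives an algebra morphism `twist` from 𝒫 to matrices over 𝒫, which
describes how x^a moves through a polynomial.

Derivatives: the braided Leibniz rule is the product rule of block triangular matrices with diagonal
blocks q·twist(x^b) and x^b and with the column C^{ab} off the diagonal. The relations of 𝒫 are
respected because `twist` is a morphism and because P_A(1 + qR̂) = 0. Uniqueness is an induction on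
words.

The Pizzetti functional: crossing gives Δx^j = μ∂^j + q²x^jΔ, and from this Δ𝐱² = q²𝐱²Δ + μ²[n +
m/2]_{q²} in degree n (`laplace_normSq_mul`). Hence (Δ^{k+1}𝐱²f)(0) = μ²[k+1][k + m/2] (Δ^k f)(0)
for f of degree 2k, and the functional equation of the q-Gamma function gives the Pizzetti
coefficients the inverse ratio. Coinvariance holds because Δ commutes with the coaction and
evaluation at 0 is coinvariant.

Uniqueness needs no decomposition into harmonics; it is a twisted trace argument
(`IsCoinvariant.eq_zero`). Coinvariance, tested in `braidRep`, together with J(𝐱²f) = J(f) gives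
J(x^a v) = q^d ζ⁻¹ met_a² J(v x^a) for a word v of length d, once J kills all shorter words.
Rotating a word w of length d + 1 completely yields J(w) = (q^d ζ⁻¹)^{d+1} (∏ met)² J(w), and the
torus element diag(met) removes the product. The remaining factor q^{(d+m-1)(d+1)} is less than 1
for d ≥ 1, so J(w) = 0; words of length one are killed by the torus element -1. Thus J is determined
by J(1). -/

/-! ### Entries of the braid matrix -/

/-- The constant `q - q⁻¹`. -/
def nu (q : ℝ) : ℝ := q - q⁻¹

/-- The eigenvalue `q ^ (1 - m)` of the braid matrix. -/
def zeta (q : ℝ) (m : ℕ) : ℝ := q ^ (1 - (m : ℤ))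

/-- The non-zero entry `q ^ (-ρ_i)` of the `i`-th row of the metric. -/
def met (q : ℝ) (m : ℕ) (i : Fin m) : ℝ := q ^ (-rho m i)

/-- The entry of the braid matrix at `(i, i'), (i', i)`. -/
def alpha (q : ℝ) {m : ℕ} (i : Fin m) : ℝ := if i = i.rev then 1 else q⁻¹

/-- The block of the braid matrix on the vectors `e_i ⊗ e_{i'}`. -/
def zeroBlock (q : ℝ) (m : ℕ) (x y : Fin m) : ℝ :=
  (if y = x.rev then alpha q x else 0) + (if x = y ∧ x < x.rev then nu q else 0)
    - (if y < x.rev then nu q * (met q m x * met q m y) else 0)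

theorem metric_apply (q : ℝ) (m : ℕ) (i j : Fin m) :
    metric q m i j = if j = i.rev then met q m i else 0 := rfl

theorem rho_rev (m : ℕ) (i : Fin m) : rho m i.rev = -rho m i := by
  have hi := i.isLt
  unfold rho
  rw [Fin.val_rev]
  have h : ((m - (i + 1) : ℕ) : ℝ) = (m : ℝ) - (i + 1) := by
    rw [Nat.cast_sub (by omega)]; push_cast; ring
  split_ifs <;> first | omega | (rw [h]; ring) | simp_all

theorem met_pos {q : ℝ} (hq : 0 < q) (m : ℕ) (i : Fin m) : 0 < met q m i :=
  Real.rpow_pos_of_pos hq _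

theorem met_mul_rev {q : ℝ} (hq : 0 < q) {m : ℕ} (i : Fin m) :
    met q m i * met q m i.rev = 1 := by
  unfold met
  rw [rho_rev, ← Real.rpow_add hq]; simp

theorem met_rev_mul {q : ℝ} (hq : 0 < q) {m : ℕ} (i : Fin m) :
    met q m i.rev * met q m i = 1 := by
  rw [mul_comm, met_mul_rev hq]

theorem zeta_pos {q : ℝ} (hq : 0 < q) (m : ℕ) : 0 < zeta q m := zpow_pos hq _

theorem nu_neg {q : ℝ} (hq : 0 < q) (hq1 : q < 1) : nu q < 0 := by
  have : 1 < q⁻¹ := (one_lt_inv₀ hq).2 hq1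
  unfold nu; linarith

theorem rev_eq_iff {m : ℕ} {i j : Fin m} : i.rev = j ↔ i = j.rev := by
  constructor <;> rintro rfl <;> simp

theorem met_eq_one_of_eq_rev {q : ℝ} (hq : 0 < q) {m : ℕ} {i : Fin m} (h : i = i.rev) :
    met q m i = 1 := by
  have h1 := met_mul_rev hq i
  rw [← h] at h1
  nlinarith [met_pos hq m i]

theorem alpha_rev (q : ℝ) {m : ℕ} (i : Fin m) : alpha q i.rev = alpha q i := by
  unfold alpha
  rw [Fin.rev_rev]
  simp only [eq_comm]

theorem braid_zero (q : ℝ) (m : ℕ) (x y : Fin m) :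
    braid q m (x, x.rev) (y, y.rev) = zeroBlock q m x y := by
  have e1 : (x = y.rev ∧ x.rev = y) ↔ y = x.rev := by
    constructor
    · rintro ⟨_, rfl⟩; rfl
    · rintro rfl; simp
  have e2 : (x = y ∧ x.rev = y.rev ∧ x < x.rev) ↔ (x = y ∧ x < x.rev) := by
    constructor
    · rintro ⟨a, _, b⟩; exact ⟨a, b⟩
    · rintro ⟨rfl, b⟩; exact ⟨rfl, rfl, b⟩
  simp only [braid, zeroBlock, e1, e2, metric_apply, if_true, Fin.rev_rev, alpha, nu]
  congr 2
  by_cases h : x = x.rev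
  · simp [← h]
  · simp [h]

/-- Away from the vectors e_i ⊗ e_{i'} the metric term vanishes and the Hecke matrix of type A
remains. With `braid_zero_of_ne` this splits off the block `zeroBlock`; all later computations
follow this splitting. -/
theorem braid_of_ne (q : ℝ) {m : ℕ} {i j : Fin m} (h : j ≠ i.rev) (k l : Fin m) :
    braid q m (i, j) (k, l) =
      (if k = j ∧ l = i then (if i = j then q else 1) else 0) +
      (if k = i ∧ l = j ∧ i < j then nu q else 0) := by
  have h' : i ≠ j.rev := fun e => h (by rw [e, Fin.rev_rev])
  simp only [braid, metric_apply, h, h', if_false, zero_mul, mul_zero, ite_self, sub_zero, nu,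
    false_and, ne_eq, not_false_eq_true, and_true]
  congr 1
  · congr 1
    exact propext ⟨fun ⟨a, b⟩ => ⟨b.symm, a.symm⟩, fun ⟨a, b⟩ => ⟨b.symm, a.symm⟩⟩
  · congr 1
    exact propext ⟨fun ⟨a, b, c⟩ => ⟨a.symm, b.symm, c⟩, fun ⟨a, b, c⟩ => ⟨a.symm, b.symm, c⟩⟩

theorem braid_zero_of_ne (q : ℝ) {m : ℕ} (x : Fin m) {k l : Fin m} (h : l ≠ k.rev) :
    braid q m (x, x.rev) (k, l) = 0 := by
  have h1 : ¬ (x = l ∧ x.rev = k) := by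
    rintro ⟨rfl, rfl⟩; simp at h
  have h2 : ¬ (x = k ∧ x.rev = l ∧ x < x.rev) := by
    rintro ⟨rfl, rfl, _⟩; simp at h
  simp [braid, metric_apply, h, h1, h2]

theorem zeroBlock_symm (q : ℝ) {m : ℕ} (x y : Fin m) : zeroBlock q m x y = zeroBlock q m y x := by
  have e1 : x = y.rev ↔ y = x.rev := by rw [eq_comm, rev_eq_iff]
  have e2 : (y = x ∧ y < y.rev) ↔ (x = y ∧ x < x.rev) := by
    constructor <;> · rintro ⟨rfl, b⟩; exact ⟨rfl, b⟩
  have e3 : y < x.rev ↔ x < y.rev := by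
    rw [Fin.lt_def, Fin.lt_def, Fin.val_rev, Fin.val_rev]; omega
  simp only [zeroBlock, e1, e2, e3, mul_comm (met q m x)]
  congr 2
  by_cases h : y = x.rev
  · rw [h, alpha_rev]
  · simp [h]

theorem braid_symm (q : ℝ) (m : ℕ) (i j k l : Fin m) :
    braid q m (i, j) (k, l) = braid q m (k, l) (i, j) := by
  by_cases h : j = i.rev
  · subst h
    by_cases h' : l = k.rev
    · subst h'
      rw [braid_zero, braid_zero, zeroBlock_symm]
    · rw [braid_zero_of_ne q i h', braid_of_ne q h']
      have h1 : ¬ (i = l ∧ i.rev = k) := by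
        rintro ⟨rfl, rfl⟩; simp at h'
      have h2 : ¬ (i = k ∧ i.rev = l ∧ k < l) := by
        rintro ⟨rfl, rfl, _⟩; simp at h'
      simp [h1, h2]
  · by_cases h' : l = k.rev
    · subst h'
      rw [braid_zero_of_ne q k h, braid_of_ne q h]
      have h1 : ¬ (k = j ∧ k.rev = i) := by
        rintro ⟨rfl, rfl⟩; simp at h
      have h2 : ¬ (k = i ∧ k.rev = j ∧ i < j) := by
        rintro ⟨rfl, rfl, _⟩; simp at h
      simp [h1, h2]
    · rw [braid_of_ne q h, braid_of_ne q h']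
      congr 1
      · by_cases h1 : k = j ∧ l = i
        · obtain ⟨rfl, rfl⟩ := h1
          simp [eq_comm]
        · rw [if_neg h1, if_neg (fun e => h1 ⟨e.2.symm, e.1.symm⟩)]
      · by_cases h1 : k = i ∧ l = j
        · obtain ⟨rfl, rfl⟩ := h1
          simp
        · rw [if_neg (fun e => h1 ⟨e.1, e.2.1⟩), if_neg (fun e => h1 ⟨e.1.symm, e.2.1.symm⟩)]

theorem braid_transpose (q : ℝ) (m : ℕ) : (braid q m).transpose = braid q m := by
  ext ⟨i, j⟩ ⟨k, l⟩
  exact braid_symm q m k l i j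

/-- The map (i, j) ↦ (j', i') fixes each pair (i, i'), and elsewhere the matrix depends only on
equality and order of indices, which the map preserves. -/
theorem braid_flip (q : ℝ) (m : ℕ) (i j k l : Fin m) :
    braid q m (i, j) (k, l) = braid q m (j.rev, i.rev) (l.rev, k.rev) := by
  by_cases h : j = i.rev
  · subst h
    by_cases h' : l = k.rev
    · subst h'
      simp
    · rw [braid_zero_of_ne q i h', Fin.rev_rev, braid_zero_of_ne]
      intro e
      exact h' (by simpa using e.symm)
  · have h' : i.rev ≠ j.rev.rev := fun e => h (by simpa using e.symm)
    rw [braid_of_ne q h, braid_of_ne q h']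
    simp only [Fin.rev_inj, Fin.rev_lt_rev]
    congr 1
    · congr 1
      · exact propext and_comm
      · simp [eq_comm]
    · congr 1
      exact propext ⟨fun ⟨a, b, c⟩ => ⟨b, a, c⟩, fun ⟨a, b, c⟩ => ⟨b, a, c⟩⟩

/-- The braid matrix preserves the weights of the torus `t = diag χ`, `χ_i χ_{i'} = 1`. -/
theorem braid_weight (q : ℝ) {m : ℕ} {χ : Fin m → ℝ} (hχ : ∀ i, χ i * χ i.rev = 1)
    (i j k l : Fin m) :
    braid q m (i, j) (k, l) * (χ i * χ j) = braid q m (i, j) (k, l) * (χ k * χ l) := by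
  by_cases h : j = i.rev
  · subst h
    by_cases h' : l = k.rev
    · subst h'
      rw [hχ, hχ]
    · rw [braid_zero_of_ne q i h']; simp
  · rw [braid_of_ne q h]
    by_cases h1 : k = j ∧ l = i
    · obtain ⟨rfl, rfl⟩ := h1
      rw [mul_comm (χ k)]
    · by_cases h2 : k = i ∧ l = j
      · obtain ⟨rfl, rfl⟩ := h2; rfl
      · rw [if_neg h1, if_neg (fun e => h2 ⟨e.1, e.2.1⟩)]; simp

/-! ### The sums of the squares of the metric coefficients -/

/-- The value of `ρ` at the natural number `n`. -/
def rhoNat (m n : ℕ) : ℝ :=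
  if 2 * n + 1 < m then (m : ℝ) / 2 - 1 - n else if 2 * n + 1 = m then 0 else (m : ℝ) / 2 - n

/-- A telescoping sum: one step multiplies the squared coefficient by q², except around the middle,
where the correction terms absorb the irregular steps of ρ. All products of zero-weight blocks below
reduce to this identity. -/
theorem nu_mul_sum_range {q : ℝ} (hq : 0 < q) {m s : ℕ} (hs : s < m) :
    nu q * ∑ p ∈ Finset.range s, (q ^ (-rhoNat m p)) ^ 2 =
      (if 2 * s + 1 = m then 1 else q⁻¹) * (q ^ (-rhoNat m s)) ^ 2
        + (if m < 2 * s + 1 then nu q else 0) - zeta q m := by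
  have sq : ∀ u : ℝ, (q ^ u) ^ 2 = q ^ (2 * u) := fun u => by
    rw [mul_comm, Real.rpow_mul hq.le]; norm_num
  have e1 : q⁻¹ = q ^ (-1 : ℝ) := (Real.rpow_neg_one q).symm
  induction s with
  | zero =>
    have hz : zeta q m = q ^ (1 - (m : ℝ)) := by
      unfold zeta; rw [← Real.rpow_intCast]; push_cast; rfl
    rw [hz]
    simp only [Finset.range_zero, Finset.sum_empty, mul_zero, zero_add, sq]
    rcases Nat.lt_or_ge 1 m with h | h
    · rw [if_neg (by omega), if_neg (by omega), rhoNat, if_pos (by omega), e1,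
        ← Real.rpow_add hq]
      rw [eq_comm, add_zero, sub_eq_zero]
      congr 1
      push_cast
      ring
    · have : m = 1 := by omega
      subst this
      simp [rhoNat]
  | succ s ih =>
    rw [Finset.sum_range_succ, mul_add, ih (by omega)]
    simp only [sq]
    have q2 : q⁻¹ * q ^ (2 : ℝ) = q := by
      rw [e1, ← Real.rpow_add hq]; norm_num
    -- The index `s + 1` lies before the middle, on it (odd `m`), or after it. In the last case `s`
    -- lies before the middle (`m = 2 s + 2`, the two central zeros of ρ), on it, or after it.
    rcases lt_trichotomy (2 * s + 3) m with h | h | h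
    · rw [if_neg (by omega), if_neg (by omega), if_neg (by omega), if_neg (by omega)]
      unfold rhoNat
      rw [if_pos (by omega), if_pos (by omega)]
      have : (2 * -((m : ℝ) / 2 - 1 - ((s + 1 : ℕ) : ℝ))) =
          2 + (2 * -((m : ℝ) / 2 - 1 - (s : ℝ))) := by push_cast; ring
      rw [this, Real.rpow_add hq, ← mul_assoc, q2, nu]; ring
    · rw [if_neg (by omega), if_neg (by omega), if_pos (by omega), if_neg (by omega)]
      unfold rhoNat
      rw [if_pos (by omega), if_neg (by omega), if_pos (by omega), ← h]
      have : (2 * -(((2 * s + 3 : ℕ) : ℝ) / 2 - 1 - (s : ℝ))) = -1 := by push_cast; ring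
      rw [this, ← e1]
      have := mul_inv_cancel₀ hq.ne'
      simp [nu]; linear_combination this
    · rcases lt_trichotomy (2 * s + 1) m with h' | h' | h'
      · rw [if_neg (by omega), if_neg (by omega), if_neg (by omega), if_pos (by omega)]
        unfold rhoNat
        rw [if_pos (by omega), if_neg (by omega), if_neg (by omega)]
        have hm : (m : ℝ) = 2 * s + 2 := by
          have : m = 2 * s + 2 := by omega
          rw [this]; push_cast; ring
        rw [hm]
        have h1 : (2 * -((2 * (s : ℝ) + 2) / 2 - 1 - s)) = 0 := by ring
        have h2 : (2 * -((2 * (s : ℝ) + 2) / 2 - ((s + 1 : ℕ) : ℝ))) = 0 := by push_cast; ring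
        rw [h1, h2, Real.rpow_zero]
        ring
      · rw [if_pos (by omega), if_neg (by omega), if_neg (by omega), if_pos (by omega)]
        unfold rhoNat
        rw [if_neg (by omega), if_pos (by omega), if_neg (by omega), if_neg (by omega), ← h']
        have : (2 * -(((2 * s + 1 : ℕ) : ℝ) / 2 - ((s + 1 : ℕ) : ℝ))) = 1 := by push_cast; ring
        rw [this]
        have := mul_inv_cancel₀ hq.ne'
        simp [nu]; linear_combination -this
      · rw [if_neg (by omega), if_pos (by omega), if_neg (by omega), if_pos (by omega)]
        unfold rhoNat
        rw [if_neg (by omega), if_neg (by omega), if_neg (by omega), if_neg (by omega)]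
        have : (2 * -((m : ℝ) / 2 - ((s + 1 : ℕ) : ℝ))) =
          2 + (2 * -((m : ℝ) / 2 - (s : ℝ))) := by push_cast; ring
        rw [this, Real.rpow_add hq, ← mul_assoc, q2, nu]; ring

theorem nu_mul_sum_met {q : ℝ} (hq : 0 < q) {m : ℕ} (s : Fin m) :
    nu q * ∑ p : Fin m, (if p < s then met q m p ^ 2 else 0) =
      alpha q s * met q m s ^ 2 + (if s.rev < s then nu q else 0) - zeta q m := by
  have h := nu_mul_sum_range hq s.isLt
  have e1 : s.rev < s ↔ m < 2 * (s : ℕ) + 1 := by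
    rw [Fin.lt_def, Fin.val_rev]; omega
  have e2 : s = s.rev ↔ 2 * (s : ℕ) + 1 = m := by
    rw [Fin.ext_iff, Fin.val_rev]; omega
  simp only [alpha, e1, e2]
  have h2 : ∑ p : Fin m, (if p < s then met q m p ^ 2 else 0) =
      ∑ p ∈ Finset.range s, (q ^ (-rhoNat m p)) ^ 2 := by
    rw [← Finset.sum_filter]
    refine Finset.sum_bij (fun p _ => (p : ℕ)) ?_ ?_ ?_ ?_
    · intro p hp
      exact Finset.mem_range.2 (Finset.mem_filter.1 hp).2
    · intro p _ p' _ e; exact Fin.ext e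
    · intro n hn
      have hn' : n < s := Finset.mem_range.1 hn
      exact ⟨⟨n, hn'.trans s.isLt⟩, Finset.mem_filter.2 ⟨Finset.mem_univ _, hn'⟩, rfl⟩
    · intro p _; rfl
  rw [h2]
  exact h

/-! ### Rows of the braid matrix -/

theorem sum_braid_of_ne (q : ℝ) {m : ℕ} {i j : Fin m} (h : j ≠ i.rev)
    (f : Fin m → Fin m → ℝ) :
    ∑ k, ∑ l, braid q m (i, j) (k, l) * f k l =
      (if i = j then q else 1) * f j i + (if i < j then nu q else 0) * f i j := by
  have e : ∀ k l, braid q m (i, j) (k, l) * f k l =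
      (if k = j then (if l = i then (if i = j then q else 1) * f j i else 0) else 0) +
      (if k = i then (if l = j then (if i < j then nu q else 0) * f i j else 0) else 0) := by
    intro k l
    rw [braid_of_ne q h, add_mul]
    congr 1
    · by_cases h1 : k = j
      · by_cases h2 : l = i
        · subst h1 h2; simp
        · simp [h2]
      · simp [h1]
    · by_cases h1 : k = i
      · by_cases h2 : l = j
        · subst h1 h2; simp
        · simp [h2]
      · simp [h1]
  simp only [e, Finset.sum_add_distrib]
  simp

theorem sum_braid_zero (q : ℝ) {m : ℕ} (x : Fin m) (f : Fin m → Fin m → ℝ) :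
    ∑ k, ∑ l, braid q m (x, x.rev) (k, l) * f k l = ∑ y, zeroBlock q m x y * f y y.rev := by
  refine Finset.sum_congr rfl fun k _ => ?_
  rw [Finset.sum_eq_single k.rev]
  · rw [braid_zero]
  · intro l _ hl
    rw [braid_zero_of_ne q x hl, zero_mul]
  · simp

theorem sum_zeroBlock (q : ℝ) {m : ℕ} (x : Fin m) (g : Fin m → ℝ) :
    ∑ y, zeroBlock q m x y * g y =
      alpha q x * g x.rev + (if x < x.rev then nu q else 0) * g x
        - nu q * met q m x * ∑ y, (if y < x.rev then met q m y * g y else 0) := by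
  simp only [zeroBlock, sub_mul, add_mul, Finset.sum_sub_distrib, Finset.sum_add_distrib]
  congr 1
  · congr 1
    · simp [ite_mul]
    · rw [Finset.sum_eq_single x]
      · simp
      · intro y _ hy
        rw [if_neg (fun e => hy e.1.symm), zero_mul]
      · simp
  · rw [Finset.mul_sum]
    refine Finset.sum_congr rfl fun y _ => ?_
    split_ifs <;> ring

/-- The telescoped sum cancels the two other terms of the row and leaves ζ. This makes the metric an
eigenvector of R̂. -/
theorem sum_zeroBlock_met {q : ℝ} (hq : 0 < q) {m : ℕ} (x : Fin m) :
    ∑ y, zeroBlock q m x y * met q m y = zeta q m * met q m x := by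
  rw [sum_zeroBlock]
  have h := nu_mul_sum_met hq x.rev
  simp only [← pow_two]
  rw [Fin.rev_rev, alpha_rev] at h
  rw [mul_right_comm, h]
  have h1 := met_mul_rev hq x
  linear_combination (- alpha q x * met q m x.rev) * h1

/-- The value of a product of three zero blocks, the middle one diagonal. -/
theorem sum_zeroBlock_mul_zeroBlock (q : ℝ) {m : ℕ} (x z : Fin m) (D : Fin m → ℝ) :
    ∑ y, zeroBlock q m x y * (D y * zeroBlock q m y z) =
      alpha q x * (D x.rev * zeroBlock q m x.rev z)
        + (if x < x.rev then nu q else 0) * (D x * zeroBlock q m x z)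
        - nu q * met q m x * ((if z.rev < x.rev then met q m z.rev * D z.rev * alpha q z else 0)
          + (if z < x.rev ∧ z < z.rev then met q m z * D z * nu q else 0)
          - nu q * met q m z *
            ∑ y, (if y < x.rev ∧ y < z.rev then met q m y ^ 2 * D y else 0)) := by
  rw [sum_zeroBlock]
  congr 2
  -- By symmetry of the block the remaining sum is again a row sum, of the row `z`, with the
  -- constraint on `y` moved into the vector.
  have e : ∀ y, (if y < x.rev then met q m y * (D y * zeroBlock q m y z) else 0) =
      zeroBlock q m z y * (if y < x.rev then met q m y * D y else 0) := by
    intro y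
    rw [zeroBlock_symm]
    split_ifs <;> ring
  simp only [e]
  rw [sum_zeroBlock]
  congr 1
  · congr 1
    · split_ifs <;> ring
    · by_cases h1 : z < x.rev <;> by_cases h2 : z < z.rev <;> simp [h1, h2]; ring
  · congr 1
    refine Finset.sum_congr rfl fun y _ => ?_
    by_cases h1 : y < x.rev <;> by_cases h2 : y < z.rev <;> simp [h1, h2]; ring

/-- Both sides are symmetric, so z ≤ x may be assumed; then y < x' implies y < z' and the leftover
sum is the telescoping one. -/
theorem sum_zeroBlock_zeroBlock {q : ℝ} (hq : 0 < q) {m : ℕ} (x z : Fin m) :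
    ∑ y, zeroBlock q m x y * zeroBlock q m y z =
      nu q * zeroBlock q m x z + (if x = z then 1 else 0)
        - nu q * zeta q m * (met q m x * met q m z) := by
  wlog h : z ≤ x generalizing x z
  · have := this z x (le_of_not_ge h)
    rw [zeroBlock_symm q x z, mul_comm (met q m x)]
    simp only [eq_comm (a := x), ← this]
    exact Finset.sum_congr rfl fun y _ => by
      rw [zeroBlock_symm q x y, zeroBlock_symm q y z, mul_comm]
  have h' : x.rev ≤ z.rev := Fin.rev_le_rev.2 h
  have hs := sum_zeroBlock_mul_zeroBlock q x z (fun _ => 1)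
  simp only [one_mul, mul_one] at hs
  rw [hs]
  clear hs
  have e : ∀ y, (if y < x.rev ∧ y < z.rev then met q m y ^ 2 else 0) =
      (if y < x.rev then met q m y ^ 2 else 0) := by
    intro y
    congr 1
    exact propext ⟨And.left, fun a => ⟨a, a.trans_le h'⟩⟩
  simp only [e]
  have h1 := nu_mul_sum_met hq x.rev
  rw [Fin.rev_rev, alpha_rev] at h1
  rw [if_neg (not_lt.2 h'), mul_right_comm (nu q) (met q m z), h1]
  have hx := met_mul_rev hq x
  have hz := met_mul_rev hq z
  have hqq := mul_inv_cancel₀ hq.ne'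
  rcases h.eq_or_lt with rfl | h2
  · rcases lt_trichotomy z z.rev with h3 | h3 | h3
    · simp [zeroBlock, alpha, h3, h3.ne, h3.ne', h3.not_gt, nu]
      grind
    · have := met_eq_one_of_eq_rev hq h3
      simp [zeroBlock, alpha, ← h3, this, nu]
      ring
    · simp [zeroBlock, alpha, h3, h3.ne, h3.ne', h3.not_gt, nu]
      grind
  · by_cases hxz : x.rev = z
    · subst hxz
      rw [Fin.rev_rev] at *
      simp [zeroBlock, alpha, h2, h2.ne, h2.ne', h2.not_gt, nu]
      grind
    · have hne : z ≠ x.rev := fun e => hxz e.symm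
      have l1 : x.rev.val = m - (x + 1) := Fin.val_rev x
      have l2 : z.rev.val = m - (z + 1) := Fin.val_rev z
      have l3 := x.isLt
      rcases lt_or_gt_of_ne hne with h3 | h3
      · have h4 : z < z.rev := by rw [Fin.lt_def] at *; omega
        rcases lt_trichotomy x x.rev with h5 | h5 | h5
        · simp [zeroBlock, h2.ne', h3, h4, h5, hne, hxz, h2]
          grind
        · simp [zeroBlock, h2.ne', ← h5, h4, h2.ne, h2]
          grind
        · simp [zeroBlock, h2.ne', h3, h4, h5.not_gt, hne, hxz, h2]
          grind
      · have h5 : ¬ x < x.rev := by rw [Fin.lt_def] at *; omega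
        simp [zeroBlock, h2.ne, h2.ne', h3.not_gt, h5, hne, hxz, h2]
        grind

/-! ### The inverse of the braid matrix -/

/-- The rank one matrix `C^{ij} C_{kl}`. -/
def capCup (q : ℝ) (m : ℕ) : Matrix (Fin m × Fin m) (Fin m × Fin m) ℝ :=
  fun ij kl => metric q m ij.1 ij.2 * metric q m kl.1 kl.2

/-- The inverse `R̂ - (q - q⁻¹) (1 - K)` of the braid matrix. -/
def braidInv (q : ℝ) (m : ℕ) : Matrix (Fin m × Fin m) (Fin m × Fin m) ℝ :=
  braid q m - nu q • (1 : Matrix (Fin m × Fin m) (Fin m × Fin m) ℝ) + nu q • capCup q m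

theorem sum_metric (q : ℝ) {m : ℕ} {M : Type*} [AddCommMonoid M] [Module ℝ M]
    (F : Fin m → Fin m → M) :
    ∑ i, ∑ j, metric q m i j • F i j = ∑ i, met q m i • F i i.rev := by
  simp [metric_apply, ite_smul]

theorem sum_braid_metric {q : ℝ} (hq : 0 < q) {m : ℕ} (i j : Fin m) :
    ∑ k, ∑ l, braid q m (i, j) (k, l) * metric q m k l = zeta q m * metric q m i j := by
  by_cases h : j = i.rev
  · subst h
    rw [sum_braid_zero q i (fun k l => metric q m k l)]
    simp only [metric_apply, if_true, sum_zeroBlock_met hq]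
  · have h' : i ≠ j.rev := fun e => h (by rw [e, Fin.rev_rev])
    rw [sum_braid_of_ne q h (fun k l => metric q m k l)]
    simp [metric_apply, h, h']

theorem braid_mul_capCup {q : ℝ} (hq : 0 < q) (m : ℕ) :
    braid q m * capCup q m = zeta q m • capCup q m := by
  ext ⟨i, j⟩ ⟨a, b⟩
  rw [Matrix.mul_apply, Fintype.sum_prod_type, Matrix.smul_apply, smul_eq_mul]
  simp only [capCup, ← mul_assoc, ← Finset.sum_mul]
  rw [sum_braid_metric hq]

theorem capCup_transpose (q : ℝ) (m : ℕ) : (capCup q m).transpose = capCup q m := by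
  ext ⟨i, j⟩ ⟨a, b⟩
  simp only [Matrix.transpose_apply, capCup, mul_comm]

theorem capCup_mul_braid {q : ℝ} (hq : 0 < q) (m : ℕ) :
    capCup q m * braid q m = zeta q m • capCup q m := by
  have h := congrArg Matrix.transpose (braid_mul_capCup hq m)
  rwa [Matrix.transpose_mul, Matrix.transpose_smul, capCup_transpose, braid_transpose] at h

/-- On e_i ⊗ e_j with j ≠ i' this is the Hecke relation, a consequence of q² = νq + 1; on the
zero-weight block it is `sum_zeroBlock_zeroBlock`. Both the inverse of R̂ and the form of P_A used
below come from it. -/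
theorem braid_mul_self {q : ℝ} (hq : 0 < q) (m : ℕ) :
    braid q m * braid q m = nu q • braid q m + 1 - (nu q * zeta q m) • capCup q m := by
  ext ⟨i, j⟩ ⟨a, b⟩
  rw [Matrix.mul_apply, Fintype.sum_prod_type]
  simp only [Matrix.sub_apply, Matrix.add_apply, Matrix.smul_apply, smul_eq_mul, capCup,
    Matrix.one_apply]
  by_cases h : j = i.rev
  · subst h
    rw [sum_braid_zero]
    by_cases h' : b = a.rev
    · subst h'
      simp only [braid_zero]
      rw [sum_zeroBlock_zeroBlock hq]
      simp [metric_apply]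
    · rw [braid_zero_of_ne q i h', Finset.sum_eq_zero]
      · have : ¬ (i = a ∧ i.rev = b) := by rintro ⟨rfl, rfl⟩; exact h' rfl
        simp [metric_apply, h', this]
      · intro y _
        rw [braid_zero_of_ne q y h', mul_zero]
  · have h' : i ≠ j.rev := fun e => h (by rw [e, Fin.rev_rev])
    rw [sum_braid_of_ne q h, braid_of_ne q h, braid_of_ne q h']
    have hqq := mul_inv_cancel₀ hq.ne'
    simp only [metric_apply, h, if_false, zero_mul, mul_zero, sub_zero, Prod.mk.injEq, nu]
    rcases lt_trichotomy i j with h1 | h1 | h1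
    · simp only [h1.ne, h1.ne', h1, h1.not_gt, if_false, and_false, and_true, if_true]
      by_cases h2 : a = i <;> by_cases h3 : b = j <;> by_cases h4 : a = j <;>
        by_cases h5 : b = i <;> simp [h2, h3, h4, h5, eq_comm] <;> grind
    · subst h1
      by_cases h2 : a = i <;> by_cases h3 : b = i <;> simp [h2, h3] <;> grind
    · simp only [h1.ne, h1.ne', h1, h1.not_gt, if_false, and_false, and_true]
      by_cases h2 : a = i <;> by_cases h3 : b = j <;> by_cases h4 : a = j <;>
        by_cases h5 : b = i <;> simp [h2, h3, h4, h5, eq_comm] <;> grind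

theorem braid_mul_braidInv {q : ℝ} (hq : 0 < q) (m : ℕ) : braid q m * braidInv q m = 1 := by
  rw [braidInv, mul_add, mul_sub, Matrix.mul_smul, Matrix.mul_smul, mul_one,
    braid_mul_capCup hq, braid_mul_self hq, smul_smul]
  abel

theorem braidInv_mul_braid {q : ℝ} (hq : 0 < q) (m : ℕ) : braidInv q m * braid q m = 1 :=
  mul_eq_one_comm.1 (braid_mul_braidInv hq m)

theorem inv_braid {q : ℝ} (hq : 0 < q) (m : ℕ) : (braid q m)⁻¹ = braidInv q m :=
  Matrix.inv_eq_right_inv (braid_mul_braidInv hq m)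

theorem capCup_mul_braidInv {q : ℝ} (hq : 0 < q) (m : ℕ) :
    capCup q m * braidInv q m = (zeta q m)⁻¹ • capCup q m := by
  have h := congrArg (· * braidInv q m) (capCup_mul_braid hq m)
  simp only [mul_assoc, braid_mul_braidInv hq, mul_one, Matrix.smul_mul] at h
  conv_rhs => rw [h]
  rw [smul_smul, inv_mul_cancel₀ (zeta_pos hq m).ne', one_smul]

theorem sum_metric_braidInv {q : ℝ} (hq : 0 < q) {m : ℕ} (k l : Fin m) :
    ∑ i, met q m i * braidInv q m (i, i.rev) (k, l) = (zeta q m)⁻¹ * metric q m k l := by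
  have h := congrFun (congrFun (capCup_mul_braidInv hq m) (k, k.rev)) (k, l)
  rw [Matrix.mul_apply, Fintype.sum_prod_type, Matrix.smul_apply, smul_eq_mul] at h
  simp only [capCup, mul_assoc, ← Finset.mul_sum] at h
  have h2 := sum_metric q (fun i j => braidInv q m (i, j) (k, l))
  simp only [smul_eq_mul] at h2
  rw [h2, metric_apply q m k k.rev, if_pos rfl] at h
  have := (met_pos hq m k).ne'
  apply mul_left_cancel₀ this
  rw [h]; ring

theorem sum_metric_braid {q : ℝ} (hq : 0 < q) {m : ℕ} (k l : Fin m) :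
    ∑ i, met q m i * braid q m (i, i.rev) (k, l) = zeta q m * metric q m k l := by
  rw [← sum_braid_metric hq]
  have h2 := sum_metric q (fun i j => braid q m (k, l) (i, j))
  simp only [smul_eq_mul] at h2
  simp only [braid_symm q m _ _ k l, mul_comm (braid _ _ _ _)]
  exact h2.symm

/-- The crossing symmetry between the braid matrix and its inverse. -/
theorem braidInv_crossing {q : ℝ} (hq : 0 < q) {m : ℕ} (i a k l : Fin m) :
    braidInv q m (i, a) (k, l) =
      met q m i * met q m l.rev * braid q m (a, l.rev) (i.rev, k) := by
  have hqq := mul_inv_cancel₀ hq.ne'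
  have hi := met_mul_rev hq i
  have hl := met_mul_rev hq l
  have ha := met_mul_rev hq a
  have hk := met_mul_rev hq k
  simp only [braidInv, braid, Matrix.sub_apply, Matrix.add_apply, Matrix.smul_apply, smul_eq_mul,
    capCup, metric_apply, Matrix.one_apply, Prod.mk.injEq, Fin.rev_rev, Fin.rev_inj,
    Fin.rev_lt_rev]
  -- Crossing preserves the permutation terms and exchanges the diagonal terms with the metric
  -- terms. The cases follow these three supports.
  by_cases h1 : i = l ∧ a = k
  · obtain ⟨rfl, rfl⟩ := h1
    by_cases h2 : i = a
    · subst h2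
      by_cases h3 : i = i.rev
      · have := met_eq_one_of_eq_rev hq h3
        simp [← h3, this]
      · have h3' : ¬ i.rev = i := fun e => h3 e.symm
        simp [h3, h3', nu]
        grind
    · by_cases h3 : a = i.rev
      · subst h3
        have h2' : ¬ i.rev = i := fun e => h2 e.symm
        simp [h2, h2', nu]
        grind
      · have h3' : ¬ i.rev = a := fun e => h3 e.symm
        have h4 : ¬ i = a.rev := fun e => h3 (by rw [e, Fin.rev_rev])
        have h2' : ¬ a = i := fun e => h2 e.symm
        simp [h2, h2', h3, h3', h4]
        grind
  · have h1' : ¬ (a = k ∧ l = i) := fun e => h1 ⟨e.2.symm, e.1⟩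
    by_cases h2 : i = k ∧ a = l
    · obtain ⟨rfl, rfl⟩ := h2
      have hne : i ≠ a := fun e => h1 ⟨e, e.symm⟩
      by_cases h3 : a = i.rev
      · subst h3
        rcases lt_or_gt_of_ne hne with h4 | h4
        · simp [hne, hne.symm, h4, h4.not_gt, nu]
        · simp [hne, hne.symm, h4, h4.not_gt, nu]
          grind
      · have h4 : ¬ i = a.rev := fun e => h3 (by rw [e, Fin.rev_rev])
        have h5 : ¬ a.rev = i := fun e => h4 e.symm
        rcases lt_or_gt_of_ne hne with h6 | h6
        · simp [hne, hne.symm, h3, h6, h6.not_gt, nu]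
        · simp [hne, hne.symm, h3, h6, h6.not_gt, nu]
          grind
    · have h2' : ¬ (l = a ∧ k = i) := fun e => h2 ⟨e.2.symm, e.1.symm⟩
      by_cases h3 : a = i.rev ∧ l = k.rev
      · obtain ⟨rfl, rfl⟩ := h3
        have hne : i.rev ≠ k := by rintro rfl; exact h1 ⟨by simp, rfl⟩
        have h4 : ¬ (i = k ∧ i.rev = k.rev) := h2
        have h5 : ¬ (k.rev = i.rev ∧ k = i) := h2'
        have h6 : ¬ (k.rev < i ∧ k.rev = i.rev ∧ k = i) := fun e => h5 e.2
        have h8 : ¬ k = i := fun e => h4 ⟨e.symm, by rw [e]⟩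
        have h9 : ¬ i = k := fun e => h8 e.symm
        rcases lt_or_gt_of_ne hne with h7 | h7
        · simp only [h1, h1', h4, h7, h7.not_gt, if_false, if_true, Fin.rev_rev, and_self,
            true_and, nu]
          simp [h8, h9]
          ring
        · simp only [h1, h1', h4, h7, h7.not_gt, if_false, if_true, Fin.rev_rev, true_and, nu]
          simp [h8, h9]
      · have h4 : ¬ (a = i.rev ∧ l.rev = k) := fun e => h3 ⟨e.1, rev_eq_iff.1 e.2⟩
        have h5 : ¬ (i = k ∧ a = l ∧ i < a) := fun e => h2 ⟨e.1, e.2.1⟩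
        have h6 : ¬ (a = i.rev ∧ l.rev = k ∧ a < l.rev) := fun e => h4 ⟨e.1, e.2.1⟩
        rw [if_neg h1, if_neg h5, if_neg h2, if_neg h1', if_neg h6]
        by_cases h7 : a = i.rev
        · have h8 : ¬ l = k.rev := fun e => h3 ⟨h7, e⟩
          by_cases h9 : l = a
          · have h10 : ¬ k = i := fun e => h2' ⟨h9, e⟩
            simp [h8, h10]
          · simp [h8, h9]
        · by_cases h9 : l = a
          · have h10 : ¬ k = i := fun e => h2' ⟨h9, e⟩
            simp [h7, h10]
          · simp [h7, h9]

/-! ### The braid relation -/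

variable {m : ℕ}

/-- A matrix acting on the first two factors of a triple tensor product. -/
def legsLeft (A : Matrix (Fin m × Fin m) (Fin m × Fin m) ℝ) :
    Matrix (Fin m × Fin m × Fin m) (Fin m × Fin m × Fin m) ℝ :=
  fun p r => if p.2.2 = r.2.2 then A (p.1, p.2.1) (r.1, r.2.1) else 0

/-- A matrix acting on the last two factors of a triple tensor product. -/
def legsRight (A : Matrix (Fin m × Fin m) (Fin m × Fin m) ℝ) :
    Matrix (Fin m × Fin m × Fin m) (Fin m × Fin m × Fin m) ℝ :=
  fun p r => if p.1 = r.1 then A p.2 r.2 else 0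

theorem legsLeft_mulVec (A : Matrix (Fin m × Fin m) (Fin m × Fin m) ℝ)
    (f : Fin m × Fin m × Fin m → ℝ) (i j k : Fin m) :
    (legsLeft A).mulVec f (i, j, k) = ∑ p, ∑ r, A (i, j) (p, r) * f (p, r, k) := by
  simp [Matrix.mulVec, dotProduct, Fintype.sum_prod_type, legsLeft]

theorem legsRight_mulVec (A : Matrix (Fin m × Fin m) (Fin m × Fin m) ℝ)
    (f : Fin m × Fin m × Fin m → ℝ) (i j k : Fin m) :
    (legsRight A).mulVec f (i, j, k) = ∑ p, ∑ r, A (j, k) (p, r) * f (i, p, r) := by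
  simp only [Matrix.mulVec, dotProduct, Fintype.sum_prod_type, legsRight, ite_mul, zero_mul]
  rw [Finset.sum_eq_single i]
  · simp
  · intro b _ hb
    simp [hb.symm]
  · simp

theorem legsLeft_mul (A B : Matrix (Fin m × Fin m) (Fin m × Fin m) ℝ) :
    legsLeft (A * B) = legsLeft A * legsLeft B := by
  ext ⟨i, j, k⟩ ⟨a, b, c⟩
  change _ = (legsLeft A).mulVec (fun s => legsLeft B s (a, b, c)) (i, j, k)
  rw [legsLeft_mulVec]
  by_cases h : k = c
  · simp [legsLeft, h, Matrix.mul_apply, Fintype.sum_prod_type]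
  · simp [legsLeft, h]

theorem legsRight_mul (A B : Matrix (Fin m × Fin m) (Fin m × Fin m) ℝ) :
    legsRight (A * B) = legsRight A * legsRight B := by
  ext ⟨i, j, k⟩ ⟨a, b, c⟩
  change _ = (legsRight A).mulVec (fun s => legsRight B s (a, b, c)) (i, j, k)
  rw [legsRight_mulVec]
  by_cases h : i = a
  · simp [legsRight, h, Matrix.mul_apply, Fintype.sum_prod_type]
  · simp [legsRight, h]

theorem legsLeft_one : legsLeft (1 : Matrix (Fin m × Fin m) (Fin m × Fin m) ℝ) = 1 := by
  ext ⟨i, j, k⟩ ⟨a, b, c⟩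
  simp only [legsLeft, Matrix.one_apply, Prod.mk.injEq]
  split_ifs <;> simp_all

theorem legsRight_one : legsRight (1 : Matrix (Fin m × Fin m) (Fin m × Fin m) ℝ) = 1 := by
  ext ⟨i, j, k⟩ ⟨a, b, c⟩
  simp only [legsRight, Matrix.one_apply, Prod.mk.injEq]
  split_ifs <;> simp_all

theorem legsLeft_mulVec_braid_of_ne (q : ℝ) {i j : Fin m} (h : j ≠ i.rev)
    (f : Fin m × Fin m × Fin m → ℝ) (k : Fin m) :
    (legsLeft (braid q m)).mulVec f (i, j, k) =
      (if i = j then q else 1) * f (j, i, k) + (if i < j then nu q else 0) * f (i, j, k) := by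
  rw [legsLeft_mulVec]
  exact sum_braid_of_ne q h fun p r => f (p, r, k)

theorem legsRight_mulVec_braid_of_ne (q : ℝ) {j k : Fin m} (h : k ≠ j.rev)
    (f : Fin m × Fin m × Fin m → ℝ) (i : Fin m) :
    (legsRight (braid q m)).mulVec f (i, j, k) =
      (if j = k then q else 1) * f (i, k, j) + (if j < k then nu q else 0) * f (i, j, k) := by
  rw [legsRight_mulVec]
  exact sum_braid_of_ne q h fun p r => f (i, p, r)

theorem legsLeft_mulVec_braid_zero (q : ℝ) (x k : Fin m) (f : Fin m × Fin m × Fin m → ℝ) :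
    (legsLeft (braid q m)).mulVec f (x, x.rev, k) =
      ∑ y, zeroBlock q m x y * f (y, y.rev, k) := by
  rw [legsLeft_mulVec]
  exact sum_braid_zero q x fun p r => f (p, r, k)

theorem legsRight_mulVec_braid_zero (q : ℝ) (x k : Fin m) (f : Fin m × Fin m × Fin m → ℝ) :
    (legsRight (braid q m)).mulVec f (k, x, x.rev) =
      ∑ y, zeroBlock q m x y * f (k, y, y.rev) := by
  rw [legsRight_mulVec]
  exact sum_braid_zero q x fun p r => f (k, p, r)

/-- The defect of the braid relation. -/
def braidDefect (q : ℝ) (m : ℕ) :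
    Matrix (Fin m × Fin m × Fin m) (Fin m × Fin m × Fin m) ℝ :=
  legsLeft (braid q m) * legsRight (braid q m) * legsLeft (braid q m) -
    legsRight (braid q m) * legsLeft (braid q m) * legsRight (braid q m)

theorem braidDefect_apply (q : ℝ) (r c : Fin m × Fin m × Fin m) :
    braidDefect q m r c =
      (legsLeft (braid q m)).mulVec ((legsRight (braid q m)).mulVec
        (fun s => legsLeft (braid q m) s c)) r -
      (legsRight (braid q m)).mulVec ((legsLeft (braid q m)).mulVec
        (fun s => legsRight (braid q m) s c)) r := by
  rw [braidDefect, Matrix.mul_assoc, Matrix.mul_assoc]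
  rfl

theorem braidDefect_mulVec (q : ℝ) (f : Fin m × Fin m × Fin m → ℝ) :
    (braidDefect q m).mulVec f =
      (legsLeft (braid q m)).mulVec ((legsRight (braid q m)).mulVec
        ((legsLeft (braid q m)).mulVec f)) -
      (legsRight (braid q m)).mulVec ((legsLeft (braid q m)).mulVec
        ((legsRight (braid q m)).mulVec f)) := by
  simp only [braidDefect, Matrix.sub_mulVec, Matrix.mulVec_mulVec, Matrix.mul_assoc]

theorem legsLeft_braid_transpose (q : ℝ) :
    (legsLeft (braid q m)).transpose = legsLeft (braid q m) := by
  ext ⟨i, j, k⟩ ⟨a, b, c⟩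
  simp only [Matrix.transpose_apply, legsLeft, braid_symm q m a, eq_comm]

theorem legsRight_braid_transpose (q : ℝ) :
    (legsRight (braid q m)).transpose = legsRight (braid q m) := by
  ext ⟨i, j, k⟩ ⟨a, b, c⟩
  simp only [Matrix.transpose_apply, legsRight, braid_symm q m b, eq_comm]

/-- Each leg is a symmetric matrix and both sides of the braid relation are palindromes in the legs.
-/
theorem braidDefect_symm (q : ℝ) (r c : Fin m × Fin m × Fin m) :
    braidDefect q m r c = braidDefect q m c r := by
  have h : (braidDefect q m).transpose = braidDefect q m := by
    simp only [braidDefect, Matrix.transpose_sub, Matrix.transpose_mul, legsLeft_braid_transpose,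
      legsRight_braid_transpose, Matrix.mul_assoc]
  exact congrFun (congrFun h c) r

/-- The reflection `(i, j, k) ↦ (k', j', i')`. -/
def tripleFlip (m : ℕ) : Fin m × Fin m × Fin m ≃ Fin m × Fin m × Fin m where
  toFun p := (p.2.2.rev, p.2.1.rev, p.1.rev)
  invFun p := (p.2.2.rev, p.2.1.rev, p.1.rev)
  left_inv p := by simp
  right_inv p := by simp

theorem legsLeft_submatrix (q : ℝ) :
    (legsLeft (braid q m)).submatrix (tripleFlip m) (tripleFlip m) = legsRight (braid q m) := by
  ext ⟨i, j, k⟩ ⟨a, b, c⟩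
  simp [tripleFlip, legsLeft, legsRight, braid_flip q m j k b c]

theorem legsRight_submatrix (q : ℝ) :
    (legsRight (braid q m)).submatrix (tripleFlip m) (tripleFlip m) = legsLeft (braid q m) := by
  ext ⟨i, j, k⟩ ⟨a, b, c⟩
  simp [tripleFlip, legsLeft, legsRight, braid_flip q m i j a b]

/-- The reflection exchanges the two legs, hence the two sides of the braid relation; this is the
sign. -/
theorem braidDefect_flip (q : ℝ) (r c : Fin m × Fin m × Fin m) :
    braidDefect q m (tripleFlip m r) (tripleFlip m c) = -braidDefect q m r c := by
  have h : (braidDefect q m).submatrix (tripleFlip m) (tripleFlip m) = -braidDefect q m := by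
    have e : ∀ A B C : Matrix (Fin m × Fin m × Fin m) (Fin m × Fin m × Fin m) ℝ,
        (A * B * C).submatrix (tripleFlip m) (tripleFlip m) =
          A.submatrix (tripleFlip m) (tripleFlip m) * B.submatrix (tripleFlip m) (tripleFlip m) *
            C.submatrix (tripleFlip m) (tripleFlip m) := fun A B C => by
      rw [Matrix.submatrix_mul_equiv, Matrix.submatrix_mul_equiv]
    rw [braidDefect, Matrix.submatrix_sub, Pi.sub_apply, Pi.sub_apply, e, e, legsLeft_submatrix,
      legsRight_submatrix, neg_sub]
  exact congrFun (congrFun h r) c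

theorem legsLeft_mulVec_metric {q : ℝ} (hq : 0 < q) (a : Fin m) :
    (legsLeft (braid q m)).mulVec (fun p => if p.2.2 = a then metric q m p.1 p.2.1 else 0) =
      zeta q m • fun p => if p.2.2 = a then metric q m p.1 p.2.1 else 0 := by
  ext ⟨i, j, k⟩
  rw [legsLeft_mulVec]
  by_cases h : k = a
  · simp [h, sum_braid_metric hq]
  · simp [h]

theorem legsRight_mulVec_metric {q : ℝ} (hq : 0 < q) (a : Fin m) :
    (legsRight (braid q m)).mulVec (fun p => if p.1 = a then metric q m p.2.1 p.2.2 else 0) =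
      zeta q m • fun p => if p.1 = a then metric q m p.2.1 p.2.2 else 0 := by
  ext ⟨i, j, k⟩
  rw [legsRight_mulVec]
  by_cases h : i = a
  · simp [h, sum_braid_metric hq]
  · simp [h]

/-- An arc slides across a strand: by crossing, the right leg applied to C ⊗ e_a is an entry of
R̂⁻¹, which the left leg cancels. -/
theorem legsLeft_legsRight_mulVec_metric {q : ℝ} (hq : 0 < q) (a : Fin m) :
    (legsLeft (braid q m)).mulVec ((legsRight (braid q m)).mulVec
        (fun p => if p.2.2 = a then metric q m p.1 p.2.1 else 0)) =
      fun p => if p.1 = a then metric q m p.2.1 p.2.2 else 0 := by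
  ext ⟨i, j, k⟩
  rw [legsLeft_mulVec]
  have e : ∀ p r, (legsRight (braid q m)).mulVec
      (fun p => if p.2.2 = a then metric q m p.1 p.2.1 else 0) (p, r, k) =
        met q m k.rev * braidInv q m (p, r) (a, k.rev) := by
    intro p r
    rw [legsRight_mulVec, braidInv_crossing hq, Fin.rev_rev]
    have hk := met_mul_rev hq k
    simp only [metric_apply, mul_ite, mul_zero, Finset.sum_ite_eq', Finset.mem_univ, if_true]
    linear_combination (- met q m p * braid q m (r, k) (p.rev, a)) * hk
  simp only [e]
  have h := congrFun (congrFun (braid_mul_braidInv hq m) (i, j)) (a, k.rev)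
  rw [Matrix.mul_apply, Fintype.sum_prod_type, Matrix.one_apply] at h
  have e2 : ∀ p r, braid q m (i, j) (p, r) * (met q m k.rev * braidInv q m (p, r) (a, k.rev)) =
      met q m k.rev * (braid q m (i, j) (p, r) * braidInv q m (p, r) (a, k.rev)) := by
    intros; ring
  simp only [e2, ← Finset.mul_sum, h, metric_apply, Prod.mk.injEq]
  by_cases h1 : i = a
  · by_cases h2 : j = k.rev
    · subst h2; simp [h1]
    · have : ¬ k = j.rev := fun e => h2 (by rw [e, Fin.rev_rev])
      simp [h2, this]
  · simp [h1]

/-- Both sides of the braid relation send C ⊗ e_a to ζ e_a ⊗ C, by sliding the arc and the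
eigenvalue ζ. This relation later supplies the entries that are not computed directly. -/
theorem sum_met_mul_braidDefect {q : ℝ} (hq : 0 < q) (a : Fin m) (r : Fin m × Fin m × Fin m) :
    ∑ x, met q m x * braidDefect q m r (x, x.rev, a) = 0 := by
  have h : (braidDefect q m).mulVec (fun p => if p.2.2 = a then metric q m p.1 p.2.1 else 0) =
      0 := by
    rw [braidDefect_mulVec, legsLeft_mulVec_metric hq, Matrix.mulVec_smul, Matrix.mulVec_smul,
      legsLeft_legsRight_mulVec_metric hq, legsRight_mulVec_metric hq, sub_self]
  have h2 := congrFun h r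
  simpa [Matrix.mulVec, dotProduct, Fintype.sum_prod_type, metric_apply, mul_comm] using h2

/-- The diagonal matrix χ ⊗ χ ⊗ χ commutes with both legs, so the defect has no entries between
different weights. -/
theorem braidDefect_weight (q : ℝ) {χ : Fin m → ℝ} (hχ : ∀ i, χ i * χ i.rev = 1)
    (i j k a b c : Fin m) :
    braidDefect q m (i, j, k) (a, b, c) * (χ i * χ j * χ k) =
      braidDefect q m (i, j, k) (a, b, c) * (χ a * χ b * χ c) := by
  have h1 : ∀ p r : Fin m × Fin m × Fin m, (χ p.1 * χ p.2.1 * χ p.2.2) *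
      legsLeft (braid q m) p r = legsLeft (braid q m) p r * (χ r.1 * χ r.2.1 * χ r.2.2) := by
    rintro ⟨i, j, k⟩ ⟨a, b, c⟩
    simp only [legsLeft]
    split_ifs with h
    · rw [h]; linear_combination χ c * braid_weight q hχ i j a b
    · simp
  have h2 : ∀ p r : Fin m × Fin m × Fin m, (χ p.1 * χ p.2.1 * χ p.2.2) *
      legsRight (braid q m) p r = legsRight (braid q m) p r * (χ r.1 * χ r.2.1 * χ r.2.2) := by
    rintro ⟨i, j, k⟩ ⟨a, b, c⟩
    simp only [legsRight]
    split_ifs with h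
    · rw [h]; linear_combination χ a * braid_weight q hχ j k b c
    · simp
  let W : Matrix (Fin m × Fin m × Fin m) (Fin m × Fin m × Fin m) ℝ :=
    Matrix.diagonal fun p => χ p.1 * χ p.2.1 * χ p.2.2
  have c1 : Commute W (legsLeft (braid q m)) := by
    ext p r
    rw [Matrix.diagonal_mul, Matrix.mul_diagonal]
    exact h1 p r
  have c2 : Commute W (legsRight (braid q m)) := by
    ext p r
    rw [Matrix.diagonal_mul, Matrix.mul_diagonal]
    exact h2 p r
  have c3 : Commute W (braidDefect q m) :=
    ((c1.mul_right c2).mul_right c1).sub_right ((c2.mul_right c1).mul_right c2)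
  have h3 := congrFun (congrFun c3.eq (i, j, k)) (a, b, c)
  rw [Matrix.diagonal_mul, Matrix.mul_diagonal] at h3
  rw [← h3, mul_comm]

/-- The diagonal entry of `1 ⊗ R̂` at `e_y ⊗ e_{y'} ⊗ e_a`. -/
def diagWeight (q : ℝ) (a y : Fin m) : ℝ :=
  if y = a then zeroBlock q m a.rev a.rev
  else if y = a.rev then q else if a.rev < y then nu q else 0

/-- Beyond a' the weight is ν, so the sum is the difference of the telescoping sums at s and at a',
corrected at y = a' and y = a. For s ≤ a' every term vanishes. -/
theorem sum_met_diagWeight {q : ℝ} (hq : 0 < q) (a s : Fin m) :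
    ∑ y, (if y < s then met q m y ^ 2 * diagWeight q a y else 0) =
      (if a.rev < s then
        alpha q s * met q m s ^ 2 + (if s.rev < s ∧ s ≤ a then nu q else 0) else 0) := by
  have hS := nu_mul_sum_met hq s
  have hA := nu_mul_sum_met hq a.rev
  rw [Fin.rev_rev, alpha_rev] at hA
  have ha := met_mul_rev hq a
  have hqq := mul_inv_cancel₀ hq.ne'
  -- `u` and `v` are the corrections at `y = a'` and `y = a`.
  have key : ∀ u v : ℝ, a.rev < s → (∀ y, (if y < s then met q m y ^ 2 * diagWeight q a y else 0) =
      nu q * (if y < s then met q m y ^ 2 else 0) - nu q * (if y < a.rev then met q m y ^ 2 else 0)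
      + (if y = a.rev then u else 0) + (if y = a then v else 0)) →
      ∑ y, (if y < s then met q m y ^ 2 * diagWeight q a y else 0) =
      (alpha q s * met q m s ^ 2 + (if s.rev < s then nu q else 0) - zeta q m) -
      (alpha q a * met q m a.rev ^ 2 + (if a < a.rev then nu q else 0) - zeta q m) + u + v := by
    intro u v _ h
    simp only [h, Finset.sum_add_distrib, Finset.sum_sub_distrib, ← Finset.mul_sum, hS, hA]
    simp
  have l1 : a.rev.val = m - (a + 1) := Fin.val_rev a
  have l2 : s.rev.val = m - (s + 1) := Fin.val_rev s
  by_cases h1 : a.rev < s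
  · rw [if_pos h1]
    rcases lt_trichotomy a a.rev with h2 | h2 | h2
    · have c1 : s.rev < s := by omega
      have c2 : ¬ s ≤ a := by omega
      rw [key (met q m a.rev ^ 2 * (q - nu q)) 0 h1, if_pos h2, if_pos c1, if_neg fun h => c2 h.2]
      · simp only [alpha, h2.ne, if_false, nu]; ring
      · intro y
        unfold diagWeight
        rcases lt_trichotomy y a.rev with h3 | h3 | h3
        · by_cases h4 : y = a
          · subst h4
            simp [h3, h3.ne, h3.trans h1, zeroBlock, h2.ne', h2.not_gt]
          · simp [h3, h3.ne, h3.trans h1, h4, h3.not_gt]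
        · subst h3
          simp [h1, h2.ne']; ring
        · simp [h3.ne', (h2.trans h3).ne', h3, h3.not_gt]
          split_ifs <;> ring
    · have hone := met_eq_one_of_eq_rev hq h2
      have c1 : s.rev < s := by omega
      have c2 : ¬ s ≤ a := by omega
      rw [← h2] at key h1
      rw [key (1 - nu q) 0 h1, if_neg (lt_irrefl a), if_pos c1, if_neg fun h => c2 h.2]
      · simp [alpha, ← h2, hone]
      · intro y
        unfold diagWeight
        rw [← h2]
        rcases lt_trichotomy y a with h3 | h3 | h3
        · simp [h3, h3.ne, h3.trans h1, h3.not_gt]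
        · subst h3
          simp [h1, hone, zeroBlock, ← h2, alpha]
        · simp [h3.ne', h3, h3.not_gt]
          split_ifs <;> ring
    · rw [key (met q m a.rev ^ 2 * (q - nu q)) (if a < s then - nu q else 0) h1,
        if_neg h2.not_gt]
      · have hsr : a < s → s.rev < s := by omega
        by_cases h3 : a < s
        · simp [alpha, h2.ne', nu, h3, h3.not_ge, hsr]; ring
        · simp [alpha, h2.ne', nu, h3, not_lt.1 h3]; ring
      · intro y
        unfold diagWeight
        rcases lt_trichotomy y a.rev with h3 | h3 | h3
        · simp [h3, h3.ne, (h3.trans h2).ne, h3.trans h1, h3.not_gt]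
        · subst h3
          simp [h1, h2.ne]; ring
        · by_cases h4 : y = a
          · subst h4
            simp [h2.ne', zeroBlock, h2.ne, h2, h2.not_gt]
            split_ifs
            · linear_combination (nu q * (met q m y * met q m y.rev + 1)) * (-ha)
            · ring
          · simp [h3.ne', h3, h3.not_gt, h4]
            split_ifs <;> ring
  · rw [if_neg h1]
    refine Finset.sum_eq_zero fun y _ => ?_
    by_cases h2 : y < s
    · have h3 : y < a.rev := h2.trans_le (not_lt.1 h1)
      by_cases h4 : y = a
      · subst h4
        simp [diagWeight, zeroBlock, h3.ne', h3.not_gt]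
      · simp [diagWeight, h3.ne, h4, h3.not_gt]
    · simp [h2]

/-- The diagonal part of the braid relation on the vectors `e_x ⊗ e_{x'} ⊗ e_a`. -/
theorem sum_zeroBlock_diagWeight {q : ℝ} (hq : 0 < q) {a x z : Fin m} (hx : x ≠ a) (hz : z ≠ a) :
    ∑ y, zeroBlock q m x y * (diagWeight q a y * zeroBlock q m y z) =
      diagWeight q a x * (zeroBlock q m x z * diagWeight q a z) +
        (if x = z ∧ x ≠ a.rev ∧ x < a then nu q else 0) := by
  -- Both sides are symmetric in `x` and `z`. With `z ≤ x` only the constraint `y < x'` survives,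
  -- and `sum_met_diagWeight` evaluates the sum.
  wlog h : z ≤ x generalizing x z
  · have := this hz hx (le_of_not_ge h)
    have e : (x = z ∧ x ≠ a.rev ∧ x < a) ↔ (z = x ∧ z ≠ a.rev ∧ z < a) := by
      constructor <;> · rintro ⟨rfl, h2⟩; exact ⟨rfl, h2⟩
    simp only [e]
    have e2 : ∀ y, zeroBlock q m x y * (diagWeight q a y * zeroBlock q m y z) =
        zeroBlock q m z y * (diagWeight q a y * zeroBlock q m y x) := fun y => by
      rw [zeroBlock_symm q x y, zeroBlock_symm q y z]; ring
    simp only [e2, this, zeroBlock_symm q x z]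
    ring
  have h' : x.rev ≤ z.rev := Fin.rev_le_rev.2 h
  rw [sum_zeroBlock_mul_zeroBlock]
  have e : ∀ y, (if y < x.rev ∧ y < z.rev then met q m y ^ 2 * diagWeight q a y else 0) =
      (if y < x.rev then met q m y ^ 2 * diagWeight q a y else 0) := by
    intro y
    congr 1
    exact propext ⟨And.left, fun a => ⟨a, a.trans_le h'⟩⟩
  simp only [e]
  rw [sum_met_diagWeight hq, Fin.rev_rev, if_neg (not_lt.2 h'), alpha_rev]
  have l1 : x.rev.val = m - (x + 1) := Fin.val_rev x
  have l2 : z.rev.val = m - (z + 1) := Fin.val_rev z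
  have l3 : a.rev.val = m - (a + 1) := Fin.val_rev a
  have mx := met_mul_rev hq x
  have mz := met_mul_rev hq z
  have hqq := mul_inv_cancel₀ hq.ne'
  have gen : ∀ y : Fin m, y ≠ a → y ≠ a.rev →
      diagWeight q a y = if a.rev < y then nu q else 0 := fun y h1 h2 => by
    simp [diagWeight, h1, h2]
  have r1 : x.rev = a ↔ x = a.rev := rev_eq_iff
  have r2 : x.rev ≠ a.rev := fun e => hx (Fin.rev_inj.1 e)
  have g1 : a.rev < x.rev ↔ x < a := Fin.rev_lt_rev
  have g2 : x.rev ≤ a ↔ a.rev ≤ x := Fin.rev_le_iff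
  rcases h.eq_or_lt with rfl | h2
  · by_cases c1 : z = a.rev
    · subst c1
      have d1 : diagWeight q a a = zeroBlock q m a.rev a.rev := by simp [diagWeight]
      have d2 : diagWeight q a a.rev = q := by simp [diagWeight, hz]
      rw [Fin.rev_rev] at *
      have hz' : a ≠ a.rev := hz.symm
      rw [d1, d2]
      rcases lt_or_gt_of_ne hz with h3 | h3
      · simp [zeroBlock, alpha, h3, h3.ne, h3.ne', h3.not_gt, nu]
        grind
      · simp [zeroBlock, alpha, h3, h3.ne, h3.ne', h3.not_gt, nu]
    · rw [gen z hz c1, gen z.rev (fun e => c1 (r1.1 e)) r2]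
      simp only [g1, g2]
      rcases lt_trichotomy z z.rev with h3 | h3 | h3
      · by_cases c2 : z < a <;> by_cases c3 : a.rev < z <;>
          have c4 : a.rev ≤ z ↔ a.rev < z := ⟨fun e => lt_of_le_of_ne e (Ne.symm c1), le_of_lt⟩ <;>
          simp [zeroBlock, alpha, h3, h3.ne, h3.ne', h3.not_gt, nu, c1, c2, c3, c4] <;> grind
      · by_cases c2 : z < a
        · have c3 : a.rev < z := by omega
          have := met_eq_one_of_eq_rev hq h3
          simp [zeroBlock, alpha, ← h3, nu, c1, c2, c3, this]
          ring
        · have c3 : ¬ a.rev < z := by omega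
          simp [zeroBlock, alpha, ← h3, c1, c2, c3]
      · have c5 : z < a → a.rev < z := by omega
        by_cases c2 : z < a
        · simp [zeroBlock, alpha, h3, h3.ne, h3.ne', h3.not_gt, nu, c1, c2, c5 c2]
          grind
        · simp [zeroBlock, alpha, h3, h3.ne, h3.ne', h3.not_gt, c2]
  · by_cases hxz : z = x.rev
    · subst hxz
      rw [Fin.rev_rev] at *
      have c1 : x ≠ a.rev := fun e => hz (r1.2 e)
      rw [gen x hx c1, gen x.rev hz r2]
      simp only [g1, g2]
      have c5 : x < a → a.rev < x := by omega
      by_cases c2 : x < a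
      · simp [zeroBlock, alpha, h2, h2.ne, h2.ne', h2.not_gt, nu, c2, c5 c2]
        grind
      · simp [zeroBlock, alpha, h2.ne', h2.not_gt, c2]
    · have hxz' : ¬ x.rev = z := fun e => hxz e.symm
      have hzx' : ¬ x = z.rev := fun e => hxz' (rev_eq_iff.2 e)
      by_cases c1 : x = a.rev
      · subst c1
        have d1 : diagWeight q a a = zeroBlock q m a.rev a.rev := by simp [diagWeight]
        have d2 : diagWeight q a a.rev = q := by simp [diagWeight, hx]
        rw [gen z hz h2.ne, Fin.rev_rev, d1, d2]
        rw [Fin.rev_rev] at *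
        rcases lt_or_gt_of_ne hx with h3 | h3
        · simp [zeroBlock, alpha, h2, h2.ne, h2.ne', h2.not_gt, h3, h3.ne, h3.not_gt, nu,
            hxz, hxz']
          grind
        · simp [zeroBlock, alpha, h2, h2.ne, h2.ne', h2.not_gt, h3, h3.ne', h3.not_gt, nu,
            hxz, hxz']
      · rw [gen x hx c1, gen x.rev (fun e => c1 (r1.1 e)) r2]
        simp only [g1, g2]
        by_cases c2 : z = a.rev
        · subst c2
          have d2 : diagWeight q a a.rev = q := by simp [diagWeight, hz]
          rw [d2]
          simp [zeroBlock, alpha, h2, h2.ne, h2.ne', hxz, hxz', h2.le, nu]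
          by_cases c3 : x < a <;> by_cases c4 : a.rev < a <;> by_cases c5 : x < x.rev <;>
            first
              | (exfalso; omega)
              | (simp [c3, c4, c5]; done)
              | (by_cases c6 : x = x.rev
                 · simp [c3, c4, ← c6]; grind
                 · have c7 : ¬ x.rev = x := fun e => c6 e.symm
                   simp [c3, c4, c5, c6]; grind)
        · rw [gen z hz c2]
          have c11 : a.rev ≤ x ↔ a.rev < x := ⟨fun e => lt_of_le_of_ne e (Ne.symm c1), le_of_lt⟩
          simp [zeroBlock, alpha, h2, h2.ne, h2.ne', hxz, hxz', nu]
          by_cases c3 : x < a <;> by_cases c4 : a.rev < z <;> by_cases c5 : x < x.rev <;>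
            by_cases c6 : a.rev < x <;> by_cases c7 : z < x.rev <;> by_cases c8 : z < z.rev <;>
            first
              | (exfalso; omega)
              | (simp [c3, c4, c5, c6, c7, c8]; done)
              | (by_cases c9 : x = x.rev
                 · simp [c4, c6, c8, ← c9]; grind
                 · have c10 : ¬ x.rev = x := fun e => c9 e.symm
                   simp [c3, c4, c5, c6, c7, c8, c9, c11]; grind)

theorem braid_swap (q : ℝ) {i j : Fin m} (h : i ≠ j) (h' : j ≠ i.rev) :
    braid q m (i, j) (j, i) = 1 := by
  rw [braid_of_ne q h']; simp [h, h.symm]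

theorem braid_diag (q : ℝ) {i j : Fin m} (h : i ≠ j) (h' : j ≠ i.rev) :
    braid q m (i, j) (i, j) = if i < j then nu q else 0 := by
  rw [braid_of_ne q h']; simp [h]

theorem braid_diag_self (q : ℝ) {i : Fin m} (h' : i ≠ i.rev) : braid q m (i, i) (i, i) = q := by
  rw [braid_of_ne q h']; simp

theorem legsRight_mulVec_braid_zero' (q : ℝ) (a k : Fin m) (f : Fin m × Fin m × Fin m → ℝ) :
    (legsRight (braid q m)).mulVec f (k, a.rev, a) =
      ∑ y, zeroBlock q m a.rev y * f (k, y, y.rev) := by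
  have := legsRight_mulVec_braid_zero q a.rev k f
  rwa [Fin.rev_rev] at this

theorem braid_zero' (q : ℝ) (x y : Fin m) :
    braid q m (x.rev, x) (y, y.rev) = zeroBlock q m x.rev y := by
  have := braid_zero q m x.rev y
  rwa [Fin.rev_rev] at this

theorem legsRight_mulVec_braid_zero_left (q : ℝ) {a y : Fin m} (h : y ≠ a)
    (f : Fin m × Fin m × Fin m → ℝ) :
    (legsRight (braid q m)).mulVec f (y, y.rev, a) =
      if y = a.rev then q * f (y, y.rev, a)
      else f (y, a, y.rev) + (if a.rev < y then nu q else 0) * f (y, y.rev, a) := by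
  have h' : a ≠ y.rev.rev := by rw [Fin.rev_rev]; exact h.symm
  rw [legsRight_mulVec_braid_of_ne q h']
  by_cases h2 : y = a.rev
  · subst h2
    simp
  · have h3 : ¬ y.rev = a := fun e => h2 (rev_eq_iff.1 e)
    have h4 : y.rev < a ↔ a.rev < y := Fin.rev_lt_iff
    simp [h2, h3, h4]

theorem braidDefect_zero_left (q : ℝ) {a x : Fin m} (hx : x ≠ a) (c : Fin m × Fin m × Fin m) :
    braidDefect q m (x, x.rev, a) c =
      ∑ y, zeroBlock q m x y * (legsRight (braid q m)).mulVec
        (fun s => legsLeft (braid q m) s c) (y, y.rev, a) -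
      (if x = a.rev then q * ∑ y, zeroBlock q m x y * legsRight (braid q m) (y, y.rev, a) c
      else legsRight (braid q m) (a, x, x.rev) c +
        (if x < a then nu q else 0) * legsRight (braid q m) (x, a, x.rev) c +
        (if a.rev < x then nu q else 0) *
          ∑ y, zeroBlock q m x y * legsRight (braid q m) (y, y.rev, a) c) := by
  rw [braidDefect_apply, legsLeft_mulVec_braid_zero, legsRight_mulVec_braid_zero_left q hx,
    legsLeft_mulVec_braid_zero]
  by_cases h : x = a.rev
  · simp [h]
  · have h1 : a ≠ x.rev := fun e => h (rev_eq_iff.1 e.symm)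
    rw [legsLeft_mulVec_braid_of_ne q h1]
    simp [h, hx]

/-- Between vectors e_y ⊗ e_{y'} ⊗ e_a the right leg acts diagonally by `diagWeight`, and its other
outputs do not reach this column. One side of the braid relation is thus block times diagonal times
block, the sum in `sum_zeroBlock_diagWeight`. -/
theorem braidDefect_zero_left_zero_left {q : ℝ} (hq : 0 < q) {a x z : Fin m} (hx : x ≠ a)
    (hz : z ≠ a) : braidDefect q m (x, x.rev, a) (z, z.rev, a) = 0 := by
  have haz : a ≠ z.rev.rev := by rw [Fin.rev_rev]; exact hz.symm
  rw [braidDefect_zero_left q hx, sub_eq_zero]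
  have e1 : ∀ y, (legsRight (braid q m)).mulVec
      (fun s => legsLeft (braid q m) s (z, z.rev, a)) (y, y.rev, a) =
        diagWeight q a y * zeroBlock q m y z := by
    intro y
    by_cases h : y = a
    · subst h
      rw [legsRight_mulVec_braid_zero', Finset.sum_eq_single y.rev]
      · simp [legsLeft, diagWeight, braid_zero]
      · intro p _ hp
        have : ¬ p.rev = y := fun e => hp (rev_eq_iff.1 e)
        simp [legsLeft, this]
      · simp
    · rw [legsRight_mulVec_braid_zero_left q h]
      by_cases h2 : y = a.rev
      · subst h2
        simp [legsLeft, diagWeight, h, braid_zero']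
      · have h3 : ¬ y.rev = a := fun e => h2 (rev_eq_iff.1 e)
        simp [legsLeft, diagWeight, h, h2, h3, braid_zero]
  have e2 : ∀ y, legsRight (braid q m) (y, y.rev, a) (z, z.rev, a) =
      if y = z then diagWeight q a z else 0 := by
    intro y
    by_cases h : y = z
    · subst h
      by_cases h2 : y = a.rev
      · subst h2
        simp [legsRight, diagWeight, hz, braid_diag_self q hz.symm]
      · have h3 : y.rev ≠ a := fun e => h2 (rev_eq_iff.1 e)
        have h4 : y.rev < a ↔ a.rev < y := Fin.rev_lt_iff
        simp [legsRight, diagWeight, hz, h2, braid_diag q h3 haz, h4]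
    · simp [legsRight, h]
  simp only [e1, e2, mul_ite, mul_zero, Finset.sum_ite_eq', Finset.mem_univ, if_true]
  rw [sum_zeroBlock_diagWeight hq hx hz]
  by_cases h : x = a.rev
  · subst h
    simp [diagWeight, hx]
  · have e3 : legsRight (braid q m) (x, a, x.rev) (z, z.rev, a) = if x = z then 1 else 0 := by
      by_cases h1 : x = z
      · subst h1
        have h2 : a ≠ x.rev := fun e => h (rev_eq_iff.1 e.symm)
        have h3 : x.rev ≠ a.rev := fun e => hx (Fin.rev_inj.1 e)
        simp [legsRight, braid_swap q h2 h3]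
      · simp [legsRight, h1]
    have e4 : legsRight (braid q m) (a, x, x.rev) (z, z.rev, a) = 0 := by
      simp [legsRight, hz.symm]
    rw [if_neg h, e3, e4, diagWeight, if_neg hx, if_neg h]
    by_cases h1 : x = z <;> by_cases h2 : x < a <;> simp [h, h1, h2] <;> grind

theorem braidDefect_zero_left_mid {q : ℝ} (hq : 0 < q) {a x z : Fin m} (hx : x ≠ a)
    (hz : z ≠ a) (hz' : z ≠ a.rev) : braidDefect q m (x, x.rev, a) (z, a, z.rev) = 0 := by
  have haz : a ≠ z.rev := fun e => hz' (rev_eq_iff.1 e.symm)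
  have hza : z.rev ≠ a.rev := fun e => hz (Fin.rev_inj.1 e)
  rw [braidDefect_zero_left q hx, sub_eq_zero]
  have e1 : ∀ y, (legsRight (braid q m)).mulVec
      (fun s => legsLeft (braid q m) s (z, a, z.rev)) (y, y.rev, a) =
        (if y = z then (if z < a then nu q else 0) else 0) +
          if y = a then zeroBlock q m a.rev z else 0 := by
    intro y
    by_cases h : y = a
    · subst h
      rw [legsRight_mulVec_braid_zero', Finset.sum_eq_single z]
      · simp [legsLeft, braid_swap q hz.symm hz', hz.symm]
      · intro p _ hp
        simp [legsLeft, hp]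
      · simp
    · rw [legsRight_mulVec_braid_zero_left q h]
      by_cases h2 : y = a.rev
      · subst h2
        simp [legsLeft, h, haz, hz'.symm]
      · by_cases h3 : y = z
        · subst h3
          simp [legsLeft, h, h2, haz, braid_diag q hz haz]
        · simp [legsLeft, h, h2, haz, h3]
  have e2 : ∀ y, legsRight (braid q m) (y, y.rev, a) (z, a, z.rev) = if y = z then 1 else 0 := by
    intro y
    by_cases h : y = z
    · subst h
      simp [legsRight, braid_swap q haz.symm (by rw [Fin.rev_rev]; exact hz.symm)]
    · simp [legsRight, h]
  simp only [e1, e2, mul_add, mul_ite, mul_zero, mul_one, Finset.sum_add_distrib,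
    Finset.sum_ite_eq', Finset.mem_univ, if_true]
  have e3 : legsRight (braid q m) (x, a, x.rev) (z, a, z.rev) =
      if x = z then (if a < z.rev then nu q else 0) else 0 := by
    by_cases h1 : x = z
    · subst h1
      simp [legsRight, braid_diag q haz hza]
    · simp [legsRight, h1]
  have e4 : legsRight (braid q m) (a, x, x.rev) (z, a, z.rev) = 0 := by
    simp [legsRight, hz.symm]
  rw [e3, e4]
  have hqq := mul_inv_cancel₀ hq.ne'
  have ma := met_mul_rev hq a
  have l1 : x.rev.val = m - (x + 1) := Fin.val_rev x
  have l2 : z.rev.val = m - (z + 1) := Fin.val_rev z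
  have l3 : a.rev.val = m - (a + 1) := Fin.val_rev a
  by_cases h : x = a.rev
  · subst h
    by_cases h1 : z < a
    · simp [zeroBlock, hz, hz'.symm, alpha, hx, h1, nu]
      grind
    · simp [zeroBlock, hz, hz'.symm, h1]
  · have h1 : a ≠ x.rev := fun e => h (rev_eq_iff.1 e.symm)
    rw [if_neg h]
    have c1 : a.rev < x ↔ ¬ a < x.rev := by omega
    have c2 : ¬ a.rev = z := fun e => hz' e.symm
    by_cases h2 : a < x.rev <;> by_cases h3 : z < a
    · have c3 : ¬ z = x.rev := by omega
      have c4 : z < x.rev := by omega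
      have c5 : x = z → x < a := by omega
      have c6 : a < z.rev ∨ ¬ x = z := by omega
      have c7 : x < x.rev ∨ ¬ x = z := by omega
      by_cases h4 : x = z
      · subst h4
        simp [zeroBlock, c1, h1, h2, h3, hx, c2, c3, c4]
        grind
      · simp [zeroBlock, c1, h1, h2, h3, hx, c2, c3, c4, h4, hz]
        grind
    · by_cases h4 : x = z
      · subst h4
        simp [zeroBlock, c1, h2, h3, hz, c2]
      · simp [zeroBlock, c1, h2, h3, h4, hz, c2]
    · by_cases h4 : x = z
      · subst h4
        simp [zeroBlock, c1, h1, h2, h3, hx, c2]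
        ring
      · simp [zeroBlock, c1, h1, h2, h3, h4, hx]
        ring
    · have c3 : ¬ z = x.rev := by omega
      have c4 : ¬ z < x.rev := by omega
      have c5 : ¬ (x = z ∧ x < x.rev) := by omega
      by_cases h4 : x = z
      · subst h4
        have c6 : ¬ x < x.rev := fun e => c5 ⟨rfl, e⟩
        simp [zeroBlock, c1, h1, h2, h3, hz, c2, c3, c6]
      · simp [zeroBlock, c1, h1, h2, h3, h4, c3, c4, hz, c2]

theorem braidDefect_zero_left_zero_right {q : ℝ} (hq : 0 < q) {a x z : Fin m} (hx : x ≠ a)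
    (hz : z ≠ a) (hz' : z ≠ a.rev) : braidDefect q m (x, x.rev, a) (a, z, z.rev) = 0 := by
  have haz : a ≠ z.rev := fun e => hz' (rev_eq_iff.1 e.symm)
  have hza : z.rev ≠ a.rev := fun e => hz (Fin.rev_inj.1 e)
  rw [braidDefect_zero_left q hx, sub_eq_zero]
  have e1 : ∀ y, (legsRight (braid q m)).mulVec
      (fun s => legsLeft (braid q m) s (a, z, z.rev)) (y, y.rev, a) =
        (if y = z then 1 else 0) +
          if y = a then zeroBlock q m a.rev z * (if a < z then nu q else 0) else 0 := by
    intro y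
    by_cases h : y = a
    · subst h
      rw [legsRight_mulVec_braid_zero', Finset.sum_eq_single z]
      · simp [legsLeft, braid_diag q hz.symm hz', hz.symm]
      · intro p _ hp
        simp [legsLeft, hp]
      · simp
    · rw [legsRight_mulVec_braid_zero_left q h]
      by_cases h2 : y = a.rev
      · subst h2
        simp [legsLeft, h, haz, hz'.symm]
      · by_cases h3 : y = z
        · subst h3
          simp [legsLeft, h, h2, haz, braid_swap q hz haz]
        · simp [legsLeft, h, h2, haz, h3]
  have e2 : ∀ y, legsRight (braid q m) (y, y.rev, a) (a, z, z.rev) =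
      if y = a then zeroBlock q m a.rev z else 0 := by
    intro y
    by_cases h : y = a
    · subst h
      simp [legsRight, braid_zero']
    · simp [legsRight, h]
  simp only [e1, e2, mul_add, mul_ite, mul_zero, mul_one, Finset.sum_add_distrib,
    Finset.sum_ite_eq', Finset.mem_univ, if_true]
  have e3 : legsRight (braid q m) (x, a, x.rev) (a, z, z.rev) = 0 := by
    simp [legsRight, hx]
  have e4 : legsRight (braid q m) (a, x, x.rev) (a, z, z.rev) = zeroBlock q m x z := by
    simp [legsRight, braid_zero]
  rw [e3, e4]
  have hqq := mul_inv_cancel₀ hq.ne'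
  have ma := met_mul_rev hq a
  have l1 : x.rev.val = m - (x + 1) := Fin.val_rev x
  have l2 : z.rev.val = m - (z + 1) := Fin.val_rev z
  have l3 : a.rev.val = m - (a + 1) := Fin.val_rev a
  by_cases h : x = a.rev
  · subst h
    by_cases h1 : z < a
    · simp [zeroBlock, hz, hz'.symm, alpha, hx, h1, h1.not_gt]
      grind
    · simp [zeroBlock, hz, hz'.symm, h1]
  · have h1 : a ≠ x.rev := fun e => h (rev_eq_iff.1 e.symm)
    rw [if_neg h]
    have c1 : a.rev < x ↔ ¬ a < x.rev := by omega
    have c2 : ¬ a.rev = z := fun e => hz' e.symm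
    by_cases h2 : a < x.rev
    · by_cases h3 : z < a
      · simp [c1, h2, h3.not_gt]
      · simp [zeroBlock, c1, h2, h3, c2, hz]
    · simp [zeroBlock, c1, h1, h2, hx]

theorem braidDefect_mid_mid (q : ℝ) {a x z : Fin m} (hx : x ≠ a) (hx' : x ≠ a.rev)
    (hz : z ≠ a) (hz' : z ≠ a.rev) : braidDefect q m (x, a, x.rev) (z, a, z.rev) = 0 := by
  have haz : a ≠ z.rev := fun e => hz' (rev_eq_iff.1 e.symm)
  have hza : z.rev ≠ a.rev := fun e => hz (Fin.rev_inj.1 e)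
  have hax : a ≠ x.rev := fun e => hx' (rev_eq_iff.1 e.symm)
  have hxa : x.rev ≠ a.rev := fun e => hx (Fin.rev_inj.1 e)
  have hxa' : a ≠ x.rev.rev := by rw [Fin.rev_rev]; exact hx.symm
  have hza' : a ≠ z.rev.rev := by rw [Fin.rev_rev]; exact hz.symm
  rw [braidDefect_apply, legsLeft_mulVec_braid_of_ne q hax, legsRight_mulVec_braid_zero,
    legsRight_mulVec_braid_of_ne q hxa, legsRight_mulVec_braid_of_ne q hxa,
    legsLeft_mulVec_braid_zero, legsLeft_mulVec_braid_of_ne q hax, sub_eq_zero]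
  have e1 : ∀ y, legsLeft (braid q m) (a, y, y.rev) (z, a, z.rev) = if y = z then 1 else 0 := by
    intro y
    by_cases h : y = z
    · subst h
      simp [legsLeft, braid_swap q hz.symm hz']
    · simp [legsLeft, h]
  have e2 : ∀ y, legsRight (braid q m) (y, y.rev, a) (z, a, z.rev) = if y = z then 1 else 0 := by
    intro y
    by_cases h : y = z
    · subst h
      simp [legsRight, braid_swap q haz.symm hza']
    · simp [legsRight, h]
  simp only [e1, e2]
  by_cases h : x = z
  · subst h
    simp [legsLeft, legsRight, hx, hax, hx.symm, braid_diag q hx hax, braid_diag q hax hxa]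
    split_ifs <;> ring
  · simp [legsLeft, legsRight, hx, hax, haz, hz.symm, h]

/-- No two of the three positions carry dual indices, so only permutations of (i, j, k) occur and R̂
acts as the Hecke matrix of type A. The relation then reduces to q² = νq + 1. -/
theorem braidDefect_of_ne {q : ℝ} (hq : 0 < q) {i j k : Fin m} (hij : j ≠ i.rev)
    (hjk : k ≠ j.rev) (hik : k ≠ i.rev) (c : Fin m × Fin m × Fin m) :
    braidDefect q m (i, j, k) c = 0 := by
  have hji : i ≠ j.rev := fun e => hij (rev_eq_iff.1 e.symm)
  have hkj : j ≠ k.rev := fun e => hjk (rev_eq_iff.1 e.symm)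
  have h : ∀ f : Fin m × Fin m × Fin m → ℝ, (braidDefect q m).mulVec f (i, j, k) = 0 := by
    intro f
    rw [braidDefect_mulVec, Pi.sub_apply]
    simp only [legsLeft_mulVec_braid_of_ne q hij, legsLeft_mulVec_braid_of_ne q hji,
      legsLeft_mulVec_braid_of_ne q hjk, legsLeft_mulVec_braid_of_ne q hik,
      legsRight_mulVec_braid_of_ne q hij, legsRight_mulVec_braid_of_ne q hjk,
      legsRight_mulVec_braid_of_ne q hkj, legsRight_mulVec_braid_of_ne q hik]
    have hqq := mul_inv_cancel₀ hq.ne'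
    have h2 : nu q = q - q⁻¹ := rfl
    have h3 : q * q = nu q * q + 1 := by rw [h2]; linear_combination hqq
    rcases eq_or_ne i j with rfl | n1
    · rcases eq_or_ne i k with rfl | n2
      · simp
      · rcases lt_or_gt_of_ne n2 with h4 | h4 <;> simp [h4.ne, h4.ne', h4, h4.not_gt] <;> grind
    · rcases eq_or_ne j k with rfl | n2
      · rcases lt_or_gt_of_ne n1 with h4 | h4 <;> simp [h4.ne, h4.ne', h4, h4.not_gt] <;> grind
      · rcases eq_or_ne i k with rfl | n3
        · rcases lt_or_gt_of_ne n1 with h4 | h4 <;> simp [h4.ne, h4.ne', h4, h4.not_gt] <;> grind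
        · rcases lt_or_gt_of_ne n1 with h4 | h4 <;> rcases lt_or_gt_of_ne n2 with h5 | h5 <;>
            rcases lt_or_gt_of_ne n3 with h6 | h6 <;>
            simp [h4, h4.ne, h4.ne', h4.not_gt, h5, h5.ne, h5.ne', h5.not_gt, h6, h6.ne, h6.ne',
              h6.not_gt] <;> grind
  have := h (Pi.single c 1)
  rwa [Matrix.mulVec_single_one] at this

/-- The weight 2 at b, 1/2 at b' and 1 elsewhere separates the two indices when b ≠ b'. At most one
index is self-dual, so otherwise a and b exchange roles. -/
theorem exists_weight_ne {a b : Fin m} (h : a ≠ b) :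
    ∃ χ : Fin m → ℝ, (∀ i, χ i * χ i.rev = 1) ∧ χ a ≠ χ b := by
  wlog hb : b ≠ b.rev generalizing a b
  · have ha : a ≠ a.rev := by
      intro ha
      push Not at hb
      have h1 := congrArg Fin.val ha
      have h2 := congrArg Fin.val hb
      rw [Fin.val_rev] at h1 h2
      exact h (Fin.ext (by omega))
    obtain ⟨χ, h1, h2⟩ := this h.symm ha
    exact ⟨χ, h1, h2.symm⟩
  refine ⟨fun i => if i = b then 2 else if i = b.rev then 2⁻¹ else 1, fun i => ?_, ?_⟩
  · by_cases h1 : i = b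
    · subst h1; simp [hb.symm]
    · by_cases h2 : i = b.rev
      · subst h2; simp [hb.symm]
      · have h3 : ¬ i.rev = b := fun e => h2 (rev_eq_iff.1 e)
        simp [h1, h2, h3]
  · simp only [h, if_false, if_true]
    split_ifs <;> norm_num

theorem braidDefect_eq_zero_of_weight (q : ℝ) {r c : Fin m × Fin m × Fin m} {a b : Fin m}
    (hab : a ≠ b)
    (hr : ∀ χ : Fin m → ℝ, (∀ i, χ i * χ i.rev = 1) → χ r.1 * χ r.2.1 * χ r.2.2 = χ a)
    (hc : ∀ χ : Fin m → ℝ, (∀ i, χ i * χ i.rev = 1) → χ c.1 * χ c.2.1 * χ c.2.2 = χ b) :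
    braidDefect q m r c = 0 := by
  obtain ⟨χ, h1, h2⟩ := exists_weight_ne hab
  have h := braidDefect_weight q h1 r.1 r.2.1 r.2.2 c.1 c.2.1 c.2.2
  rw [hr χ h1, hc χ h1, ← sub_eq_zero, ← mul_sub] at h
  exact (mul_eq_zero.1 h).resolve_right (sub_ne_zero.2 h2)

theorem sum_met_mul_braidDefect_right {q : ℝ} (hq : 0 < q) (a : Fin m)
    (r : Fin m × Fin m × Fin m) :
    ∑ x, met q m x * braidDefect q m r (a, x, x.rev) = 0 := by
  have h := sum_met_mul_braidDefect hq a.rev (tripleFlip m r)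
  have e : ∀ x, braidDefect q m (tripleFlip m r) (x, x.rev, a.rev) =
      - braidDefect q m r (a, x, x.rev) := fun x => by
    rw [← braidDefect_flip]
    simp [tripleFlip]
  simpa [e] using h

theorem eq_zero_of_sum_met {q : ℝ} (hq : 0 < q) {f : Fin m → ℝ} (hf : ∑ x, met q m x * f x = 0)
    (a : Fin m) (h : ∀ x, x ≠ a → f x = 0) (x : Fin m) : f x = 0 := by
  by_cases hx : x = a
  · subst hx
    rw [Finset.sum_eq_single x (fun b _ hb => by rw [h b hb, mul_zero]) (by simp)] at hf
    exact (mul_eq_zero.1 hf).resolve_left (met_pos hq m x).ne'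
  · exact h x hx

/-- Columns of another weight vanish by the torus, columns without a dual pair by
`braidDefect_of_ne`. The other columns have the form (z, z', a), (z, a, z') or (a, z, z') and are
computed for x ≠ a and generic z. The exceptional entries at z = a, and finally those at x = a,
follow from the vanishing of the metric-weighted sums. -/
theorem braidDefect_zero_row {q : ℝ} (hq : 0 < q) (x a : Fin m) (c : Fin m × Fin m × Fin m) :
    braidDefect q m (x, x.rev, a) c = 0 := by
  have hs := sum_met_mul_braidDefect hq a c
  simp only [braidDefect_symm q c] at hs
  refine eq_zero_of_sum_met hq (f := fun x => braidDefect q m (x, x.rev, a) c) hs a ?_ x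
  clear hs x
  intro x hx
  have hr : ∀ χ : Fin m → ℝ, (∀ i, χ i * χ i.rev = 1) → χ x * χ x.rev * χ a = χ a :=
    fun χ h => by rw [h, one_mul]
  have hX : ∀ z, braidDefect q m (x, x.rev, a) (z, z.rev, a) = 0 :=
    eq_zero_of_sum_met hq (sum_met_mul_braidDefect hq a _) a fun z hz =>
      braidDefect_zero_left_zero_left hq hx hz
  have hZ : ∀ z, braidDefect q m (x, x.rev, a) (a, z, z.rev) = 0 :=
    eq_zero_of_sum_met hq (sum_met_mul_braidDefect_right hq a _) a fun z hz => by
      -- The triple `(a, a', a)` has both forms, so this entry is already known.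
      by_cases hz' : z = a.rev
      · subst hz'
        simpa using hX a
      · exact braidDefect_zero_left_zero_right hq hx hz hz'
  obtain ⟨p, r, s⟩ := c
  by_cases h1 : r = p.rev
  · subst h1
    by_cases h2 : a = s
    · subst h2; exact hX p
    · exact braidDefect_eq_zero_of_weight q h2 hr fun χ h => by simp [h]
  · by_cases h2 : s = r.rev
    · subst h2
      by_cases h3 : a = p
      · subst h3; exact hZ r
      · exact braidDefect_eq_zero_of_weight q h3 hr fun χ h => by simp [mul_assoc, h]
    · by_cases h3 : s = p.rev
      · subst h3
        by_cases h4 : a = r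
        · subst h4
          refine braidDefect_zero_left_mid hq hx ?_ ?_
          · rintro rfl; exact h2 rfl
          · rintro rfl; exact h1 (by simp)
        · refine braidDefect_eq_zero_of_weight q h4 hr fun χ h => ?_
          change χ p * χ r * χ p.rev = χ r
          rw [mul_right_comm, h, one_mul]
      · rw [braidDefect_symm]
        exact braidDefect_of_ne hq h1 h2 h3 _

theorem braidDefect_zero_row_right {q : ℝ} (hq : 0 < q) (x a : Fin m)
    (c : Fin m × Fin m × Fin m) : braidDefect q m (a, x, x.rev) c = 0 := by
  have h := braidDefect_flip q (a, x, x.rev) c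
  have h2 : tripleFlip m (a, x, x.rev) = (x, x.rev, a.rev) := by simp [tripleFlip]
  rw [h2, braidDefect_zero_row hq] at h
  linarith

/-- The braid relation. -/
theorem braid_relation {q : ℝ} (hq : 0 < q) (m : ℕ) :
    legsLeft (braid q m) * legsRight (braid q m) * legsLeft (braid q m) =
      legsRight (braid q m) * legsLeft (braid q m) * legsRight (braid q m) := by
  rw [← sub_eq_zero]
  change braidDefect q m = 0
  have hX := fun x a c => braidDefect_zero_row hq (m := m) x a c
  have hZ := fun x a c => braidDefect_zero_row_right hq (m := m) x a c
  ext ⟨i, j, k⟩ ⟨p, r, s⟩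
  rw [Matrix.zero_apply]
  by_cases h1 : j = i.rev
  · subst h1; exact hX _ _ _
  by_cases h2 : k = j.rev
  · subst h2; exact hZ _ _ _
  by_cases h3 : k = i.rev
  swap
  · exact braidDefect_of_ne hq h1 h2 h3 _
  subst h3
  by_cases h4 : r = p.rev
  · subst h4; rw [braidDefect_symm]; exact hX _ _ _
  by_cases h5 : s = r.rev
  · subst h5; rw [braidDefect_symm]; exact hZ _ _ _
  by_cases h6 : s = p.rev
  swap
  · rw [braidDefect_symm]; exact braidDefect_of_ne hq h4 h5 h6 _
  subst h6
  -- Only rows `(i, j, i')` and columns `(p, r, p')` are left; their weights are those of `j` and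
  -- `r`.
  by_cases h7 : j = r
  · subst h7
    refine braidDefect_mid_mid q ?_ ?_ ?_ ?_
    · rintro rfl; exact h2 rfl
    · rintro rfl; exact h1 (by simp)
    · rintro rfl; exact h5 rfl
    · rintro rfl; exact h4 (by simp)
  · refine braidDefect_eq_zero_of_weight q h7 (fun χ h => ?_) (fun χ h => ?_)
    · change χ i * χ j * χ i.rev = χ j
      rw [mul_right_comm, h, one_mul]
    · change χ p * χ r * χ p.rev = χ r
      rw [mul_right_comm, h, one_mul]

/-- The form of the braid relation for the inverse of the braid matrix. -/
theorem braidInv_relation {q : ℝ} (hq : 0 < q) (m : ℕ) :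
    legsLeft (braidInv q m) * legsRight (braidInv q m) * legsLeft (braid q m) =
      legsRight (braid q m) * (legsLeft (braidInv q m) * legsRight (braidInv q m)) := by
  have h1 : legsLeft (braidInv q m) * legsLeft (braid q m) = 1 := by
    rw [← legsLeft_mul, braidInv_mul_braid hq, legsLeft_one]
  have h2 : legsRight (braidInv q m) * legsRight (braid q m) = 1 := by
    rw [← legsRight_mul, braidInv_mul_braid hq, legsRight_one]
  have h3 : legsLeft (braid q m) * legsLeft (braidInv q m) = 1 := by
    rw [← legsLeft_mul, braid_mul_braidInv hq, legsLeft_one]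
  have h4 : legsRight (braid q m) * legsRight (braidInv q m) = 1 := by
    rw [← legsRight_mul, braid_mul_braidInv hq, legsRight_one]
  have h := braid_relation hq m
  set A := legsLeft (braid q m)
  set A' := legsLeft (braidInv q m)
  set B := legsRight (braid q m)
  set B' := legsRight (braidInv q m)
  calc A' * B' * A = A' * B' * (A * B * A) * (A' * B') := by
        rw [mul_assoc (A' * B'), mul_assoc (A * B), ← mul_assoc A A', h3, one_mul, mul_assoc A,
          h4, mul_one]
    _ = A' * (B' * B) * A * B * (A' * B') := by rw [h]; simp only [mul_assoc]
    _ = B * (A' * B') := by rw [h2, mul_one, h1, one_mul]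

/-! ### The representation of the quantum group given by the braid matrix -/

/-- These are the entries of `braidInv_relation`; the sum over w is the matrix product in the
representation. -/
theorem braidInv_rtt {q : ℝ} (hq : 0 < q) (i j k l u v : Fin m) :
    ∑ a, ∑ b, braid q m (i, j) (a, b) *
        ∑ w, braidInv q m (u, a) (k, w) * braidInv q m (w, b) (l, v) =
      ∑ a, ∑ b, braid q m (a, b) (k, l) *
        ∑ w, braidInv q m (u, i) (a, w) * braidInv q m (w, j) (b, v) := by
  have h := congrFun (congrFun (braidInv_relation hq m) (u, i, j)) (k, l, v)
  rw [Matrix.mul_assoc] at h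
  change (legsLeft (braidInv q m)).mulVec ((legsRight (braidInv q m)).mulVec
      fun s => legsLeft (braid q m) s (k, l, v)) (u, i, j) =
    (legsRight (braid q m)).mulVec ((legsLeft (braidInv q m)).mulVec
      fun s => legsRight (braidInv q m) s (k, l, v)) (u, i, j) at h
  simp only [legsLeft_mulVec, legsRight_mulVec, legsLeft, legsRight, mul_ite, mul_zero,
    Finset.sum_ite_eq', Finset.mem_univ, if_true] at h
  have e1 : ∀ a b : Fin m, ∑ p, ∑ r, braidInv q m (u, a) (p, r) *
      (if p = k then braidInv q m (r, b) (l, v) else 0) =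
        ∑ w, braidInv q m (u, a) (k, w) * braidInv q m (w, b) (l, v) := by
    intro a b
    rw [Finset.sum_eq_single k (fun p _ hp => by simp [hp]) (by simp)]
    simp
  simp only [mul_ite, mul_zero] at e1
  simp only [e1] at h
  rw [← h]
  simp only [Finset.mul_sum]
  refine Finset.sum_congr rfl fun a _ => ?_
  rw [Finset.sum_comm]
  exact Finset.sum_congr rfl fun w _ => Finset.sum_congr rfl fun b _ => by ring

theorem met_weight {q : ℝ} (hq : 0 < q) (i j k l : Fin m) :
    braid q m (i, j) (k, l) * (met q m i * met q m j) =
      braid q m (i, j) (k, l) * (met q m k * met q m l) :=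
  braid_weight q (fun i => met_mul_rev hq i) i j k l

/-- Crossing applied to the first factor turns the double sum into an entry of R̂R̂⁻¹ = 1;
invariance of R̂ under the weights `met` collects the coefficients. -/
theorem braidInv_metric_lower {q : ℝ} (hq : 0 < q) (i j u v : Fin m) :
    ∑ k, met q m k * ∑ w, braidInv q m (u, k) (i, w) * braidInv q m (w, k.rev) (j, v) =
      if u = v then metric q m i j else 0 := by
  have h := congrFun (congrFun (braid_mul_braidInv hq m) (i.rev, u)) (j, v)
  rw [Matrix.mul_apply, Fintype.sum_prod_type, Matrix.one_apply] at h
  have e : ∀ k w, met q m k * (braidInv q m (u, k) (i, w) * braidInv q m (w, k.rev) (j, v)) =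
      met q m i * (braid q m (i.rev, u) (w, k.rev) * braidInv q m (w, k.rev) (j, v)) := by
    intro k w
    rw [braidInv_crossing hq u k i w, braid_flip q m k, Fin.rev_rev, Fin.rev_rev,
      braid_symm q m w k.rev]
    have h1 := met_weight hq i.rev u w k.rev
    have hw := met_mul_rev hq w
    have hk := met_mul_rev hq k
    have hi := met_mul_rev hq i
    have : met q m k * met q m w.rev * met q m u * braid q m (i.rev, u) (w, k.rev) =
        met q m i * braid q m (i.rev, u) (w, k.rev) := by
      linear_combination (- met q m k * met q m w.rev * met q m u *
        braid q m (i.rev, u) (w, k.rev)) * hi + met q m k * met q m w.rev * met q m i * h1 +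
        met q m i * braid q m (i.rev, u) (w, k.rev) * met q m w * met q m w.rev * hk +
        met q m i * braid q m (i.rev, u) (w, k.rev) * hw
    linear_combination braidInv q m (w, k.rev) (j, v) * this
  simp only [Finset.mul_sum, e]
  simp only [← Finset.mul_sum]
  rw [Finset.sum_comm]
  have e2 : ∀ w, ∑ k : Fin m, braid q m (i.rev, u) (w, k.rev) * braidInv q m (w, k.rev) (j, v) =
      ∑ k, braid q m (i.rev, u) (w, k) * braidInv q m (w, k) (j, v) := fun w =>
    Equiv.sum_comp Fin.revPerm fun k => braid q m (i.rev, u) (w, k) * braidInv q m (w, k) (j, v)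
  simp only [e2, h, metric_apply, Prod.mk.injEq]
  by_cases h1 : u = v
  · simp [h1, eq_comm]
  · simp [h1]

/-- Here crossing is applied to the second factor and the result is an entry of R̂⁻¹R̂ = 1. -/
theorem braidInv_metric_upper {q : ℝ} (hq : 0 < q) (i j u v : Fin m) :
    ∑ k, met q m k * ∑ w, braidInv q m (u, i) (k, w) * braidInv q m (w, j) (k.rev, v) =
      if u = v then metric q m i j else 0 := by
  have h := congrFun (congrFun (braidInv_mul_braid hq m) (u, i)) (v, j.rev)
  rw [Matrix.mul_apply, Fintype.sum_prod_type, Matrix.one_apply] at h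
  have e : ∀ k w, met q m k * (braidInv q m (u, i) (k, w) * braidInv q m (w, j) (k.rev, v)) =
      met q m v.rev * met q m v * met q m j.rev *
        (braidInv q m (u, i) (k, w) * braid q m (k, w) (v, j.rev)) := by
    intro k w
    rw [braidInv_crossing hq w j k.rev v, braid_flip q m j, braid_symm q m v.rev.rev j.rev]
    simp only [Fin.rev_rev]
    have h1 := met_weight hq k w v j.rev
    linear_combination met q m v.rev * braidInv q m (u, i) (k, w) * h1
  simp only [Finset.mul_sum, e]
  simp only [← Finset.mul_sum, h, metric_apply, Prod.mk.injEq]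
  have hv := met_rev_mul hq v
  by_cases h1 : u = v
  · by_cases h2 : j = i.rev
    · subst h2; simp [h1, hv]
    · have h3 : ¬ i = j.rev := fun e => h2 (by rw [e, Fin.rev_rev])
      simp [h1, h2, h3]
  · simp [h1]

/-- The representation `t^b_c ↦ (R̂⁻¹)^{ab}_{cd}` of the quantum group. -/
def braidRep (q : ℝ) (hq : 0 < q) (m : ℕ) : OrthGroup q m →ₐ[ℂ] Matrix (Fin m) (Fin m) ℂ :=
  RingQuot.liftAlgHom ℂ ⟨FreeAlgebra.lift ℂ fun bc : Fin m × Fin m =>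
    (Matrix.of fun a d => (braidInv q m (a, bc.1) (bc.2, d) : ℂ)), by
      rintro _ _ (⟨i, j, k, l⟩ | ⟨i, j⟩ | ⟨i, j⟩)
      · ext u v
        simp only [map_sum, map_smul, map_mul, FreeAlgebra.lift_ι_apply, Matrix.sum_apply,
          Matrix.smul_apply, Matrix.mul_apply, Matrix.of_apply, smul_eq_mul]
        exact_mod_cast braidInv_rtt hq i j k l u v
      · ext u v
        simp only [map_sum, map_smul, map_mul, FreeAlgebra.lift_ι_apply, Matrix.sum_apply,
          Matrix.smul_apply, Matrix.mul_apply, Matrix.of_apply, smul_eq_mul, AlgHom.commutes,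
          Matrix.algebraMap_matrix_apply]
        have h := braidInv_metric_upper hq i j u v
        have h0 := sum_metric q (fun k l => ∑ w, braidInv q m (u, i) (k, w) *
          braidInv q m (w, j) (l, v))
        simp only [smul_eq_mul] at h0
        have h2 := congrArg (fun x : ℝ => (x : ℂ)) (h0.trans h)
        push_cast at h2
        rw [h2, Algebra.algebraMap_self_apply]
        split_ifs <;> rfl
      · ext u v
        simp only [map_sum, map_smul, map_mul, FreeAlgebra.lift_ι_apply, Matrix.sum_apply,
          Matrix.smul_apply, Matrix.mul_apply, Matrix.of_apply, smul_eq_mul, AlgHom.commutes,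
          Matrix.algebraMap_matrix_apply]
        have h := braidInv_metric_lower hq i j u v
        have h0 := sum_metric q (fun k l => ∑ w, braidInv q m (u, k) (i, w) *
          braidInv q m (w, l) (j, v))
        simp only [smul_eq_mul] at h0
        have h2 := congrArg (fun x : ℝ => (x : ℂ)) (h0.trans h)
        push_cast at h2
        rw [h2, Algebra.algebraMap_self_apply]
        split_ifs <;> rfl⟩

theorem braidRep_gen {q : ℝ} (hq : 0 < q) (b c : Fin m) :
    braidRep q hq m (gen q m b c) =
      Matrix.of fun a d => (braidInv q m (a, b) (c, d) : ℂ) := by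
  rw [braidRep, gen, RingQuot.liftAlgHom_mkAlgHom_apply, FreeAlgebra.lift_ι_apply]

/-- The character `t = diag χ` of the quantum group. -/
def torusChar (q : ℝ) (m : ℕ) (χ : Fin m → ℝ) (hχ : ∀ i, χ i * χ i.rev = 1) :
    OrthGroup q m →ₐ[ℂ] ℂ :=
  RingQuot.liftAlgHom ℂ ⟨FreeAlgebra.lift ℂ fun ij : Fin m × Fin m =>
    if ij.1 = ij.2 then (χ ij.1 : ℂ) else 0, by
      have h0 : ∀ i, (χ i : ℂ) * χ i.rev = 1 := fun i => by exact_mod_cast hχ i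
      rintro _ _ (⟨i, j, k, l⟩ | ⟨i, j⟩ | ⟨i, j⟩)
      · simp only [map_sum, map_smul, map_mul, FreeAlgebra.lift_ι_apply, smul_eq_mul, ite_mul,
          mul_ite, zero_mul, mul_zero, Finset.sum_ite_eq, Finset.sum_ite_eq', Finset.mem_univ,
          if_true]
        exact_mod_cast (braid_weight q hχ i j k l).symm
      · simp only [map_sum, map_smul, map_mul, FreeAlgebra.lift_ι_apply, smul_eq_mul, ite_mul,
          mul_ite, zero_mul, mul_zero, Finset.sum_ite_eq, Finset.mem_univ, if_true,
          AlgHom.commutes, metric_apply, Algebra.algebraMap_self_apply]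
        split_ifs with h
        · subst h; rw [h0, mul_one]
        · simp
      · simp only [map_sum, map_smul, map_mul, FreeAlgebra.lift_ι_apply, smul_eq_mul, ite_mul,
          mul_ite, zero_mul, mul_zero, Finset.sum_ite_eq', Finset.mem_univ, if_true,
          AlgHom.commutes, metric_apply, Algebra.algebraMap_self_apply]
        split_ifs with h
        · subst h; rw [h0, mul_one]
        · simp⟩

theorem torusChar_gen (q : ℝ) {χ : Fin m → ℝ} (hχ : ∀ i, χ i * χ i.rev = 1) (i j : Fin m) :
    torusChar q m χ hχ (gen q m i j) = if i = j then (χ i : ℂ) else 0 := by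
  rw [torusChar, gen, RingQuot.liftAlgHom_mkAlgHom_apply, FreeAlgebra.lift_ι_apply]

/-! ### Real matrices acting on families of vectors -/

section MatrixAction

variable {ι κ M : Type*} [Fintype κ] [AddCommGroup M] [Module ℂ M]

/-- The family `∑ j, A i j • F j`, for a real matrix `A` and a family `F` of vectors. -/
def matAct {ι' : Type*} (A : Matrix ι' κ ℝ) (F : κ → M) (i : ι') : M := ∑ j, (A i j : ℂ) • F j

theorem matAct_mul {ι' : Type*} [Fintype ι] (A : Matrix ι' ι ℝ) (B : Matrix ι κ ℝ) (F : κ → M) :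
    matAct (A * B) F = matAct A (matAct B F) := by
  ext i
  simp only [matAct, Matrix.mul_apply, Complex.ofReal_sum, Complex.ofReal_mul, Finset.sum_smul,
    Finset.smul_sum, smul_smul]
  exact Finset.sum_comm

theorem matAct_add (A B : Matrix ι κ ℝ) (F : κ → M) :
    matAct (A + B) F = matAct A F + matAct B F := by
  ext i
  simp [matAct, add_smul, Finset.sum_add_distrib]

theorem matAct_sub (A B : Matrix ι κ ℝ) (F : κ → M) :
    matAct (A - B) F = matAct A F - matAct B F := by
  ext i
  simp [matAct, sub_smul, Finset.sum_sub_distrib]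

theorem matAct_smul (c : ℝ) (A : Matrix ι κ ℝ) (F : κ → M) :
    matAct (c • A) F = (c : ℂ) • matAct A F := by
  ext i
  simp [matAct, mul_smul, Finset.smul_sum]

theorem matAct_one [DecidableEq κ] (F : κ → M) : matAct (1 : Matrix κ κ ℝ) F = F := by
  ext i
  simp [matAct, Matrix.one_apply]

theorem matAct_prod {m : ℕ} {ι' : Type*} (A : Matrix ι' (Fin m × Fin m) ℝ)
    (F : Fin m × Fin m → M) (i : ι') :
    matAct A F i = ∑ k, ∑ l, (A i (k, l) : ℂ) • F (k, l) := by
  rw [matAct, Fintype.sum_prod_type]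

theorem sum_metric_smul {m : ℕ} (q : ℝ) (F : Fin m → Fin m → M) :
    ∑ i, ∑ j, (metric q m i j : ℂ) • F i j = ∑ i, (met q m i : ℂ) • F i i.rev := by
  refine Finset.sum_congr rfl fun i _ => ?_
  rw [Finset.sum_eq_single i.rev]
  · rw [metric_apply, if_pos rfl]
  · intro j _ hj
    rw [metric_apply, if_neg hj, Complex.ofReal_zero, zero_smul]
  · simp

omit [Module ℂ M] in
theorem sum_rev {m : ℕ} (F : Fin m → M) : ∑ i, F (Fin.rev i) = ∑ i, F i :=
  Equiv.sum_comp Fin.revPerm F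

theorem sum_smul_mul_sum_smul {ι κ ι' A : Type*} [Fintype ι] [Fintype κ] [Fintype ι'] [Semiring A]
    [Algebra ℂ A] (a : κ → ι → ℂ) (b : ι → ι' → ℂ) (x : κ → A) (y : ι' → A) :
    ∑ w, (∑ c, a c w • x c) * (∑ d, b w d • y d) =
      ∑ c, ∑ d, (∑ w, a c w * b w d) • (x c * y d) := by
  simp only [Finset.sum_mul_sum, smul_mul_smul_comm, Finset.sum_smul]
  rw [Finset.sum_comm]
  exact Finset.sum_congr rfl fun c _ => Finset.sum_comm

theorem sum_smul_sum_sum_smul {ι κ ι' N : Type*} [Fintype ι] [Fintype κ] [Fintype ι']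
    [AddCommMonoid N] [Module ℂ N] (a : ι → ℂ) (b : ι → κ → ι' → ℂ) (z : κ → ι' → N) :
    ∑ k, a k • ∑ c, ∑ d, b k c d • z c d = ∑ c, ∑ d, (∑ k, a k * b k c d) • z c d := by
  simp only [Finset.smul_sum, smul_smul, Finset.sum_smul]
  rw [Finset.sum_comm]
  exact Finset.sum_congr rfl fun c _ => Finset.sum_comm

end MatrixAction

variable {q : ℝ}

theorem met_mul_rev_cast (hq : 0 < q) (i : Fin m) : (met q m i : ℂ) * met q m i.rev = 1 := by
  exact_mod_cast met_mul_rev hq i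

theorem met_rev_mul_cast (hq : 0 < q) (i : Fin m) : (met q m i.rev : ℂ) * met q m i = 1 := by
  exact_mod_cast met_rev_mul hq i

/-! ### Words in the coordinates and the grading -/

/-- The product of the coordinates with the indices in a list. -/
def word (q : ℝ) (m : ℕ) (w : List (Fin m)) : Poly q m := (w.map (coord q m)).prod

@[simp] theorem word_nil : word q m [] = 1 := rfl

@[simp] theorem word_cons (j : Fin m) (w : List (Fin m)) :
    word q m (j :: w) = coord q m j * word q m w := by simp [word]

theorem word_append (v w : List (Fin m)) : word q m (v ++ w) = word q m v * word q m w := by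
  simp [word]

/-- The polynomials that are homogeneous of degree `n`. -/
def homog (q : ℝ) (m : ℕ) (n : ℤ) : Submodule ℂ (Poly q m) :=
  Submodule.span ℂ {f | ∃ w : List (Fin m), (w.length : ℤ) = n ∧ word q m w = f}

theorem word_mem_homog (w : List (Fin m)) : word q m w ∈ homog q m w.length :=
  Submodule.subset_span ⟨w, rfl, rfl⟩

/-- Induction on words for claims that depend on the degree. Only spans are used; the degrees are
not claimed to be independent. The integer index makes negative degrees zero, so lowering the degree
needs no truncation. -/
theorem homog_le {S : ℤ → Submodule ℂ (Poly q m)} (one : 1 ∈ S 0)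
    (mul : ∀ d j f, f ∈ S d → coord q m j * f ∈ S (d + 1)) (n : ℤ) : homog q m n ≤ S n := by
  refine Submodule.span_le.mpr ?_
  rintro _ ⟨w, rfl, rfl⟩
  induction w with
  | nil => simpa using one
  | cons j w ih => simpa using mul _ j _ ih

/-- Left multiplication by the image of any element of the free algebra preserves S; applied to 1 it
reaches every polynomial. -/
theorem poly_mem {S : Submodule ℂ (Poly q m)} (one : 1 ∈ S)
    (mul : ∀ j f, f ∈ S → coord q m j * f ∈ S) (f : Poly q m) : f ∈ S := by
  obtain ⟨g, rfl⟩ := RingQuot.mkAlgHom_surjective ℂ (PolyRel q m) f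
  have key : ∀ g : FreeAlgebra ℂ (Fin m), ∀ h ∈ S,
      RingQuot.mkAlgHom ℂ (PolyRel q m) g * h ∈ S := by
    intro g
    induction g using FreeAlgebra.induction with
    | grade0 r =>
      intro h hh
      rw [AlgHom.commutes, ← Algebra.smul_def]
      exact S.smul_mem _ hh
    | grade1 x => exact fun h hh => mul x h hh
    | mul a b ha hb =>
      intro h hh
      rw [map_mul, mul_assoc]
      exact ha _ (hb _ hh)
    | add a b ha hb =>
      intro h hh
      rw [map_add, add_mul]
      exact S.add_mem (ha _ hh) (hb _ hh)
  simpa using key g 1 one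

theorem poly_mem_of_word {S : Submodule ℂ (Poly q m)} (h : ∀ w, word q m w ∈ S)
    (f : Poly q m) : f ∈ S := by
  have key : ∀ f : Poly q m, f ∈ Submodule.span ℂ (Set.range (word q m)) := by
    refine poly_mem (Submodule.subset_span ⟨[], rfl⟩) fun j f hf => ?_
    induction hf using Submodule.span_induction with
    | mem f hf =>
      obtain ⟨w, rfl⟩ := hf
      exact Submodule.subset_span ⟨j :: w, word_cons j w⟩
    | zero => simp
    | add a b _ _ ha hb => rw [mul_add]; exact Submodule.add_mem _ ha hb
    | smul c a _ ha => rw [mul_smul_comm]; exact Submodule.smul_mem _ c ha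
  refine Submodule.span_le.mpr ?_ (key f)
  rintro _ ⟨w, rfl⟩
  exact h w

theorem coord_mul_mem_homog {n : ℤ} (j : Fin m) {f : Poly q m} (hf : f ∈ homog q m n) :
    coord q m j * f ∈ homog q m (n + 1) := by
  induction hf using Submodule.span_induction with
  | mem f hf =>
    obtain ⟨w, rfl, rfl⟩ := hf
    simpa using word_mem_homog (q := q) (j :: w)
  | zero => simp
  | add a b _ _ ha hb => rw [mul_add]; exact Submodule.add_mem _ ha hb
  | smul c a _ ha => rw [mul_smul_comm]; exact Submodule.smul_mem _ c ha

theorem evalZero_coord (i : Fin m) : evalZero q m (coord q m i) = 0 := by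
  rw [evalZero, coord, RingQuot.liftAlgHom_mkAlgHom_apply, FreeAlgebra.lift_ι_apply]

theorem evalZero_of_mem_homog {n : ℤ} (hn : n ≠ 0) {f : Poly q m} (hf : f ∈ homog q m n) :
    evalZero q m f = 0 := by
  induction hf using Submodule.span_induction with
  | mem f hf =>
    obtain ⟨w, rfl, rfl⟩ := hf
    cases w with
    | nil => simp at hn
    | cons j w => rw [word_cons, map_mul, evalZero_coord, zero_mul]
  | zero => simp
  | add a b _ _ ha hb => rw [map_add, ha, hb, add_zero]
  | smul c a _ ha => rw [map_smul, ha, smul_zero]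

/-! ### The quadratic relations -/

theorem normSq_eq_sum : normSq q m = ∑ i, (met q m i : ℂ) • (coord q m i * coord q m i.rev) :=
  sum_metric_smul q fun i j => coord q m i * coord q m j

/-- The quadratic monomials. -/
def quad (q : ℝ) (m : ℕ) (ij : Fin m × Fin m) : Poly q m := coord q m ij.1 * coord q m ij.2

theorem mu_eq (hq : 0 < q) : mu q m = 1 + q * zeta q m := by
  rw [mu, zeta, ← zpow_one_add₀ hq.ne']
  congr 2
  ring

theorem mu_pos (hq : 0 < q) : 0 < mu q m := by
  rw [mu_eq hq]
  have := mul_pos hq (zeta_pos hq m)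
  linarith

/-- By `braid_mul_self` the product (R̂ - q)(R̂ - ζ) is linear in R̂ and K, with constant term 1 +
qζ = μ. -/
theorem antisymmetrizer_smul (hq : 0 < q) :
    ((q⁻¹ + q) * (q⁻¹ + zeta q m)) • antisymmetrizer q m =
      -(q⁻¹ * mu q m) • braid q m + mu q m • (1 : Matrix (Fin m × Fin m) (Fin m × Fin m) ℝ)
        - (nu q * zeta q m) • capCup q m := by
  have hz := zeta_pos hq m
  have hqi := inv_pos.mpr hq
  have h1 : (q⁻¹ + q) * (q⁻¹ + zeta q m) ≠ 0 := by positivity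
  rw [antisymmetrizer, ← zeta, smul_inv_smul₀ h1, sub_mul, mul_sub, mul_sub, braid_mul_self hq,
    mu_eq hq]
  simp only [Matrix.mul_smul, Matrix.smul_mul, Matrix.mul_one, Matrix.one_mul]
  have e1 : -(q⁻¹ * (1 + q * zeta q m)) = -q⁻¹ - zeta q m := by field_simp; ring
  rw [e1, nu]
  module

/-- The eigenvalue of R̂ belonging to P_A is -q⁻¹. This makes the inhomogeneous term C^{ij} of the
Leibniz rule compatible with the relations. -/
theorem antisymmetrizer_mul_one_add (hq : 0 < q) :
    antisymmetrizer q m * (1 + q • braid q m) = 0 := by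
  have hz := zeta_pos hq m
  have hqi := inv_pos.mpr hq
  have h1 : (q⁻¹ + q) * (q⁻¹ + zeta q m) ≠ 0 := by positivity
  have h2 : ((q⁻¹ + q) * (q⁻¹ + zeta q m)) • (antisymmetrizer q m * (1 + q • braid q m)) = 0 := by
    rw [← Matrix.smul_mul, antisymmetrizer_smul hq, sub_mul, add_mul, mul_add, mul_add, mul_add]
    simp only [Matrix.mul_smul, Matrix.smul_mul, Matrix.mul_one, Matrix.one_mul,
      braid_mul_self hq, capCup_mul_braid hq, mu_eq hq, nu]
    ext a b
    simp only [Matrix.add_apply, Matrix.sub_apply, Matrix.smul_apply, smul_eq_mul,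
      Matrix.zero_apply]
    field_simp
    ring
  exact (smul_eq_zero.mp h2).resolve_left h1

theorem matAct_capCup_quad (i j : Fin m) :
    matAct (capCup q m) (quad q m) (i, j) = (metric q m i j : ℂ) • normSq q m := by
  simp only [matAct_prod, capCup, normSq, quad, Finset.smul_sum, smul_smul, Complex.ofReal_mul]

/-- Since P_A kills x ⊗ x and K sends it to C𝐱², `antisymmetrizer_smul` can be solved for R̂(x ⊗ x).
-/
theorem matAct_braid_quad (hq : 0 < q) (i j : Fin m) :
    matAct (braid q m) (quad q m) (i, j) = (q : ℂ) • quad q m (i, j) -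
      ((nu q * q * zeta q m / mu q m : ℝ) : ℂ) • (metric q m i j : ℂ) • normSq q m := by
  have h0 : matAct (antisymmetrizer q m) (quad q m) = 0 := by
    ext ⟨i, j⟩
    rw [matAct_prod]
    exact antisymm_coord q m i j
  have h1 := congrArg (fun A => matAct A (quad q m) (i, j)) (antisymmetrizer_smul (m := m) hq)
  simp only [matAct_sub, matAct_add, matAct_smul, matAct_one, h0, Pi.sub_apply, Pi.add_apply,
    Pi.smul_apply, matAct_capCup_quad, smul_zero, Pi.zero_apply] at h1
  have hmu := mu_pos (m := m) hq
  have hmu' : (mu q m : ℂ) ≠ 0 := by exact_mod_cast hmu.ne'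
  have hq' : (q : ℂ) ≠ 0 := by exact_mod_cast hq.ne'
  linear_combination (norm := skip) (q / mu q m : ℂ) • h1
  match_scalars <;> field_simp <;> ring

theorem matAct_braidInv_quad (hq : 0 < q) (i j : Fin m) :
    matAct (braidInv q m) (quad q m) (i, j) = (q⁻¹ : ℂ) • quad q m (i, j) +
      (nu q / mu q m : ℂ) • (metric q m i j : ℂ) • normSq q m := by
  have h : matAct (braidInv q m) (quad q m) (i, j) = matAct (braid q m) (quad q m) (i, j) -
      (nu q : ℂ) • quad q m (i, j) + (nu q : ℂ) • (metric q m i j : ℂ) • normSq q m := by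
    rw [braidInv, matAct_add, matAct_sub, matAct_smul, matAct_smul, matAct_one, Pi.add_apply,
      Pi.sub_apply, Pi.smul_apply, Pi.smul_apply, matAct_capCup_quad]
  have hmu' : (mu q m : ℂ) ≠ 0 := by exact_mod_cast (mu_pos (m := m) hq).ne'
  have hq' : (q : ℂ) ≠ 0 := by exact_mod_cast hq.ne'
  have hmu : (mu q m : ℂ) = 1 + q * zeta q m := by exact_mod_cast mu_eq hq
  rw [h, matAct_braid_quad hq]
  match_scalars
  · simp only [nu]; push_cast; ring
  · field_simp
    rw [hmu]
    ring

/-! ### The twist of the coordinates by the braid matrix -/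

/-- The algebra morphism with `x^b ↦ ((R̂⁻¹)^{ab}_{cd} x^c)_{ad}`, obtained by evaluating the
quantum group in the coaction. -/
def coactionRep (q : ℝ) (hq : 0 < q) (m : ℕ) :
    OrthGroup q m ⊗[ℂ] Poly q m →ₐ[ℂ] Matrix (Fin m) (Fin m) (Poly q m) :=
  Algebra.TensorProduct.lift ((Algebra.ofId ℂ (Poly q m)).mapMatrix.comp (braidRep q hq m))
    (Matrix.scalarAlgHom (Fin m) ℂ) fun a f => by
      change Commute ((Algebra.ofId ℂ (Poly q m)).mapMatrix (braidRep q hq m a))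
        (Matrix.scalar (Fin m) f)
      refine (Matrix.scalar_commute_iff.mpr ?_).symm
      ext i j
      exact (Algebra.commutes (braidRep q hq m a i j) f).symm

/-- The algebra morphism with `x^b ↦ ((R̂⁻¹)^{ab}_{cd} x^c)_{ad}`. -/
def twist (q : ℝ) (hq : 0 < q) (m : ℕ) : Poly q m →ₐ[ℂ] Matrix (Fin m) (Fin m) (Poly q m) :=
  (coactionRep q hq m).comp (coaction q m)

theorem coaction_coord (i : Fin m) :
    coaction q m (coord q m i) = ∑ j, gen q m i j ⊗ₜ[ℂ] coord q m j := by
  rw [coaction, coord, RingQuot.liftAlgHom_mkAlgHom_apply, FreeAlgebra.lift_ι_apply]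

theorem coactionRep_tmul (hq : 0 < q) (t : OrthGroup q m) (f : Poly q m) (a d : Fin m) :
    coactionRep q hq m (t ⊗ₜ f) a d = braidRep q hq m t a d • f := by
  rw [coactionRep, Algebra.TensorProduct.lift_tmul]
  simp [Matrix.mul_apply, Matrix.diagonal_apply, Algebra.ofId_apply, Algebra.smul_def]

theorem twist_coord (hq : 0 < q) (a b d : Fin m) :
    twist q hq m (coord q m b) a d = ∑ c, (braidInv q m (a, b) (c, d) : ℂ) • coord q m c := by
  rw [twist, AlgHom.comp_apply, coaction_coord, map_sum, Matrix.sum_apply]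
  refine Finset.sum_congr rfl fun c _ => ?_
  rw [coactionRep_tmul, braidRep_gen, Matrix.of_apply]

/-- The representation and J act on different tensor factors. Coinvariance thereby becomes a
statement about `twist`. -/
theorem apply_coactionRep (hq : 0 < q) (J : Poly q m →ₗ[ℂ] ℂ) (τ : OrthGroup q m ⊗[ℂ] Poly q m)
    (a d : Fin m) :
    J (coactionRep q hq m τ a d) =
      braidRep q hq m (TensorProduct.rid ℂ _ (LinearMap.lTensor _ J τ)) a d := by
  induction τ using TensorProduct.induction_on with
  | zero => simp
  | tmul t f =>
    rw [coactionRep_tmul, LinearMap.lTensor_tmul, TensorProduct.rid_tmul, map_smul, map_smul,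
      Matrix.smul_apply, smul_eq_mul, smul_eq_mul, mul_comm]
  | add x y hx hy =>
    simp only [map_add, Matrix.add_apply, hx, hy]

theorem IsCoinvariant.twist {J : Poly q m →ₗ[ℂ] ℂ} (hJ : IsCoinvariant q m J) (hq : 0 < q)
    (f : Poly q m) (a d : Fin m) :
    J (twist q hq m f a d) = if a = d then J f else 0 := by
  rw [QuantumEuclidean.twist, AlgHom.comp_apply, apply_coactionRep, hJ f, map_smul, map_one,
    Matrix.smul_apply, Matrix.one_apply, smul_eq_mul, mul_ite, mul_one, mul_zero]

/-- Coinvariance of 𝐱², read in the representation; the contraction is `braidInv_metric_lower`. -/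
theorem twist_normSq (hq : 0 < q) :
    twist q hq m (normSq q m) = Matrix.scalar (Fin m) (normSq q m) := by
  ext u v
  have h : ∀ c d, ∑ k, (met q m k : ℂ) * ∑ w, (braidInv q m (u, k) (c, w) : ℂ) *
      braidInv q m (w, k.rev) (d, v) = if u = v then (metric q m c d : ℂ) else 0 := by
    intro c d
    have := congrArg (fun x : ℝ => (x : ℂ)) (braidInv_metric_lower hq c d u v)
    push_cast at this
    rw [this]
    split_ifs <;> rfl
  have e : twist q hq m (normSq q m) u v = ∑ c, ∑ d, (∑ k, (met q m k : ℂ) *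
      ∑ w, (braidInv q m (u, k) (c, w) : ℂ) * braidInv q m (w, k.rev) (d, v)) •
        (coord q m c * coord q m d) := by
    rw [normSq_eq_sum]
    simp only [map_sum, map_smul, map_mul, Matrix.sum_apply, Matrix.smul_apply, Matrix.mul_apply,
      twist_coord]
    refine Eq.trans ?_ (sum_smul_sum_sum_smul _ _ _)
    exact Finset.sum_congr rfl fun k _ => congrArg _ (sum_smul_mul_sum_smul _ _ _ _)
  rw [e]
  simp only [h, Matrix.scalar_apply, Matrix.diagonal_apply]
  by_cases huv : u = v
  · simp only [huv, if_true, normSq]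
  · simp [huv]

/-! ### The norm squared is central -/

theorem sum_metSq_braidInv (hq : 0 < q) (a c : Fin m) :
    ∑ b, (met q m b : ℂ) * ((met q m b : ℂ) * braidInv q m (a, b) (c, b)) =
      if a = c then (zeta q m : ℂ) else 0 := by
  have h := sum_metric_braid hq a.rev c
  have e : ∀ b, met q m b * (met q m b * braidInv q m (a, b) (c, b)) =
      met q m a * (met q m b * braid q m (b, b.rev) (a.rev, c)) := by
    intro b
    rw [braidInv_crossing hq]
    linear_combination met q m a * met q m b * braid q m (b, b.rev) (a.rev, c) * met_mul_rev hq b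
  have h2 : ∑ b, met q m b * (met q m b * braidInv q m (a, b) (c, b)) =
      if a = c then zeta q m else 0 := by
    simp only [e, ← Finset.mul_sum, h, metric_apply, Fin.rev_rev]
    by_cases hac : a = c
    · subst hac
      simp only [if_true]
      linear_combination zeta q m * met_mul_rev hq a
    · simp [hac, Ne.symm hac]
  have h3 := congrArg (fun x : ℝ => (x : ℂ)) h2
  push_cast at h3
  rw [h3]
  split_ifs <;> rfl

theorem sum_met_braidInv_metric_smul {M : Type*} [AddCommGroup M] [Module ℂ M] (hq : 0 < q)
    (v : Fin m → M) (a : Fin m) :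
    ∑ b, (met q m b : ℂ) •
      matAct (braidInv q m) (fun cd => (metric q m cd.2 b.rev : ℂ) • v cd.1) (a, b) =
        (zeta q m : ℂ) • v a := by
  have e : ∀ b, matAct (braidInv q m) (fun cd => (metric q m cd.2 b.rev : ℂ) • v cd.1) (a, b) =
      ∑ c, ((met q m b : ℂ) * braidInv q m (a, b) (c, b)) • v c := by
    intro b
    rw [matAct_prod]
    refine Finset.sum_congr rfl fun c _ => ?_
    rw [Finset.sum_eq_single b]
    · rw [metric_apply, if_pos rfl, smul_smul, mul_comm]
    · intro d _ hd
      rw [metric_apply, if_neg (fun h => hd (Fin.rev_injective h).symm)]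
      simp
    · simp
  simp only [e, Finset.smul_sum, smul_smul]
  rw [Finset.sum_comm]
  simp only [← Finset.sum_smul, sum_metSq_braidInv hq, ite_smul, zero_smul, Finset.sum_ite_eq,
    Finset.mem_univ, if_true]

theorem sum_met_metric_smul {M : Type*} [AddCommGroup M] [Module ℂ M] (hq : 0 < q)
    (v : Fin m → M) (a : Fin m) :
    ∑ b, (met q m b : ℂ) • (metric q m a b : ℂ) • v b.rev = v a := by
  rw [Finset.sum_eq_single a.rev]
  · rw [metric_apply, if_pos rfl, smul_smul, met_rev_mul_cast hq, Fin.rev_rev, one_smul]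
  · intro b _ hb
    rw [metric_apply, if_neg hb]
    simp
  · simp

theorem matAct_linear {ι κ M N : Type*} [Fintype κ] [AddCommGroup M] [Module ℂ M]
    [AddCommGroup N] [Module ℂ N] (φ : M →ₗ[ℂ] N) (A : Matrix ι κ ℝ) (F : κ → M) (i : ι) :
    φ (matAct A F i) = matAct A (fun j => φ (F j)) i := by
  simp only [matAct, map_sum, map_smul]

/-! ### The braided right multiplication by the coordinates -/

/-- The operator `f ↦ ∑ e, twist f a e * x^e`, moving the coordinate `x^a` through `f`. -/
def push (hq : 0 < q) (f : Poly q m) (a : Fin m) : Poly q m :=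
  ∑ e, twist q hq m f a e * coord q m e

theorem push_one (hq : 0 < q) (a : Fin m) : push hq (1 : Poly q m) a = coord q m a := by
  simp [push, Matrix.one_apply]

theorem push_coord_mul (hq : 0 < q) (b : Fin m) (f : Poly q m) (a : Fin m) :
    push hq (coord q m b * f) a =
      matAct (braidInv q m) (fun cd => coord q m cd.1 * push hq f cd.2) (a, b) := by
  have h : push hq (coord q m b * f) a =
      ∑ d, twist q hq m (coord q m b) a d * push hq f d := by
    simp only [push, map_mul, Matrix.mul_apply, Finset.sum_mul, Finset.mul_sum, mul_assoc]
    exact Finset.sum_comm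
  rw [h, matAct_prod, Finset.sum_comm]
  simp only [twist_coord, Finset.sum_mul, smul_mul_assoc]

theorem push_coord (hq : 0 < q) (b a : Fin m) :
    push hq (coord q m b) a = (q⁻¹ : ℂ) • quad q m (a, b) +
      (nu q / mu q m : ℂ) • (metric q m a b : ℂ) • normSq q m := by
  have h := push_coord_mul hq b 1 a
  rw [mul_one] at h
  rw [h, ← matAct_braidInv_quad hq]
  simp only [push_one]
  rfl

theorem push_normSq (hq : 0 < q) (a : Fin m) :
    push hq (normSq q m) a = normSq q m * coord q m a := by
  simp [push, twist_normSq, Matrix.diagonal_apply]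

theorem push_quad (hq : 0 < q) (b k a : Fin m) :
    push hq (coord q m b * coord q m k) a =
      (q⁻¹ : ℂ) • ((q⁻¹ : ℂ) • quad q m (a, b) +
        (nu q / mu q m : ℂ) • (metric q m a b : ℂ) • normSq q m) * coord q m k +
      (nu q / mu q m : ℂ) • matAct (braidInv q m)
        (fun cd => (metric q m cd.2 k : ℂ) • (coord q m cd.1 * normSq q m)) (a, b) := by
  rw [push_coord_mul, ← matAct_braidInv_quad hq]
  simp only [matAct_prod, push_coord, mul_add, smul_add, Finset.sum_add_distrib, quad,
    mul_smul_comm, Finset.smul_sum, Finset.sum_mul, smul_mul_assoc, mul_assoc]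
  congr 1
  · exact Finset.sum_congr rfl fun _ _ => Finset.sum_congr rfl fun _ _ => smul_comm _ _ _
  · exact Finset.sum_congr rfl fun _ _ => Finset.sum_congr rfl fun _ _ => smul_comm _ _ _

/-- Moving x^a through 𝐱² is computed twice: at once, the twist of 𝐱² being scalar, and factor by
factor with the quadratic relations. Comparison gives the commutator the coefficient qζ + q⁻², which
is not zero. -/
theorem normSq_mul_coord (hq : 0 < q) (a : Fin m) :
    normSq q m * coord q m a = coord q m a * normSq q m := by
  have h : push hq (normSq q m) a = (q⁻¹ : ℂ) • (q⁻¹ : ℂ) • (coord q m a * normSq q m) +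
      (q⁻¹ : ℂ) • (nu q / mu q m : ℂ) • (normSq q m * coord q m a) +
      (nu q / mu q m : ℂ) • (zeta q m : ℂ) • (coord q m a * normSq q m) := by
    have h0 : push hq (normSq q m) a =
        ∑ b, (met q m b : ℂ) • push hq (coord q m b * coord q m b.rev) a := by
      rw [normSq_eq_sum]
      simp only [push, map_sum, map_smul, Matrix.sum_apply, Matrix.smul_apply, Finset.sum_mul,
        smul_mul_assoc, Finset.smul_sum]
      exact Finset.sum_comm
    have e : ∀ b, (met q m b : ℂ) • push hq (coord q m b * coord q m b.rev) a =
        (q⁻¹ : ℂ) • (q⁻¹ : ℂ) • (coord q m a * (met q m b : ℂ) • (coord q m b * coord q m b.rev)) +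
        (q⁻¹ : ℂ) • (nu q / mu q m : ℂ) • ((met q m b : ℂ) • (metric q m a b : ℂ) •
          (normSq q m * coord q m b.rev)) +
        (nu q / mu q m : ℂ) • ((met q m b : ℂ) • matAct (braidInv q m)
          (fun cd => (metric q m cd.2 b.rev : ℂ) • (coord q m cd.1 * normSq q m)) (a, b)) := by
      intro b
      rw [push_quad]
      simp only [quad, smul_mul_assoc, add_mul, mul_smul_comm, mul_assoc]
      module
    rw [h0]
    simp only [e, Finset.sum_add_distrib, ← Finset.smul_sum, ← Finset.mul_sum]
    rw [sum_met_braidInv_metric_smul hq (fun c => coord q m c * normSq q m),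
      sum_met_metric_smul hq (fun b => normSq q m * coord q m b), ← normSq_eq_sum]
  rw [push_normSq] at h
  have hz := zeta_pos hq m
  have hmu := mu_pos (m := m) hq
  have hmu' : (mu q m : ℂ) ≠ 0 := by exact_mod_cast hmu.ne'
  have hq' : (q : ℂ) ≠ 0 := by exact_mod_cast hq.ne'
  have hmu1 : (mu q m : ℂ) = 1 + q * zeta q m := by exact_mod_cast mu_eq hq
  have hc : ((q * zeta q m + q⁻¹ * q⁻¹ : ℝ) : ℂ) ≠ 0 := by
    have : 0 < q * zeta q m + q⁻¹ * q⁻¹ := by positivity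
    exact_mod_cast this.ne'
  refine smul_right_injective _ hc ?_
  simp only
  linear_combination (norm := skip) (mu q m : ℂ) • h
  match_scalars
  · simp only [nu]; push_cast; field_simp; rw [hmu1]; ring
  · simp only [nu]; push_cast; field_simp; rw [hmu1]; ring

/-! ### The partial derivatives -/

/-- The matrix representing the left multiplication by `x^b` in `derivHom`. -/
def derivGen (q : ℝ) (hq : 0 < q) (m : ℕ) (b : Fin m) :
    Matrix (Option (Fin m)) (Option (Fin m)) (Poly q m)
  | some a, some d => (q : ℂ) • twist q hq m (coord q m b) a d
  | some a, none => (metric q m a b : ℂ) • 1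
  | none, some _ => 0
  | none, none => coord q m b

/-- The diagonal blocks repeat the relations of x and of twist(x). In the column, crossing turns the
twisted metric term into R̂ applied to the family G of the untwisted term, so the entry is a
multiple of P_A(1 + qR̂)G = 0. -/
theorem derivGen_rel (hq : 0 < q) (i j : Fin m) :
    ∑ k, ∑ l, (antisymmetrizer q m (i, j) (k, l) : ℂ) •
      (derivGen q hq m k * derivGen q hq m l) = 0 := by
  ext (_ | a) (_ | d)
  · simpa [Matrix.sum_apply, Matrix.mul_apply, Fintype.sum_option, derivGen] using
      antisymm_coord q m i j
  · simp [Matrix.sum_apply, Matrix.mul_apply, Fintype.sum_option, derivGen]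
  · set G : Fin m × Fin m → Poly q m := fun p => if p.1 = a.rev then coord q m p.2 else 0 with hG
    have h : matAct (antisymmetrizer q m) (G + (q : ℂ) • matAct (braid q m) G) = 0 := by
      rw [← matAct_smul, ← matAct_one G, ← matAct_mul, Matrix.mul_one, ← matAct_add, ← matAct_mul,
        antisymmetrizer_mul_one_add hq]
      ext
      simp [matAct]
    have e : ∀ k l, (derivGen q hq m k * derivGen q hq m l) (some a) none =
        (met q m a : ℂ) • (G + (q : ℂ) • matAct (braid q m) G) (k, l) := by
      intro k l
      have e1 : (metric q m a k : ℂ) • coord q m l = (met q m a : ℂ) • G (k, l) := by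
        rw [metric_apply, hG]
        by_cases h : k = a.rev <;> simp [h]
      have e2 : ∑ d, twist q hq m (coord q m k) a d * ((metric q m d l : ℂ) • 1) =
          (met q m a : ℂ) • matAct (braid q m) G (k, l) := by
        have h1 : matAct (braid q m) G (k, l) =
            ∑ c, (braid q m (k, l) (a.rev, c) : ℂ) • coord q m c := by
          rw [matAct_prod, Finset.sum_eq_single a.rev]
          · simp only [hG, if_true]
          · intro p _ hp
            simp [hG, hp]
          · simp
        rw [h1, Finset.sum_eq_single l.rev]
        · rw [twist_coord, metric_apply, Fin.rev_rev, if_pos rfl, mul_smul_comm, mul_one,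
            Finset.smul_sum, Finset.smul_sum]
          refine Finset.sum_congr rfl fun c _ => ?_
          rw [smul_smul, smul_smul]
          congr 1
          have h2 := braidInv_crossing hq a k c l.rev
          rw [Fin.rev_rev] at h2
          have h3 : met q m l.rev * braidInv q m (a, k) (c, l.rev) =
              met q m a * braid q m (k, l) (a.rev, c) := by
            linear_combination met q m l.rev * h2 +
              met q m a * braid q m (k, l) (a.rev, c) * met_rev_mul hq l
          exact_mod_cast h3
        · intro d _ hd
          rw [metric_apply, if_neg (fun h => hd (by rw [h, Fin.rev_rev]))]
          simp
        · simp
      rw [Matrix.mul_apply, Fintype.sum_option]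
      simp only [derivGen, smul_mul_assoc, one_mul, ← Finset.smul_sum, e1, e2, Pi.add_apply,
        Pi.smul_apply, smul_add]
      rw [smul_comm (q : ℂ)]
    simp only [Matrix.sum_apply, Matrix.smul_apply, e, smul_comm _ (met q m a : ℂ),
      ← Finset.smul_sum]
    have h' := congrFun h (i, j)
    rw [matAct_prod, Pi.zero_apply] at h'
    rw [h', smul_zero, Matrix.zero_apply]
  · have h := congrArg (fun f => twist q hq m f a d) (antisymm_coord q m i j)
    simp only [map_sum, map_smul, map_mul, map_zero, Matrix.sum_apply, Matrix.smul_apply,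
      Matrix.mul_apply, Matrix.zero_apply] at h
    simp only [Matrix.sum_apply, Matrix.smul_apply, Matrix.mul_apply, Fintype.sum_option,
      derivGen, mul_zero, zero_add, smul_mul_smul_comm, ← Finset.smul_sum, Matrix.zero_apply]
    simp only [smul_comm _ ((q : ℂ) * q), ← Finset.smul_sum, h, smul_zero]

/-- The algebra morphism whose entry `(some a, none)` is the partial derivative `∂^a`. -/
def derivHom (q : ℝ) (hq : 0 < q) (m : ℕ) :
    Poly q m →ₐ[ℂ] Matrix (Option (Fin m)) (Option (Fin m)) (Poly q m) :=
  RingQuot.liftAlgHom ℂ ⟨FreeAlgebra.lift ℂ (derivGen q hq m), by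
    rintro _ _ ⟨i, j⟩
    simp only [map_sum, map_smul, map_mul, map_zero, FreeAlgebra.lift_ι_apply]
    exact derivGen_rel hq i j⟩

theorem derivHom_coord (hq : 0 < q) (b : Fin m) :
    derivHom q hq m (coord q m b) = derivGen q hq m b := by
  rw [derivHom, coord, RingQuot.liftAlgHom_mkAlgHom_apply, FreeAlgebra.lift_ι_apply]

/-- The partial derivatives `∂^i`. -/
def partialD (q : ℝ) (hq : 0 < q) (m : ℕ) (i : Fin m) : Module.End ℂ (Poly q m) where
  toFun f := derivHom q hq m f (some i) none
  map_add' f g := by simp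
  map_smul' c f := by simp

theorem derivHom_none_none (hq : 0 < q) (f : Poly q m) : derivHom q hq m f none none = f := by
  have key := poly_mem (S := LinearMap.eqLocus
    ((Matrix.entryLinearMap ℂ (Poly q m) none none).comp (derivHom q hq m).toLinearMap)
    LinearMap.id) ?_ ?_ f
  · exact key
  · change derivHom q hq m 1 none none = 1
    simp
  · intro j f hf
    change derivHom q hq m f none none = f at hf
    change derivHom q hq m (coord q m j * f) none none = coord q m j * f
    rw [map_mul, Matrix.mul_apply, Fintype.sum_option, hf, derivHom_coord]
    simp [derivGen]

/-- This is the product of block triangular matrices, whose corner entry for g is g itself. -/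
theorem partialD_mul (hq : 0 < q) (f g : Poly q m) (i : Fin m) :
    partialD q hq m i (f * g) = partialD q hq m i f * g +
      ∑ l, derivHom q hq m f (some i) (some l) * partialD q hq m l g := by
  change derivHom q hq m (f * g) (some i) none = _
  rw [map_mul, Matrix.mul_apply, Fintype.sum_option, derivHom_none_none]
  rfl

theorem partialD_one (hq : 0 < q) (i : Fin m) : partialD q hq m i 1 = 0 := by
  change derivHom q hq m 1 (some i) none = _
  simp

theorem partialD_coord_mul (hq : 0 < q) (i j : Fin m) (f : Poly q m) :
    partialD q hq m i (coord q m j * f) = (metric q m i j : ℂ) • f +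
      (q : ℂ) • matAct (braidInv q m)
        (fun kl => coord q m kl.1 * partialD q hq m kl.2 f) (i, j) := by
  rw [partialD_mul]
  congr 1
  · change derivHom q hq m (coord q m j) (some i) none * f = _
    rw [derivHom_coord, derivGen, smul_mul_assoc, one_mul]
  · simp only [derivHom_coord, derivGen, matAct_prod, twist_coord, smul_mul_assoc, Finset.sum_mul,
      ← Finset.smul_sum]
    rw [Finset.sum_comm]

theorem isPartialDerivatives_partialD (hq : 0 < q) :
    IsPartialDerivatives q m (partialD q hq m) := by
  refine ⟨partialD_one hq, fun i j f => ?_⟩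
  rw [partialD_coord_mul, matAct_prod, inv_braid hq]

theorem IsPartialDerivatives.eq {D D' : Fin m → Module.End ℂ (Poly q m)}
    (h : IsPartialDerivatives q m D) (h' : IsPartialDerivatives q m D') : D = D' := by
  have key : ∀ f, ∀ i, D i f = D' i f := by
    intro f
    have hf : f ∈ ⨅ i, LinearMap.eqLocus (D i) (D' i) := by
      refine poly_mem ?_ (fun j f hf => ?_) f
      · rw [Submodule.mem_iInf]
        intro i
        rw [LinearMap.mem_eqLocus, h.1, h'.1]
      · rw [Submodule.mem_iInf] at hf ⊢
        intro i
        rw [LinearMap.mem_eqLocus, h.2, h'.2]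
        simp only [fun l => LinearMap.mem_eqLocus.mp (hf l)]
    rw [Submodule.mem_iInf] at hf
    exact hf
  ext i f
  exact key f i

theorem partialD_mem_homog (hq : 0 < q) (i : Fin m) {n : ℤ} {f : Poly q m}
    (hf : f ∈ homog q m n) : partialD q hq m i f ∈ homog q m (n - 1) := by
  have h := homog_le (S := fun n => homog q m n ⊓
    ⨅ i, (homog q m (n - 1)).comap (partialD q hq m i)) ?_ ?_ n hf
  · exact (Submodule.mem_iInf _).mp h.2 i
  · refine ⟨word_mem_homog [], (Submodule.mem_iInf _).mpr fun i => ?_⟩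
    rw [Submodule.mem_comap, partialD_one]
    exact Submodule.zero_mem _
  · rintro d j f ⟨h1, h2⟩
    refine ⟨coord_mul_mem_homog j h1, (Submodule.mem_iInf _).mpr fun i => ?_⟩
    rw [Submodule.mem_comap, partialD_coord_mul, add_sub_cancel_right]
    refine Submodule.add_mem _ (Submodule.smul_mem _ _ h1) (Submodule.smul_mem _ _ ?_)
    refine Submodule.sum_mem _ fun kl _ => Submodule.smul_mem _ _ ?_
    have := coord_mul_mem_homog kl.1 ((Submodule.mem_iInf _).mp h2 kl.2)
    rwa [sub_add_cancel] at this

section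

variable {ι κ M : Type*} [Fintype κ] [AddCommGroup M] [Module ℂ M]

theorem matAct_add_right (A : Matrix ι κ ℝ) (F G : κ → M) :
    matAct A (F + G) = matAct A F + matAct A G := by
  ext i
  simp only [matAct, Pi.add_apply, smul_add, Finset.sum_add_distrib]

theorem matAct_smul_right (A : Matrix ι κ ℝ) (c : ℂ) (F : κ → M) :
    matAct A (c • F) = c • matAct A F := by
  ext i
  simp only [matAct, Pi.smul_apply, Finset.smul_sum, smul_comm c]

theorem matAct_braid_metric (hq : 0 < q) (v : M) :
    matAct (braid q m) (fun kl => (metric q m kl.1 kl.2 : ℂ) • v) =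
      fun ij => (zeta q m : ℂ) • (metric q m ij.1 ij.2 : ℂ) • v := by
  ext ⟨i, j⟩
  rw [matAct_prod]
  simp only [smul_smul, ← Finset.sum_smul]
  have h := congrArg (fun x : ℝ => (x : ℂ)) (sum_braid_metric hq i j)
  push_cast at h
  rw [h]

theorem sum_met_matAct_braidInv (hq : 0 < q) (F : Fin m × Fin m → M) :
    ∑ i, (met q m i : ℂ) • matAct (braidInv q m) F (i, i.rev) =
      ((zeta q m)⁻¹ : ℂ) • ∑ i, (met q m i : ℂ) • F (i, i.rev) := by
  simp only [matAct_prod]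
  refine (sum_smul_sum_sum_smul _ _ fun k l => F (k, l)).trans ?_
  have h : ∀ k l, ∑ i, (met q m i : ℂ) * braidInv q m (i, i.rev) (k, l) =
      (zeta q m : ℂ)⁻¹ * metric q m k l := by
    intro k l
    have h := congrArg (fun x : ℝ => (x : ℂ)) (sum_metric_braidInv hq k l)
    push_cast at h
    exact h
  simp only [h, mul_smul, ← Finset.smul_sum]
  rw [sum_metric_smul]

/-- Crossing under a contraction: R̂⁻¹ becomes R̂ acting on another pair of indices, where it can
meet the R̂⁻¹ of a second Leibniz rule or the quadratic relations. -/
theorem sum_met_matAct_crossing (hq : 0 < q) (F : Fin m → Fin m → Fin m → M) (j : Fin m) :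
    ∑ i, (met q m i : ℂ) • matAct (braidInv q m) (fun kl => F i kl.1 kl.2) (i.rev, j) =
      ∑ l, (met q m l.rev : ℂ) •
        matAct (braid q m) (fun ik => F ik.1 ik.2 l) (j, l.rev) := by
  simp only [matAct_prod, Finset.smul_sum, smul_smul]
  have e : ∀ i k l, (met q m i : ℂ) * braidInv q m (i.rev, j) (k, l) =
      met q m l.rev * braid q m (j, l.rev) (i, k) := by
    intro i k l
    have h := braidInv_crossing hq i.rev j k l
    rw [Fin.rev_rev] at h
    have h2 : met q m i * braidInv q m (i.rev, j) (k, l) =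
        met q m l.rev * braid q m (j, l.rev) (i, k) := by
      linear_combination met q m i * h + met q m l.rev * braid q m (j, l.rev) (i, k) *
        met_mul_rev hq i
    exact_mod_cast h2
  simp only [e]
  calc _ = ∑ i, ∑ l, ∑ k, ((met q m l.rev : ℂ) * braid q m (j, l.rev) (i, k)) • F i k l :=
        Finset.sum_congr rfl fun i _ => Finset.sum_comm
    _ = _ := Finset.sum_comm

end

theorem laplacian_apply (D : Fin m → Module.End ℂ (Poly q m)) (f : Poly q m) :
    laplacian q m D f = ∑ i, (met q m i : ℂ) • D i (D i.rev f) := by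
  rw [laplacian, sum_metric_smul q fun i j => D i * D j]
  simp only [LinearMap.sum_apply, LinearMap.smul_apply, Module.End.mul_apply]

theorem laplacian_apply_rev (D : Fin m → Module.End ℂ (Poly q m)) (f : Poly q m) :
    ∑ l, (met q m l.rev : ℂ) • D l.rev (D l f) = laplacian q m D f := by
  rw [laplacian_apply, ← sum_rev]
  simp only [Fin.rev_rev]

/-- The Laplace operator of the partial derivatives `partialD`. -/
abbrev laplace (q : ℝ) (hq : 0 < q) (m : ℕ) : Module.End ℂ (Poly q m) :=
  laplacian q m (partialD q hq m)

/-- R̂ cancels the R̂⁻¹ of the Leibniz rule and acts on the metric term by ζ. -/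
theorem matAct_braid_partialD (hq : 0 < q) (g : Poly q m) (i j : Fin m) :
    matAct (braid q m) (fun ak => partialD q hq m ak.1 (coord q m ak.2 * g)) (i, j) =
      (zeta q m : ℂ) • (metric q m i j : ℂ) • g +
        (q : ℂ) • (coord q m i * partialD q hq m j g) := by
  have h : (fun ak : Fin m × Fin m => partialD q hq m ak.1 (coord q m ak.2 * g)) =
      (fun ak => (metric q m ak.1 ak.2 : ℂ) • g) + (q : ℂ) • matAct (braidInv q m)
        (fun kl => coord q m kl.1 * partialD q hq m kl.2 g) := by
    ext ⟨a, k⟩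
    exact partialD_coord_mul hq a k g
  rw [h, matAct_add_right, matAct_smul_right, ← matAct_mul, braid_mul_braidInv hq, matAct_one,
    matAct_braid_metric hq]
  rfl

/-- The inner Leibniz rule leaves an R̂⁻¹, which crossing turns into R̂; this cancels the R̂⁻¹ of
the outer Leibniz rule. The two metric terms contribute 1 and qζ, with sum μ. -/
theorem laplace_coord_mul (hq : 0 < q) (j : Fin m) (f : Poly q m) :
    laplace q hq m (coord q m j * f) = (mu q m : ℂ) • partialD q hq m j f +
      (q ^ 2 : ℂ) • (coord q m j * laplace q hq m f) := by
  have h1 : laplace q hq m (coord q m j * f) =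
      ∑ i, (met q m i : ℂ) • (metric q m i.rev j : ℂ) • partialD q hq m i f +
      (q : ℂ) • ∑ i, (met q m i : ℂ) • matAct (braidInv q m)
        (fun kl => partialD q hq m i (coord q m kl.1 * partialD q hq m kl.2 f)) (i.rev, j) := by
    rw [laplacian_apply, Finset.smul_sum, ← Finset.sum_add_distrib]
    refine Finset.sum_congr rfl fun i _ => ?_
    rw [partialD_coord_mul, map_add, map_smul, map_smul, matAct_linear, smul_add,
      smul_comm (q : ℂ)]
  have h2 : ∑ i, (met q m i : ℂ) • (metric q m i.rev j : ℂ) • partialD q hq m i f =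
      partialD q hq m j f := by
    rw [Finset.sum_eq_single j]
    · rw [metric_apply, Fin.rev_rev, if_pos rfl, smul_smul, met_mul_rev_cast hq, one_smul]
    · intro i _ hi
      rw [metric_apply, Fin.rev_rev, if_neg (Ne.symm hi)]
      simp
    · simp
  have h3 : ∑ l, (met q m l.rev : ℂ) • (metric q m j l.rev : ℂ) • partialD q hq m l f =
      partialD q hq m j f := by
    rw [Finset.sum_eq_single j]
    · rw [metric_apply, if_pos rfl, smul_smul, met_rev_mul_cast hq, one_smul]
    · intro i _ hi
      rw [metric_apply, if_neg (fun h => hi (Fin.rev_injective h))]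
      simp
    · simp
  rw [h1, h2, sum_met_matAct_crossing hq
    (fun i k l => partialD q hq m i (coord q m k * partialD q hq m l f))]
  simp only [matAct_braid_partialD, smul_add, Finset.sum_add_distrib]
  have h4 : ∑ l, (met q m l.rev : ℂ) • (zeta q m : ℂ) • (metric q m j l.rev : ℂ) •
      partialD q hq m l f = (zeta q m : ℂ) • partialD q hq m j f := by
    rw [← h3, Finset.smul_sum]
    exact Finset.sum_congr rfl fun l _ => smul_comm _ _ _
  have h5 : ∑ l, (met q m l.rev : ℂ) • (q : ℂ) • (coord q m j * partialD q hq m l.rev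
      (partialD q hq m l f)) = (q : ℂ) • (coord q m j * laplace q hq m f) := by
    rw [← laplacian_apply_rev, Finset.mul_sum, Finset.smul_sum]
    refine Finset.sum_congr rfl fun l _ => ?_
    rw [mul_smul_comm, smul_comm]
  have hmu : (mu q m : ℂ) = 1 + q * zeta q m := by exact_mod_cast mu_eq hq
  rw [h4, h5, hmu]
  module

theorem derivHom_some_some_normSq (hq : 0 < q) (a d : Fin m) :
    derivHom q hq m (normSq q m) (some a) (some d) =
      if a = d then (q ^ 2 : ℂ) • normSq q m else 0 := by
  have h : derivHom q hq m (normSq q m) (some a) (some d) =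
      (q ^ 2 : ℂ) • twist q hq m (normSq q m) a d := by
    rw [normSq_eq_sum]
    simp only [map_sum, map_smul, map_mul, Matrix.sum_apply, Matrix.smul_apply, Matrix.mul_apply,
      Fintype.sum_option, derivHom_coord, derivGen, mul_zero, zero_add, smul_mul_smul_comm,
      Finset.smul_sum]
    exact Finset.sum_congr rfl fun _ _ => Finset.sum_congr rfl fun _ _ => by
      rw [smul_comm, pow_two]
  rw [h, twist_normSq, Matrix.scalar_apply, Matrix.diagonal_apply, smul_ite, smul_zero]

theorem partialD_normSq (hq : 0 < q) (i : Fin m) :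
    partialD q hq m i (normSq q m) = (mu q m : ℂ) • coord q m i := by
  have h : partialD q hq m i (normSq q m) =
      ∑ j, (met q m j : ℂ) • (metric q m i j : ℂ) • coord q m j.rev +
      (q : ℂ) • ∑ j, (met q m j : ℂ) • matAct (braidInv q m)
        (fun kl => (metric q m kl.2 j.rev : ℂ) • coord q m kl.1) (i, j) := by
    rw [normSq_eq_sum, map_sum, Finset.smul_sum, ← Finset.sum_add_distrib]
    refine Finset.sum_congr rfl fun j _ => ?_
    have e : ∀ k l, partialD q hq m k (coord q m l) = (metric q m k l : ℂ) • 1 := by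
      intro k l
      have := partialD_coord_mul hq k l 1
      rw [mul_one] at this
      rw [this]
      simp [partialD_one, matAct]
    rw [map_smul, partialD_coord_mul, smul_add, smul_comm (q : ℂ)]
    simp only [e, mul_smul_comm, mul_one]
  have hmu : (mu q m : ℂ) = 1 + q * zeta q m := by exact_mod_cast mu_eq hq
  rw [h, sum_met_metric_smul hq (coord q m), sum_met_braidInv_metric_smul hq (coord q m), hmu]
  module

theorem partialD_normSq_mul (hq : 0 < q) (i : Fin m) (f : Poly q m) :
    partialD q hq m i (normSq q m * f) = (mu q m : ℂ) • (coord q m i * f) +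
      (q ^ 2 : ℂ) • (normSq q m * partialD q hq m i f) := by
  rw [partialD_mul, partialD_normSq, smul_mul_assoc]
  simp only [derivHom_some_some_normSq, ite_mul, zero_mul, Finset.sum_ite_eq, Finset.mem_univ,
    if_true, smul_mul_assoc]

/-- The Euler operator `x^i C_{ij} ∂^j`. -/
def euler (q : ℝ) (hq : 0 < q) (m : ℕ) : Module.End ℂ (Poly q m) :=
  ∑ i, (met q m i : ℂ) • (LinearMap.mulLeft ℂ (coord q m i) * partialD q hq m i.rev)

theorem euler_apply (hq : 0 < q) (f : Poly q m) :
    euler q hq m f = ∑ i, (met q m i : ℂ) • (coord q m i * partialD q hq m i.rev f) := by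
  simp only [euler, LinearMap.sum_apply, LinearMap.smul_apply, Module.End.mul_apply,
    LinearMap.mulLeft_apply]

/-- The same crossing as for Δ, but now R̂ meets a product of two coordinates, and
`matAct_braid_quad` adds the term with 𝐱². -/
theorem euler_coord_mul (hq : 0 < q) (j : Fin m) (f : Poly q m) :
    euler q hq m (coord q m j * f) = coord q m j * f +
      (q ^ 2 : ℂ) • (coord q m j * euler q hq m f) -
      (q * (nu q * q * zeta q m / mu q m) : ℂ) • (normSq q m * partialD q hq m j f) := by
  have h1 : euler q hq m (coord q m j * f) =
      ∑ i, (met q m i : ℂ) • (metric q m i.rev j : ℂ) • (coord q m i * f) +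
      (q : ℂ) • ∑ i, (met q m i : ℂ) • matAct (braidInv q m)
        (fun kl => quad q m (i, kl.1) * partialD q hq m kl.2 f) (i.rev, j) := by
    rw [euler_apply, Finset.smul_sum, ← Finset.sum_add_distrib]
    refine Finset.sum_congr rfl fun i _ => ?_
    have := matAct_linear (LinearMap.mulLeft ℂ (coord q m i)) (braidInv q m)
      (fun kl => coord q m kl.1 * partialD q hq m kl.2 f) (i.rev, j)
    simp only [LinearMap.mulLeft_apply] at this
    rw [partialD_coord_mul, mul_add, mul_smul_comm, mul_smul_comm, this, smul_add,
      smul_comm (q : ℂ)]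
    simp only [quad, mul_assoc]
  have h2 : ∑ i, (met q m i : ℂ) • (metric q m i.rev j : ℂ) • (coord q m i * f) =
      coord q m j * f := by
    rw [Finset.sum_eq_single j]
    · rw [metric_apply, Fin.rev_rev, if_pos rfl, smul_smul, met_mul_rev_cast hq, one_smul]
    · intro i _ hi
      rw [metric_apply, Fin.rev_rev, if_neg (Ne.symm hi)]
      simp
    · simp
  have h3 : ∑ l, (met q m l.rev : ℂ) • (metric q m j l.rev : ℂ) •
      (normSq q m * partialD q hq m l f) = normSq q m * partialD q hq m j f := by
    rw [Finset.sum_eq_single j]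
    · rw [metric_apply, if_pos rfl, smul_smul, met_rev_mul_cast hq, one_smul]
    · intro i _ hi
      rw [metric_apply, if_neg (fun h => hi (Fin.rev_injective h))]
      simp
    · simp
  rw [h1, h2, sum_met_matAct_crossing hq (fun i k l => quad q m (i, k) * partialD q hq m l f)]
  have e : ∀ l, (met q m l.rev : ℂ) • matAct (braid q m)
      (fun ik => quad q m (ik.1, ik.2) * partialD q hq m l f) (j, l.rev) =
      (q : ℂ) • (coord q m j * (met q m l.rev : ℂ) •
        (coord q m l.rev * partialD q hq m l.rev.rev f)) -
      (nu q * q * zeta q m / mu q m : ℂ) • ((met q m l.rev : ℂ) • (metric q m j l.rev : ℂ) •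
        (normSq q m * partialD q hq m l f)) := by
    intro l
    have := matAct_linear (LinearMap.mulRight ℂ (partialD q hq m l f)) (braid q m)
      (quad q m) (j, l.rev)
    simp only [LinearMap.mulRight_apply] at this
    rw [← this, matAct_braid_quad hq, Fin.rev_rev]
    simp only [quad, sub_mul, smul_mul_assoc, mul_smul_comm, mul_assoc]
    push_cast
    module
  simp only [e, Finset.sum_sub_distrib, ← Finset.smul_sum, ← Finset.mul_sum, h3]
  rw [sum_rev fun l => (met q m l : ℂ) • (coord q m l * partialD q hq m l.rev f), ← euler_apply]
  module

/-- Induction on the degree: by `laplace_coord_mul` the new 𝐱²∂^j term of `euler_coord_mul` is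
absorbed into a multiple of 𝐱²Δ, as 𝐱² commutes with x^j. The scalar is [n]_{q²}. -/
theorem euler_of_mem_homog (hq : 0 < q) (hq1 : q < 1) {n : ℤ} {f : Poly q m}
    (hf : f ∈ homog q m n) :
    euler q hq m f = (((q ^ (2 * n) - 1) / (q ^ 2 - 1) : ℝ) : ℂ) • f -
      (q * (nu q * q * zeta q m / mu q m) / mu q m : ℂ) • (normSq q m * laplace q hq m f) := by
  have hmu' : (mu q m : ℂ) ≠ 0 := by exact_mod_cast (mu_pos (m := m) hq).ne'
  have hq' : (q : ℂ) ≠ 0 := by exact_mod_cast hq.ne'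
  have hq2 : (q ^ 2 - 1 : ℂ) ≠ 0 := by
    have : q ^ 2 - 1 ≠ 0 := by nlinarith
    exact_mod_cast this
  refine homog_le (S := fun n => LinearMap.eqLocus (euler q hq m)
    ((((q ^ (2 * n) - 1) / (q ^ 2 - 1) : ℝ) : ℂ) • LinearMap.id -
      (q * (nu q * q * zeta q m / mu q m) / mu q m : ℂ) •
        (LinearMap.mulLeft ℂ (normSq q m) * laplace q hq m))) ?_ ?_ n hf
  · simp [euler_apply, laplacian_apply, partialD_one, LinearMap.mem_eqLocus]
  · intro d j f hf
    simp only [LinearMap.mem_eqLocus, LinearMap.sub_apply, LinearMap.smul_apply,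
      LinearMap.id_apply, Module.End.mul_apply, LinearMap.mulLeft_apply] at hf ⊢
    have hp : q ^ (2 * (d + 1)) = q ^ 2 * q ^ (2 * d) := by
      rw [mul_add, zpow_add₀ hq.ne', mul_comm]
      rfl
    have hc : normSq q m * (coord q m j * laplace q hq m f) =
        coord q m j * (normSq q m * laplace q hq m f) := by
      rw [← mul_assoc, ← mul_assoc, normSq_mul_coord hq]
    rw [euler_coord_mul, hf, laplace_coord_mul, hp]
    simp only [mul_add, mul_sub, mul_smul_comm, hc]
    match_scalars
    · field_simp
      ring
    · field_simp
    · field_simp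

theorem sum_met_partialD_coord_mul (hq : 0 < q) (f : Poly q m) :
    ∑ i, (met q m i : ℂ) • partialD q hq m i (coord q m i.rev * f) =
      ((∑ i, met q m i ^ 2 : ℝ) : ℂ) • f + (q * (zeta q m)⁻¹ : ℂ) • euler q hq m f := by
  have e : ∀ i, (met q m i : ℂ) • partialD q hq m i (coord q m i.rev * f) =
      ((met q m i ^ 2 : ℝ) : ℂ) • f + (q : ℂ) • ((met q m i : ℂ) • matAct (braidInv q m)
        (fun kl => coord q m kl.1 * partialD q hq m kl.2 f) (i, i.rev)) := by
    intro i
    rw [partialD_coord_mul, metric_apply, if_pos rfl]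
    push_cast
    module
  simp only [e, Finset.sum_add_distrib, ← Finset.smul_sum, ← Finset.sum_smul]
  rw [sum_met_matAct_braidInv hq, euler_apply]
  push_cast
  module

/-- Multiplying the quadratic relation for R̂ by K, with R̂K = ζK and K² = (∑ met²) K, leaves a
scalar equation. An index must exist to provide a non-zero entry of K. -/
theorem nu_mul_sum_metSq (hq : 0 < q) (hm : 1 ≤ m) :
    nu q * ∑ i, met q m i ^ 2 = mu q m * ((zeta q m)⁻¹ - q⁻¹) := by
  have hK : capCup q m * capCup q m = (∑ i, met q m i ^ 2) • capCup q m := by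
    ext ⟨i, j⟩ ⟨k, l⟩
    rw [Matrix.mul_apply, Fintype.sum_prod_type, Matrix.smul_apply, smul_eq_mul, Finset.sum_mul]
    refine Finset.sum_congr rfl fun a _ => ?_
    simp only [capCup]
    rw [Finset.sum_eq_single a.rev]
    · rw [metric_apply q m a, if_pos rfl]
      ring
    · intro b _ hb
      rw [metric_apply q m a, if_neg hb]
      ring
    · simp
  have h := congrArg (fun A => A * capCup q m) (braid_mul_self hq m)
  simp only [Matrix.mul_assoc, add_mul, sub_mul, Matrix.smul_mul, Matrix.one_mul, hK,
    braid_mul_capCup hq, Matrix.mul_smul] at h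
  set o : Fin m := ⟨0, hm⟩
  have h2 := congrFun (congrFun h (o, o.rev)) (o, o.rev)
  have hz := zeta_pos hq m
  have ho : 0 < capCup q m (o, o.rev) (o, o.rev) := by
    simp only [capCup, metric_apply, if_true]
    exact mul_pos (met_pos hq m _) (met_pos hq m _)
  simp only [Matrix.add_apply, Matrix.sub_apply, Matrix.smul_apply, smul_eq_mul] at h2
  have h3 : zeta q m * zeta q m = nu q * zeta q m + 1 -
      nu q * zeta q m * ∑ i, met q m i ^ 2 := by
    refine mul_right_cancel₀ ho.ne' ?_
    linear_combination h2
  refine mul_left_cancel₀ hz.ne' ?_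
  rw [mu_eq hq]
  have e : zeta q m * ((1 + q * zeta q m) * ((zeta q m)⁻¹ - q⁻¹)) =
      (1 + q * zeta q m) * (1 - q⁻¹ * zeta q m) := by
    field_simp
  rw [e]
  have e2 : q * q⁻¹ = 1 := mul_inv_cancel₀ hq.ne'
  have hn : nu q = q - q⁻¹ := rfl
  linear_combination h3 + zeta q m * hn + zeta q m ^ 2 * e2

/-- Two Leibniz steps leave multiples of f, of its Euler derivative and of 𝐱²Δf, and
`euler_of_mem_homog` eliminates the Euler operator. `h1` collects the scalar, `h2` lowers the
coefficient q⁴ of 𝐱²Δf to q². -/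
theorem laplace_normSq_mul (hq : 0 < q) (hq1 : q < 1) (hm : 1 ≤ m) {n : ℤ} {f : Poly q m}
    (hf : f ∈ homog q m n) :
    laplace q hq m (normSq q m * f) = (q ^ 2 : ℂ) • (normSq q m * laplace q hq m f) +
      ((mu q m ^ 2 * ((q ^ (2 * n + m) - 1) / (q ^ 2 - 1)) : ℝ) : ℂ) • f := by
  have e : ∀ i, (met q m i : ℂ) • partialD q hq m i (partialD q hq m i.rev (normSq q m * f)) =
      (mu q m : ℂ) • ((met q m i : ℂ) • partialD q hq m i (coord q m i.rev * f)) +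
      (q ^ 2 * mu q m : ℂ) • ((met q m i : ℂ) • (coord q m i * partialD q hq m i.rev f)) +
      (q ^ 2 * q ^ 2 : ℂ) • (normSq q m *
        ((met q m i : ℂ) • partialD q hq m i (partialD q hq m i.rev f))) := by
    intro i
    rw [partialD_normSq_mul, map_add, map_smul, map_smul, partialD_normSq_mul, mul_smul_comm]
    module
  rw [laplacian_apply]
  simp only [e, Finset.sum_add_distrib, ← Finset.smul_sum, ← Finset.mul_sum]
  rw [sum_met_partialD_coord_mul, ← euler_apply, ← laplacian_apply,
    euler_of_mem_homog hq hq1 hf]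
  have hz := zeta_pos hq m
  have hmu := mu_pos (m := m) hq
  have hnu := nu_neg hq hq1
  have hmu' : (mu q m : ℂ) ≠ 0 := by exact_mod_cast hmu.ne'
  have hz' : (zeta q m : ℂ) ≠ 0 := by exact_mod_cast hz.ne'
  have hq' : (q : ℂ) ≠ 0 := by exact_mod_cast hq.ne'
  have hq2 : q ^ 2 - 1 ≠ 0 := by nlinarith
  have hQ : ∑ i, met q m i ^ 2 = mu q m * ((zeta q m)⁻¹ - q⁻¹) / nu q := by
    rw [eq_div_iff hnu.ne, mul_comm, nu_mul_sum_metSq hq hm]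
  have hp : q ^ (2 * n + m) = q ^ (2 * n) * (q * (zeta q m)⁻¹) := by
    rw [zpow_add₀ hq.ne', zeta, ← zpow_neg, ← zpow_one_add₀ hq.ne']
    congr 2
    ring
  have h1 : mu q m * (mu q m * ((zeta q m)⁻¹ - q⁻¹) / nu q) +
      (mu q m * (q * (zeta q m)⁻¹) + q ^ 2 * mu q m) * ((q ^ (2 * n) - 1) / (q ^ 2 - 1)) =
      mu q m ^ 2 * ((q ^ (2 * n) * (q * (zeta q m)⁻¹) - 1) / (q ^ 2 - 1)) := by
    have hn : nu q = (q ^ 2 - 1) / q := by rw [nu]; field_simp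
    rw [hn, mu_eq hq]
    field_simp
    ring
  have h2 : (mu q m * (q * (zeta q m)⁻¹) + q ^ 2 * mu q m) *
      (q * (nu q * q * zeta q m / mu q m) / mu q m) = q ^ 2 * q ^ 2 - q ^ 2 := by
    have hn : nu q = (q ^ 2 - 1) / q := by rw [nu]; field_simp
    have hmu0 := mu_eq (m := m) hq
    rw [hn]
    field_simp
    rw [hmu0]
  have h2' := congrArg (fun x : ℝ => (x : ℂ)) h2
  push_cast at h2'
  rw [hQ, hp, ← h1]
  match_scalars
  · ring
  · linear_combination -h2'

/-! ### The partial derivatives and the coaction -/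

theorem lTensor_tmul_one_mul (φ : Module.End ℂ (Poly q m)) (t : OrthGroup q m)
    (τ : OrthGroup q m ⊗[ℂ] Poly q m) :
    LinearMap.lTensor _ φ ((t ⊗ₜ 1) * τ) = (t ⊗ₜ 1) * LinearMap.lTensor _ φ τ := by
  induction τ using TensorProduct.induction_on with
  | zero => simp
  | tmul s f => simp
  | add x y hx hy => simp only [mul_add, map_add, hx, hy]

theorem lTensor_one_tmul_mul (φ : Module.End ℂ (Poly q m)) (f : Poly q m)
    (τ : OrthGroup q m ⊗[ℂ] Poly q m) :
    LinearMap.lTensor _ φ ((1 ⊗ₜ f) * τ) =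
      LinearMap.lTensor _ (φ * LinearMap.mulLeft ℂ f) τ := by
  induction τ using TensorProduct.induction_on with
  | zero => simp
  | tmul s f => simp
  | add x y hx hy => simp only [mul_add, map_add, hx, hy]

theorem lTensor_mulLeft (f : Poly q m) (τ : OrthGroup q m ⊗[ℂ] Poly q m) :
    LinearMap.lTensor _ (LinearMap.mulLeft ℂ f) τ = (1 ⊗ₜ f) * τ := by
  have := lTensor_one_tmul_mul LinearMap.id f τ
  rw [LinearMap.lTensor_id] at this
  exact this.symm

theorem lTensor_partialD_mul (hq : 0 < q) (k a : Fin m) (τ : OrthGroup q m ⊗[ℂ] Poly q m) :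
    LinearMap.lTensor _ (partialD q hq m k) ((1 ⊗ₜ coord q m a) * τ) =
      (metric q m k a : ℂ) • τ + (q : ℂ) • matAct (braidInv q m) (fun lb =>
        (1 ⊗ₜ coord q m lb.1) * LinearMap.lTensor _ (partialD q hq m lb.2) τ) (k, a) := by
  have h : partialD q hq m k * LinearMap.mulLeft ℂ (coord q m a) =
      (metric q m k a : ℂ) • LinearMap.id + (q : ℂ) • ∑ lb : Fin m × Fin m,
        (braidInv q m (k, a) lb : ℂ) •
          (LinearMap.mulLeft ℂ (coord q m lb.1) * partialD q hq m lb.2) := by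
    ext f
    simp only [Module.End.mul_apply, LinearMap.mulLeft_apply, partialD_coord_mul, matAct,
      LinearMap.add_apply, LinearMap.smul_apply, LinearMap.sum_apply, LinearMap.id_apply]
  rw [lTensor_one_tmul_mul, h, LinearMap.lTensor_add, LinearMap.lTensor_smul,
    LinearMap.lTensor_smul, LinearMap.lTensor_id, matAct]
  simp only [LinearMap.add_apply, LinearMap.smul_apply, LinearMap.id_apply]
  congr 2
  rw [← LinearMap.coe_lTensorHom, map_sum, LinearMap.sum_apply]
  refine Finset.sum_congr rfl fun lb _ => ?_
  rw [map_smul, LinearMap.smul_apply, LinearMap.coe_lTensorHom, LinearMap.lTensor_mul,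
    Module.End.mul_apply, lTensor_mulLeft]

theorem braidInv_genTensor (hq : 0 < q) (s r : Fin m × Fin m) :
    ∑ p, (braidInv q m s p : ℂ) • genTensor q m p r =
      ∑ p, (braidInv q m p r : ℂ) • genTensor q m s p := by
  have h : scalarMatrix q m (braidInv q m) * genTensor q m =
      genTensor q m * scalarMatrix q m (braidInv q m) := by
    have h1 : scalarMatrix q m (braid q m) * scalarMatrix q m (braidInv q m) = 1 := by
      rw [← map_mul, braid_mul_braidInv hq, map_one]
    have h2 : scalarMatrix q m (braidInv q m) * scalarMatrix q m (braid q m) = 1 := by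
      rw [← map_mul, braidInv_mul_braid hq, map_one]
    calc _ = scalarMatrix q m (braidInv q m) * (genTensor q m * scalarMatrix q m (braid q m)) *
          scalarMatrix q m (braidInv q m) := by
          rw [mul_assoc, mul_assoc, h1, mul_one]
      _ = _ := by rw [← (commute_braid q m).eq, ← mul_assoc, h2, one_mul]
  have h' := congrFun (congrFun h s) r
  simpa [Matrix.mul_apply, scalarMatrix, Algebra.smul_def, ← Algebra.commutes] using h'

theorem sum_metric_genTensor_upper (i j : Fin m) :
    ∑ p : Fin m × Fin m, (metric q m p.1 p.2 : ℂ) • genTensor q m (i, j) p =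
      (metric q m i j : ℂ) • 1 := by
  have h := RingQuot.mkAlgHom_rel ℂ (OrthRel.metric_upper (q := q) i j)
  simp only [map_sum, map_smul, map_mul, AlgHom.commutes] at h
  rw [Fintype.sum_prod_type, ← Algebra.algebraMap_eq_smul_one]
  exact h

theorem sum_metric_genTensor_lower (i j : Fin m) :
    ∑ p : Fin m × Fin m, (metric q m p.1 p.2 : ℂ) • genTensor q m p (i, j) =
      (metric q m i j : ℂ) • 1 := by
  have h := RingQuot.mkAlgHom_rel ℂ (OrthRel.metric_lower (q := q) i j)
  simp only [map_sum, map_smul, map_mul, AlgHom.commutes] at h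
  rw [Fintype.sum_prod_type, ← Algebra.algebraMap_eq_smul_one]
  exact h

theorem coaction_coord' (i : Fin m) :
    coaction q m (coord q m i) =
      ∑ j, (gen q m i j ⊗ₜ[ℂ] 1) * ((1 : OrthGroup q m) ⊗ₜ[ℂ] coord q m j) := by
  simp only [coaction_coord, Algebra.TensorProduct.tmul_mul_tmul, mul_one, one_mul]

theorem gen_tmul_mul_comm (k l a b : Fin m) (x : Poly q m) (τ : OrthGroup q m ⊗[ℂ] Poly q m) :
    (gen q m k a ⊗ₜ[ℂ] 1) * (1 ⊗ₜ x) * ((gen q m l b ⊗ₜ 1) * τ) =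
      (genTensor q m (k, l) (a, b) ⊗ₜ 1) * ((1 ⊗ₜ x) * τ) := by
  simp only [← mul_assoc, Algebra.TensorProduct.tmul_mul_tmul, mul_one, one_mul, genTensor]

/-- Induction along left multiplication by coordinates: t ⊗ t preserves the metric term of the
Leibniz rule and commutes with R̂⁻¹ in the braided term. -/
theorem coaction_partialD (hq : 0 < q) (f : Poly q m) (i : Fin m) :
    coaction q m (partialD q hq m i f) =
      ∑ k, (gen q m i k ⊗ₜ 1) * LinearMap.lTensor _ (partialD q hq m k) (coaction q m f) := by
  have key := poly_mem (S := ⨅ i, LinearMap.eqLocus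
    ((coaction q m).toLinearMap.comp (partialD q hq m i))
    (∑ k, (LinearMap.mulLeft ℂ (gen q m i k ⊗ₜ 1)).comp
      ((LinearMap.lTensor _ (partialD q hq m k)).comp (coaction q m).toLinearMap))) ?_ ?_ f
  · have := (Submodule.mem_iInf _).mp key i
    simpa [LinearMap.mem_eqLocus, LinearMap.sum_apply] using this
  · simp [Submodule.mem_iInf, LinearMap.mem_eqLocus, LinearMap.sum_apply, partialD_one,
      Algebra.TensorProduct.one_def]
  · intro j f hf
    simp only [Submodule.mem_iInf, LinearMap.mem_eqLocus, LinearMap.sum_apply,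
      LinearMap.comp_apply, LinearMap.mulLeft_apply, AlgHom.toLinearMap_apply] at hf ⊢
    intro i
    set τ := coaction q m f
    set X : Fin m × Fin m → OrthGroup q m ⊗[ℂ] Poly q m := fun p =>
      (1 ⊗ₜ coord q m p.1) * LinearMap.lTensor _ (partialD q hq m p.2) τ with hX
    have h1 : coaction q m (partialD q hq m i (coord q m j * f)) = (metric q m i j : ℂ) • τ +
        (q : ℂ) • ∑ p, (braidInv q m (i, j) p : ℂ) • ∑ r, (genTensor q m p r ⊗ₜ 1) * X r := by
      rw [partialD_coord_mul, matAct]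
      simp only [map_add, map_smul, map_sum, map_mul, hf, coaction_coord', Finset.sum_mul_sum,
        gen_tmul_mul_comm, Fintype.sum_prod_type]
      rfl
    have h2 : ∑ k, (gen q m i k ⊗ₜ 1) * LinearMap.lTensor _ (partialD q hq m k)
        (coaction q m (coord q m j * f)) =
        (∑ p : Fin m × Fin m, (metric q m p.1 p.2 : ℂ) • genTensor q m (i, j) p) ⊗ₜ 1 * τ +
        (q : ℂ) • ∑ p, (genTensor q m (i, j) p ⊗ₜ 1) * ∑ r, (braidInv q m p r : ℂ) • X r := by
      have e : ∀ k a : Fin m, gen q m i k ⊗ₜ[ℂ] (1 : Poly q m) * (gen q m j a ⊗ₜ 1 *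
          ((metric q m k a : ℂ) • τ + (q : ℂ) • matAct (braidInv q m) X (k, a))) =
          (metric q m k a : ℂ) • (genTensor q m (i, j) (k, a) ⊗ₜ 1 * τ) + (q : ℂ) •
            (genTensor q m (i, j) (k, a) ⊗ₜ 1 * matAct (braidInv q m) X (k, a)) := by
        intro k a
        rw [← mul_assoc, Algebra.TensorProduct.tmul_mul_tmul, mul_one, mul_add, mul_smul_comm,
          mul_smul_comm, genTensor]
      simp only [map_mul, coaction_coord', Finset.sum_mul, map_sum, mul_assoc,
        lTensor_tmul_one_mul, lTensor_partialD_mul, Finset.mul_sum]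
      rw [TensorProduct.sum_tmul, Finset.sum_mul, Fintype.sum_prod_type, Fintype.sum_prod_type,
        Finset.smul_sum, ← Finset.sum_add_distrib]
      refine Finset.sum_congr rfl fun k _ => ?_
      rw [Finset.smul_sum, ← Finset.sum_add_distrib]
      refine Finset.sum_congr rfl fun a _ => ?_
      rw [← TensorProduct.smul_tmul', smul_mul_assoc]
      exact (e k a).trans (by rw [matAct, Finset.mul_sum])
    rw [h1, h2, sum_metric_genTensor_upper, ← TensorProduct.smul_tmul', smul_mul_assoc,
      ← Algebra.TensorProduct.one_def, one_mul]
    congr 2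
    have h3 : ∀ r, (∑ p, (braidInv q m (i, j) p : ℂ) • genTensor q m p r) ⊗ₜ 1 * X r =
        (∑ p, (braidInv q m p r : ℂ) • genTensor q m (i, j) p) ⊗ₜ 1 * X r := fun r => by
      rw [braidInv_genTensor hq]
    simp only [TensorProduct.sum_tmul, Finset.sum_mul, ← TensorProduct.smul_tmul',
      smul_mul_assoc] at h3
    simp only [Finset.mul_sum, Finset.smul_sum, mul_smul_comm]
    rw [Finset.sum_comm]
    simp only [h3]
    exact Finset.sum_comm

/-- The two derivatives bring out t ⊗ t, which the lower metric relation contracts away. -/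
theorem coaction_laplace (hq : 0 < q) (f : Poly q m) :
    coaction q m (laplace q hq m f) = LinearMap.lTensor _ (laplace q hq m) (coaction q m f) := by
  set τ := coaction q m f with hτ
  set Y : Fin m × Fin m → OrthGroup q m ⊗[ℂ] Poly q m := fun r =>
    LinearMap.lTensor _ (partialD q hq m r.1 * partialD q hq m r.2) τ with hY
  have h1 : ∀ i j, coaction q m (partialD q hq m i (partialD q hq m j f)) =
      ∑ r, (genTensor q m (i, j) r ⊗ₜ 1) * Y r := by
    intro i j
    rw [coaction_partialD, coaction_partialD, ← hτ, Fintype.sum_prod_type]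
    simp only [map_sum, lTensor_tmul_one_mul, Finset.mul_sum, ← mul_assoc,
      Algebra.TensorProduct.tmul_mul_tmul, mul_one, hY, LinearMap.lTensor_mul,
      Module.End.mul_apply, genTensor]
  have h2 : ∀ r, ∑ p : Fin m × Fin m, (metric q m p.1 p.2 : ℂ) • (genTensor q m p r ⊗ₜ 1 * Y r) =
      (metric q m r.1 r.2 : ℂ) • Y r := by
    rintro ⟨k, l⟩
    simp only [← smul_mul_assoc, TensorProduct.smul_tmul', ← Finset.sum_mul,
      ← TensorProduct.sum_tmul, sum_metric_genTensor_lower]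
    rw [← TensorProduct.smul_tmul', ← Algebra.TensorProduct.one_def, smul_mul_assoc, one_mul]
  have h3 : LinearMap.lTensor (OrthGroup q m) (laplace q hq m) τ =
      ∑ r : Fin m × Fin m, (metric q m r.1 r.2 : ℂ) • Y r := by
    rw [laplace, laplacian, ← LinearMap.coe_lTensorHom, Fintype.sum_prod_type]
    simp only [map_sum, map_smul, LinearMap.sum_apply, LinearMap.smul_apply]
    rfl
  have h4 : coaction q m (laplace q hq m f) = ∑ p : Fin m × Fin m,
      (metric q m p.1 p.2 : ℂ) • ∑ r, (genTensor q m p r ⊗ₜ 1) * Y r := by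
    rw [laplace, laplacian, Fintype.sum_prod_type]
    simp only [LinearMap.sum_apply, LinearMap.smul_apply, map_sum, map_smul, Module.End.mul_apply,
      h1]
  rw [h3, h4]
  simp only [← h2, Finset.smul_sum]
  exact Finset.sum_comm

theorem isCoinvariant_evalZero : IsCoinvariant q m (evalZero q m).toLinearMap := by
  intro f
  have h := poly_mem (S := LinearMap.eqLocus
    ((TensorProduct.rid ℂ (OrthGroup q m)).toLinearMap ∘ₗ
      LinearMap.lTensor (OrthGroup q m) (evalZero q m).toLinearMap ∘ₗ (coaction q m).toLinearMap)
    ((Algebra.linearMap ℂ (OrthGroup q m)) ∘ₗ (evalZero q m).toLinearMap)) ?_ ?_ f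
  · rw [Algebra.smul_def, mul_one]
    exact h
  · simp [LinearMap.mem_eqLocus, Algebra.TensorProduct.one_def]
  · intro j f _
    have e : ∀ (a : Fin m) (τ : OrthGroup q m ⊗[ℂ] Poly q m), LinearMap.lTensor (OrthGroup q m)
        (evalZero q m).toLinearMap (gen q m j a ⊗ₜ coord q m a * τ) = 0 := by
      intro a τ
      induction τ using TensorProduct.induction_on with
      | zero => simp
      | tmul t f => simp [evalZero_coord]
      | add x y hx hy => rw [mul_add, map_add, hx, hy, add_zero]
    simp [LinearMap.mem_eqLocus, coaction_coord, Finset.sum_mul, e, evalZero_coord]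

theorem isCoinvariant_evalZero_laplace_pow (hq : 0 < q) (k : ℕ) :
    IsCoinvariant q m ((evalZero q m).toLinearMap ∘ₗ laplace q hq m ^ k) := by
  intro f
  have h : LinearMap.lTensor (OrthGroup q m) (laplace q hq m ^ k) (coaction q m f) =
      coaction q m ((laplace q hq m ^ k) f) := by
    induction k with
    | zero => simp [Module.End.one_eq_id]
    | succ k ih =>
      rw [pow_succ', LinearMap.lTensor_mul, Module.End.mul_apply, ih, Module.End.mul_apply,
        coaction_laplace]
  rw [LinearMap.lTensor_comp, LinearMap.comp_apply, h]
  exact isCoinvariant_evalZero _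

/-! ### Consequences of coinvariance -/

/-- The action of the diagonal torus on the polynomials. -/
def torusRep (q : ℝ) (m : ℕ) (χ : Fin m → ℝ) (hχ : ∀ i, χ i * χ i.rev = 1) :
    OrthGroup q m ⊗[ℂ] Poly q m →ₐ[ℂ] Poly q m :=
  Algebra.TensorProduct.lift ((Algebra.ofId ℂ (Poly q m)).comp (torusChar q m χ hχ))
    (AlgHom.id ℂ _) fun a f => by
      change Commute (algebraMap ℂ (Poly q m) (torusChar q m χ hχ a)) f
      exact Algebra.commutes (torusChar q m χ hχ a) f

theorem torusRep_tmul {χ : Fin m → ℝ} (hχ : ∀ i, χ i * χ i.rev = 1) (t : OrthGroup q m)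
    (f : Poly q m) : torusRep q m χ hχ (t ⊗ₜ f) = torusChar q m χ hχ t • f := by
  rw [torusRep, Algebra.TensorProduct.lift_tmul, Algebra.smul_def]
  rfl

theorem torusRep_coaction_word {χ : Fin m → ℝ} (hχ : ∀ i, χ i * χ i.rev = 1) (w : List (Fin m)) :
    torusRep q m χ hχ (coaction q m (word q m w)) = ((w.map χ).prod : ℂ) • word q m w := by
  induction w with
  | nil => simp
  | cons j w ih =>
    rw [word_cons, map_mul, map_mul, ih, coaction_coord, map_sum]
    simp only [torusRep_tmul, torusChar_gen, ite_smul, zero_smul, Finset.sum_ite_eq,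
      Finset.mem_univ, if_true, List.map_cons, List.prod_cons, smul_mul_smul_comm]
    push_cast
    rfl

/-- The coinvariance equation is evaluated at the character diag χ, for which every word is an
eigenvector. -/
theorem IsCoinvariant.torus {J : Poly q m →ₗ[ℂ] ℂ} (hJ : IsCoinvariant q m J) {χ : Fin m → ℝ}
    (hχ : ∀ i, χ i * χ i.rev = 1) (w : List (Fin m)) :
    ((w.map χ).prod : ℂ) * J (word q m w) = J (word q m w) := by
  have h : ∀ τ : OrthGroup q m ⊗[ℂ] Poly q m, J (torusRep q m χ hχ τ) =
      torusChar q m χ hχ (TensorProduct.rid ℂ _ (LinearMap.lTensor _ J τ)) := by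
    intro τ
    induction τ using TensorProduct.induction_on with
    | zero => simp
    | tmul t f =>
      rw [torusRep_tmul, LinearMap.lTensor_tmul, TensorProduct.rid_tmul, map_smul, map_smul,
        smul_eq_mul, smul_eq_mul, mul_comm]
    | add x y hx hy => simp only [map_add, hx, hy]
  have h2 := h (coaction q m (word q m w))
  rw [torusRep_coaction_word, hJ, map_smul, map_smul, map_one, smul_eq_mul, smul_eq_mul,
    mul_one] at h2
  exact h2

/-- The linear map `f ↦ push f a`. -/
def pushHom (hq : 0 < q) (a : Fin m) : Module.End ℂ (Poly q m) :=
  ∑ e, LinearMap.mulRight ℂ (coord q m e) ∘ₗ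
    Matrix.entryLinearMap ℂ (Poly q m) a e ∘ₗ (twist q hq m).toLinearMap

theorem pushHom_apply (hq : 0 < q) (a : Fin m) (f : Poly q m) :
    pushHom hq a f = push hq f a := by
  simp only [pushHom, LinearMap.sum_apply, LinearMap.comp_apply, LinearMap.mulRight_apply]
  rfl

/-- The recursions of `push` and of ∂ contain the same R̂⁻¹. By induction `push` is x^a f up to
scale and a multiple of 𝐱²∂^a f, the metric term of R̂⁻¹(x ⊗ x) matching that of the Leibniz rule.
-/
theorem push_of_mem_homog (hq : 0 < q) {n : ℤ} {f : Poly q m} (hf : f ∈ homog q m n)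
    (a : Fin m) :
    push hq f a = ((q ^ (-n) : ℝ) : ℂ) • (coord q m a * f) +
      ((q ^ (1 - n) * (nu q / mu q m) : ℝ) : ℂ) • (normSq q m * partialD q hq m a f) := by
  have h := homog_le (S := fun n => ⨅ a, LinearMap.eqLocus (pushHom hq a)
    (((q ^ (-n) : ℝ) : ℂ) • LinearMap.mulLeft ℂ (coord q m a) +
      ((q ^ (1 - n) * (nu q / mu q m) : ℝ) : ℂ) •
        (LinearMap.mulLeft ℂ (normSq q m) * partialD q hq m a))) ?_ ?_ n hf
  · have := (Submodule.mem_iInf _).mp h a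
    simpa only [LinearMap.mem_eqLocus, pushHom_apply, LinearMap.add_apply, LinearMap.smul_apply,
      Module.End.mul_apply, LinearMap.mulLeft_apply] using this
  · simp [Submodule.mem_iInf, LinearMap.mem_eqLocus, pushHom_apply, push_one, partialD_one]
  · intro d b f hf
    simp only [Submodule.mem_iInf, LinearMap.mem_eqLocus, pushHom_apply, LinearMap.add_apply,
      LinearMap.smul_apply, Module.End.mul_apply, LinearMap.mulLeft_apply] at hf ⊢
    intro a
    have e1 : matAct (braidInv q m) (fun cd => coord q m cd.1 * push hq f cd.2) (a, b) =
        ((q ^ (-d) : ℝ) : ℂ) • (matAct (braidInv q m) (quad q m) (a, b) * f) +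
        ((q ^ (1 - d) * (nu q / mu q m) : ℝ) : ℂ) • (normSq q m * matAct (braidInv q m)
          (fun kl => coord q m kl.1 * partialD q hq m kl.2 f) (a, b)) := by
      have l1 := matAct_linear (LinearMap.mulRight ℂ f) (braidInv q m) (quad q m) (a, b)
      have l2 := matAct_linear (LinearMap.mulLeft ℂ (normSq q m)) (braidInv q m)
        (fun kl => coord q m kl.1 * partialD q hq m kl.2 f) (a, b)
      simp only [LinearMap.mulRight_apply, LinearMap.mulLeft_apply] at l1 l2
      rw [l1, l2, ← Pi.smul_apply, ← matAct_smul_right, ← Pi.smul_apply (i := (a, b)),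
        ← matAct_smul_right, ← Pi.add_apply, ← matAct_add_right]
      congr 1
      ext ⟨c, e⟩
      simp only [hf, Pi.add_apply, Pi.smul_apply, mul_add, mul_smul_comm, quad, mul_assoc]
      rw [← mul_assoc (coord q m c) (normSq q m), ← normSq_mul_coord hq, mul_assoc]
    rw [push_coord_mul, e1, matAct_braidInv_quad hq, partialD_coord_mul]
    set Z := matAct (braidInv q m) (fun kl => coord q m kl.1 * partialD q hq m kl.2 f) (a, b)
    have hq' : (q : ℂ) ≠ 0 := by exact_mod_cast hq.ne'
    have p1 : q ^ (-(d + 1)) = q ^ (-d) * q⁻¹ := by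
      rw [neg_add, zpow_add₀ hq.ne', zpow_neg_one]
    have p2 : q ^ (1 - (d + 1)) = q ^ (-d) := by congr 1; ring
    have p3 : q ^ (1 - d) = q ^ (-d) * q := by
      rw [sub_eq_neg_add, zpow_add₀ hq.ne', zpow_one]
    rw [p1, p2, p3]
    simp only [quad, add_mul, smul_mul_assoc, mul_add, mul_smul_comm, mul_assoc]
    push_cast
    module

/-- Coinvariance is applied to f x^b. By crossing it says that R̂ maps the family H of numbers
J(twist(f) x) to the family Y of numbers J(f x^b). Inverting R̂ and contracting with the metric,
where R̂⁻¹ acts by ζ⁻¹, isolates J(push f a). -/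
theorem IsCoinvariant.push {J : Poly q m →ₗ[ℂ] ℂ} (hJ : IsCoinvariant q m J) (hq : 0 < q)
    (f : Poly q m) (a : Fin m) :
    J (QuantumEuclidean.push hq f a) =
      ((zeta q m)⁻¹ * met q m a ^ 2 : ℂ) * J (f * coord q m a) := by
  set G : Fin m → Fin m → ℂ := fun e k => J (QuantumEuclidean.twist q hq m f a e * coord q m k)
    with hG
  set H : Fin m × Fin m → ℂ := fun uk => (met q m uk.1.rev : ℂ) • G uk.1.rev uk.2 with hH
  set Y : Fin m × Fin m → ℂ := fun bs =>
    (met q m bs.2.rev : ℂ) * (if a = bs.2.rev then J (f * coord q m bs.1) else 0) with hY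
  have h1 : matAct (braid q m) H = Y := by
    ext ⟨b, s⟩
    have h := hJ.twist hq (f * coord q m b) a s.rev
    rw [map_mul, Matrix.mul_apply] at h
    simp only [twist_coord, Finset.mul_sum, mul_smul_comm, map_sum, map_smul] at h
    rw [hY]
    simp only [← h, matAct_prod, hH, Finset.mul_sum]
    rw [← sum_rev]
    refine Finset.sum_congr rfl fun e _ => Finset.sum_congr rfl fun k _ => ?_
    have hc := braidInv_crossing hq e b k s.rev
    rw [Fin.rev_rev] at hc
    have hc2 : (braid q m (b, s) (e.rev, k) : ℂ) * met q m e =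
        met q m s.rev * braidInv q m (e, b) (k, s.rev) := by
      have : braid q m (b, s) (e.rev, k) * met q m e =
          met q m s.rev * braidInv q m (e, b) (k, s.rev) := by
        linear_combination -met q m s.rev * hc -
          met q m e * braid q m (b, s) (e.rev, k) * met_mul_rev hq s
      exact_mod_cast this
    simp only [smul_eq_mul, Fin.rev_rev]
    linear_combination G e k * hc2
  have h2 : H = matAct (braidInv q m) Y := by
    rw [← h1, ← matAct_mul, braidInv_mul_braid hq, matAct_one]
  have h3 := sum_met_matAct_braidInv hq Y
  rw [← h2] at h3
  have h4 : ∑ i, (met q m i : ℂ) • H (i, i.rev) = J (QuantumEuclidean.push hq f a) := by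
    rw [QuantumEuclidean.push, map_sum, ← sum_rev fun e => J (_ * coord q m e)]
    refine Finset.sum_congr rfl fun i _ => ?_
    simp only [hH]
    rw [smul_smul, met_mul_rev_cast hq, one_smul]
  have h5 : ∑ i, (met q m i : ℂ) • Y (i, i.rev) =
      (met q m a : ℂ) ^ 2 * J (f * coord q m a) := by
    rw [Finset.sum_eq_single a]
    · simp only [hY, Fin.rev_rev, if_true, smul_eq_mul]
      ring
    · intro b _ hb
      simp [hY, Ne.symm hb]
    · simp
  rw [← h4, h3, h5, smul_eq_mul, mul_assoc, Complex.ofReal_inv]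

/-! ### The `q`-Gamma function -/

theorem summable_mul_pow {p : ℝ} (hp : 0 < p) (hp1 : p < 1) (u : ℝ) :
    Summable fun k : ℕ => -(u * p ^ k) :=
  ((summable_geometric_of_lt_one hp.le hp1).mul_left u).neg

theorem qPochhammerInf_eq_mul {p : ℝ} (hp : 0 < p) (hp1 : p < 1) (u : ℝ) :
    qPochhammerInf u p = (1 - u) * qPochhammerInf (u * p) p := by
  have e : (fun k : ℕ => 1 - u * p ^ (k + 1)) = fun k => 1 - u * p * p ^ k := by
    ext k
    ring
  have h : Multipliable fun k : ℕ => 1 - u * p ^ (k + 1) := by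
    rw [e]
    simpa only [sub_eq_add_neg] using
      Real.multipliable_one_add_of_summable (summable_mul_pow hp hp1 (u * p))
  unfold qPochhammerInf
  rw [← e, tprod_eq_zero_mul' (f := fun k : ℕ => 1 - u * p ^ k) h, pow_zero, mul_one]

theorem qPochhammerInf_ne_zero {p : ℝ} (hp : 0 < p) (hp1 : p < 1) {u : ℝ} (hu : 0 < u)
    (hu1 : u < 1) : qPochhammerInf u p ≠ 0 := by
  have h := tprod_one_add_ne_zero_of_summable (f := fun k : ℕ => -(u * p ^ k)) (fun k => ?_)
    (summable_mul_pow hp hp1 u).norm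
  · simpa [qPochhammerInf, sub_eq_add_neg] using h
  · have h1 : p ^ k ≤ 1 := pow_le_one₀ hp.le hp1.le
    have h2 : u * p ^ k ≤ u * 1 := mul_le_mul_of_nonneg_left h1 hu.le
    have : 0 < 1 + -(u * p ^ k) := by linarith
    exact this.ne'

theorem qGamma_ne_zero {p : ℝ} (hp : 0 < p) (hp1 : p < 1) {t : ℝ} (ht : 0 < t) :
    qGamma p t ≠ 0 := by
  have h1 := qPochhammerInf_ne_zero hp hp1 hp hp1
  have h2 := qPochhammerInf_ne_zero hp hp1 (Real.rpow_pos_of_pos hp t)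
    (Real.rpow_lt_one hp.le hp1 ht)
  have h3 := (Real.rpow_pos_of_pos (sub_pos.mpr hp1) (1 - t)).ne'
  exact mul_ne_zero (div_ne_zero h1 h2) h3

/-- The infinite product at p^t is its first factor 1 - p^t times the product at p^(t+1). -/
theorem qGamma_add_one {p : ℝ} (hp : 0 < p) (hp1 : p < 1) {t : ℝ} (ht : 0 < t) :
    qGamma p (t + 1) = (1 - p ^ t) / (1 - p) * qGamma p t := by
  have h2 := Real.rpow_lt_one hp.le hp1 ht
  have h3 := qPochhammerInf_ne_zero hp hp1 (Real.rpow_pos_of_pos hp (t + 1))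
    (Real.rpow_lt_one hp.le hp1 (by linarith))
  have h4 : 0 < 1 - p := sub_pos.mpr hp1
  have h5 : 1 - p ^ t ≠ 0 := by linarith
  have e : (1 - p) ^ (1 - t) = (1 - p) ^ (1 - (t + 1)) * (1 - p) := by
    rw [← Real.rpow_add_one h4.ne']
    congr 1
    ring
  rw [qGamma, qGamma, qPochhammerInf_eq_mul hp hp1 (p ^ t), ← Real.rpow_add_one hp.ne', e]
  field_simp

theorem qNumber_succ_pos {p : ℝ} (hp : 0 < p) (hp1 : p < 1) (k : ℕ) : 0 < qNumber p (k + 1) := by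
  have h := pow_lt_one₀ hp.le hp1 (Nat.succ_ne_zero k)
  rw [Nat.succ_eq_add_one] at h
  exact div_pos_of_neg_of_neg (by linarith) (by linarith)

theorem qFactorial_pos {p : ℝ} (hp : 0 < p) (hp1 : p < 1) (k : ℕ) : 0 < qFactorial p k :=
  Finset.prod_pos fun j _ => qNumber_succ_pos hp hp1 j

/-! ### The Laplace operator on multiples of the norm squared -/

/-- The ratio of two consecutive coefficients of the Pizzetti formula. -/
def pizzettiRatio (q : ℝ) (m k : ℕ) : ℝ :=
  mu q m ^ 2 * (qNumber (q ^ 2) (k + 1) * ((q ^ (2 * k + m) - 1) / (q ^ 2 - 1)))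

theorem pizzettiCoeff_zero_ne_zero (hq : 0 < q) (hq1 : q < 1) (hm : 1 ≤ m) :
    pizzettiCoeff q m 0 ≠ 0 := by
  have hp : 0 < q ^ 2 := by positivity
  have hp1 : q ^ 2 < 1 := by nlinarith
  have hm' : (0 : ℝ) < m := by exact_mod_cast hm
  have h1 := qGamma_ne_zero hp hp1 (t := 1 / 2) (by norm_num)
  have h2 := qGamma_ne_zero hp hp1 (t := ((0 : ℕ) : ℝ) + (m : ℝ) / 2)
    (by push_cast; positivity)
  have h3 := (qFactorial_pos hp hp1 0).ne'
  rw [pizzettiCoeff]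
  exact div_ne_zero (mul_ne_zero two_ne_zero (pow_ne_zero _ h1))
    (mul_ne_zero (mul_ne_zero (pow_ne_zero _ (mu_pos hq).ne') h3) h2)

/-- The functional equation of the q-Gamma function is used at t = k + m/2, where (q²)^t = q^(2k+m).
-/
theorem pizzettiCoeff_succ (hq : 0 < q) (hq1 : q < 1) (hm : 1 ≤ m) (k : ℕ) :
    pizzettiCoeff q m (k + 1) * pizzettiRatio q m k = pizzettiCoeff q m k := by
  have hp : 0 < q ^ 2 := by positivity
  have hp1 : q ^ 2 < 1 := by nlinarith
  have hm' : (0 : ℝ) < m := by exact_mod_cast hm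
  have ht : 0 < (k : ℝ) + (m : ℝ) / 2 := by positivity
  have h1 := qGamma_ne_zero hp hp1 ht
  have h2 := (qFactorial_pos hp hp1 k).ne'
  have h3 := (qNumber_succ_pos hp hp1 k).ne'
  have h4 := (mu_pos (m := m) hq).ne'
  have h5 : 1 - q ^ (2 * k + m) ≠ 0 := by
    have := pow_lt_one₀ hq.le hq1 (n := 2 * k + m) (by omega)
    linarith
  have h6 : 1 - q ^ 2 ≠ 0 := by linarith
  have h7 : q ^ 2 - 1 ≠ 0 := by linarith
  have e1 : (q ^ 2) ^ ((k : ℝ) + (m : ℝ) / 2) = q ^ (2 * k + m) := by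
    rw [← Real.rpow_natCast q 2, ← Real.rpow_mul hq.le, ← Real.rpow_natCast q (2 * k + m)]
    congr 1
    push_cast
    ring
  have e2 : qGamma (q ^ 2) (((k + 1 : ℕ) : ℝ) + (m : ℝ) / 2) =
      (1 - q ^ (2 * k + m)) / (1 - q ^ 2) * qGamma (q ^ 2) (k + (m : ℝ) / 2) := by
    rw [← e1, ← qGamma_add_one hp hp1 ht]
    congr 1
    push_cast
    ring
  have e3 : qFactorial (q ^ 2) (k + 1) = qFactorial (q ^ 2) k * qNumber (q ^ 2) (k + 1) :=
    Finset.prod_range_succ _ _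
  have e4 : (q ^ (2 * k + m) - 1) / (q ^ 2 - 1) = (1 - q ^ (2 * k + m)) / (1 - q ^ 2) := by
    rw [← neg_sub, ← neg_sub (1 : ℝ) (q ^ 2), neg_div_neg_eq]
  rw [pizzettiCoeff, pizzettiCoeff, pizzettiRatio, e2, e3, e4]
  have e5 : mu q m ^ (2 * (k + 1)) = mu q m ^ (2 * k) * mu q m ^ 2 := by ring
  rw [e5]
  field_simp

/-- The recursion that `laplace_normSq_mul` imposes in degree 2(k + 1). -/
theorem pizzettiRatio_succ (hq : 0 < q) (hq1 : q < 1) (k : ℕ) :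
    pizzettiRatio q m (k + 1) =
      mu q m ^ 2 * ((q ^ (2 * (2 * ((k + 1 : ℕ) : ℤ)) + m) - 1) / (q ^ 2 - 1)) +
        q ^ 2 * pizzettiRatio q m k := by
  have h7 : q ^ 2 - 1 ≠ 0 := by nlinarith
  have e : q ^ (2 * (2 * ((k + 1 : ℕ) : ℤ)) + m) = q ^ (2 * (2 * (k + 1)) + m) := by
    rw [← zpow_natCast q (2 * (2 * (k + 1)) + m)]
    push_cast
    rfl
  rw [pizzettiRatio, pizzettiRatio, qNumber, qNumber, e]
  field_simp
  ring

theorem laplace_pow_mem_homog (hq : 0 < q) (k : ℕ) {n : ℤ} {f : Poly q m}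
    (hf : f ∈ homog q m n) : (laplace q hq m ^ k) f ∈ homog q m (n - 2 * k) := by
  induction k with
  | zero => simpa using hf
  | succ k ih =>
    rw [pow_succ', Module.End.mul_apply, laplacian_apply]
    refine Submodule.sum_mem _ fun i _ => Submodule.smul_mem _ _ ?_
    have := partialD_mem_homog hq i (partialD_mem_homog hq i.rev ih)
    convert this using 2
    push_cast
    ring

theorem evalZero_laplace_pow_of_ne (hq : 0 < q) {k : ℕ} {n : ℤ} (hn : n ≠ 2 * k) {f : Poly q m}
    (hf : f ∈ homog q m n) : evalZero q m ((laplace q hq m ^ k) f) = 0 :=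
  evalZero_of_mem_homog (sub_ne_zero.mpr hn) (laplace_pow_mem_homog hq k hf)

theorem evalZero_normSq_mul (f : Poly q m) : evalZero q m (normSq q m * f) = 0 := by
  rw [map_mul, normSq_eq_sum]
  simp [evalZero_coord]

/-- Each Δ passing 𝐱² leaves a scalar term; the last remainder keeps the factor 𝐱² and vanishes at
the origin. -/
theorem evalZero_laplace_pow_normSq_mul (hq : 0 < q) (hq1 : q < 1) (hm : 1 ≤ m) (k : ℕ)
    {f : Poly q m} (hf : f ∈ homog q m (2 * k)) :
    evalZero q m ((laplace q hq m ^ (k + 1)) (normSq q m * f)) =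
      (pizzettiRatio q m k : ℂ) * evalZero q m ((laplace q hq m ^ k) f) := by
  induction k generalizing f with
  | zero =>
    rw [zero_add, pow_one, pow_zero, laplace_normSq_mul hq hq1 hm hf, map_add, map_smul, map_smul,
      evalZero_normSq_mul, smul_zero, zero_add, smul_eq_mul, Module.End.one_apply]
    congr 2
    have h7 : q ^ 2 - 1 ≠ 0 := by nlinarith
    simp [pizzettiRatio, qNumber, h7]
  | succ k ih =>
    have hd : laplace q hq m f ∈ homog q m (2 * k) := by
      have := laplace_pow_mem_homog hq 1 hf
      rw [pow_one] at this
      convert this using 2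
      push_cast
      ring
    rw [pow_succ, Module.End.mul_apply, laplace_normSq_mul hq hq1 hm hf, map_add, map_smul,
      map_smul, map_add, map_smul, map_smul, ih hd, pizzettiRatio_succ hq hq1, pow_succ _ k,
      Module.End.mul_apply]
    simp only [smul_eq_mul]
    push_cast
    ring

/-! ### The Pizzetti functional -/

theorem normSq_mul_mem_homog {n : ℤ} {f : Poly q m} (hf : f ∈ homog q m n) :
    normSq q m * f ∈ homog q m (n + 2) := by
  rw [normSq_eq_sum, Finset.sum_mul]
  refine Submodule.sum_mem _ fun i _ => ?_
  rw [smul_mul_assoc, mul_assoc]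
  refine Submodule.smul_mem _ _ ?_
  convert coord_mul_mem_homog i (coord_mul_mem_homog i.rev hf) using 2
  ring

/-- The functional `R ↦ (Δ^k R)(0)`. -/
def laplaceEval (q : ℝ) (hq : 0 < q) (m k : ℕ) : Poly q m →ₗ[ℂ] ℂ :=
  (evalZero q m).toLinearMap ∘ₗ laplace q hq m ^ k

theorem exists_laplaceEval_eq_zero (hq : 0 < q) (f : Poly q m) :
    ∃ N, ∀ k, N ≤ k → laplaceEval q hq m k f = 0 := by
  have h := poly_mem_of_word (q := q) (m := m) (S :=
    { carrier := {f | ∃ N, ∀ k, N ≤ k → laplaceEval q hq m k f = 0}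
      add_mem' := by
        rintro f g ⟨N, hN⟩ ⟨M, hM⟩
        refine ⟨max N M, fun k hk => ?_⟩
        rw [map_add, hN k (le_trans (le_max_left _ _) hk), hM k (le_trans (le_max_right _ _) hk),
          add_zero]
      zero_mem' := ⟨0, fun k _ => map_zero _⟩
      smul_mem' := by
        rintro c f ⟨N, hN⟩
        exact ⟨N, fun k hk => by rw [map_smul, hN k hk, smul_zero]⟩ })
    (fun w => ⟨w.length + 1, fun k hk =>
      evalZero_laplace_pow_of_ne hq (by omega) (word_mem_homog w)⟩) f
  exact h

theorem hasSum_pizzetti (hq : 0 < q) (f : Poly q m) {N : ℕ}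
    (hN : ∀ k, N ≤ k → laplaceEval q hq m k f = 0) :
    HasSum (fun k => (pizzettiCoeff q m k : ℂ) * laplaceEval q hq m k f)
      (∑ k ∈ Finset.range N, (pizzettiCoeff q m k : ℂ) * laplaceEval q hq m k f) :=
  hasSum_sum_of_ne_finset_zero fun k hk => by
    rw [hN k (by simpa using hk), mul_zero]

theorem summable_pizzetti (hq : 0 < q) (f : Poly q m) :
    Summable fun k => (pizzettiCoeff q m k : ℂ) * laplaceEval q hq m k f :=
  (exists_laplaceEval_eq_zero hq f).elim fun _ hN => (hasSum_pizzetti hq f hN).summable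

/-- The Pizzetti functional `R ↦ ∑ k, pizzettiCoeff k * (Δ^k R)(0)`. -/
def pizzetti (q : ℝ) (hq : 0 < q) (m : ℕ) : Poly q m →ₗ[ℂ] ℂ where
  toFun f := ∑' k, (pizzettiCoeff q m k : ℂ) * laplaceEval q hq m k f
  map_add' f g := by
    rw [← (summable_pizzetti hq f).tsum_add (summable_pizzetti hq g)]
    simp only [map_add, mul_add]
  map_smul' c f := by
    simp only [map_smul, smul_eq_mul, RingHom.id_apply, mul_left_comm _ c]
    exact tsum_mul_left

theorem pizzetti_apply (hq : 0 < q) (f : Poly q m) :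
    pizzetti q hq m f = ∑' k, (pizzettiCoeff q m k : ℂ) * laplaceEval q hq m k f := rfl

theorem pizzetti_of_mem_homog (hq : 0 < q) {k : ℕ} {f : Poly q m}
    (hf : f ∈ homog q m (2 * k)) :
    pizzetti q hq m f = (pizzettiCoeff q m k : ℂ) * laplaceEval q hq m k f := by
  rw [pizzetti_apply, tsum_eq_single k]
  intro l hl
  have : laplaceEval q hq m l f = 0 := evalZero_laplace_pow_of_ne hq (by omega) hf
  rw [this, mul_zero]

theorem pizzetti_of_mem_homog_odd (hq : 0 < q) {n : ℤ} (hn : Odd n) {f : Poly q m}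
    (hf : f ∈ homog q m n) : pizzetti q hq m f = 0 := by
  have : ∀ l, laplaceEval q hq m l f = 0 := fun l =>
    evalZero_laplace_pow_of_ne hq (by obtain ⟨r, hr⟩ := hn; omega) hf
  simp only [pizzetti_apply, this, mul_zero, tsum_zero]

theorem pizzetti_one (hq : 0 < q) : pizzetti q hq m 1 = pizzettiCoeff q m 0 := by
  have h : (1 : Poly q m) ∈ homog q m (2 * ((0 : ℕ) : ℤ)) := word_mem_homog []
  rw [pizzetti_of_mem_homog hq h, laplaceEval, pow_zero]
  simp

/-- On a word of even length one term of the series survives; 𝐱² shifts its index by one, and the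
two ratios cancel. Odd words give zero on both sides. -/
theorem pizzetti_normSq_mul (hq : 0 < q) (hq1 : q < 1) (hm : 1 ≤ m) (f : Poly q m) :
    pizzetti q hq m (normSq q m * f) = pizzetti q hq m f := by
  refine poly_mem_of_word (S := LinearMap.eqLocus
    (pizzetti q hq m ∘ₗ LinearMap.mulLeft ℂ (normSq q m)) (pizzetti q hq m)) (fun w => ?_) f
  change pizzetti q hq m (normSq q m * word q m w) = pizzetti q hq m (word q m w)
  have hw := word_mem_homog (q := q) w
  have hw2 := normSq_mul_mem_homog hw
  rcases Int.even_or_odd (w.length : ℤ) with h | h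
  · obtain ⟨k, hk⟩ : ∃ k : ℕ, (w.length : ℤ) = 2 * k :=
      ⟨w.length / 2, by obtain ⟨r, hr⟩ := h; omega⟩
    rw [hk] at hw hw2
    have hw3 : normSq q m * word q m w ∈ homog q m (2 * ((k + 1 : ℕ) : ℤ)) := by
      convert hw2 using 2
      push_cast
      ring
    rw [pizzetti_of_mem_homog hq hw, pizzetti_of_mem_homog hq hw3,
      ← pizzettiCoeff_succ hq hq1 hm k]
    have := evalZero_laplace_pow_normSq_mul hq hq1 hm k hw
    change laplaceEval q hq m (k + 1) _ = _ * laplaceEval q hq m k _ at this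
    rw [this, Complex.ofReal_mul, mul_assoc]
  · rw [pizzetti_of_mem_homog_odd hq h hw,
      pizzetti_of_mem_homog_odd hq (h.add_even even_two) hw2]

/-- The space of coinvariant functionals. -/
def coinvariants (q : ℝ) (m : ℕ) : Submodule ℂ (Poly q m →ₗ[ℂ] ℂ) where
  carrier := {J | IsCoinvariant q m J}
  add_mem' := by
    intro J K hJ hK f
    rw [LinearMap.lTensor_add, LinearMap.add_apply, map_add, hJ f, hK f, LinearMap.add_apply,
      add_smul]
  zero_mem' := by
    intro f
    simp
  smul_mem' := by
    intro c J hJ f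
    rw [LinearMap.lTensor_smul, LinearMap.smul_apply, map_smul, hJ f, LinearMap.smul_apply,
      smul_assoc]

/-- On a given polynomial, and on its coaction, a finite sum of pure tensors, the series agrees with
a common partial sum, which is coinvariant term by term. -/
theorem isCoinvariant_pizzetti (hq : 0 < q) : IsCoinvariant q m (pizzetti q hq m) := by
  set P : ℕ → Poly q m →ₗ[ℂ] ℂ := fun N =>
    ∑ k ∈ Finset.range N, (pizzettiCoeff q m k : ℂ) • laplaceEval q hq m k with hP
  have hP1 : ∀ N, IsCoinvariant q m (P N) := fun N =>
    Submodule.sum_mem (coinvariants q m) fun k _ =>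
      Submodule.smul_mem (coinvariants q m) _ (isCoinvariant_evalZero_laplace_pow hq k)
  have hP2 : ∀ f, ∃ M, ∀ N, M ≤ N → pizzetti q hq m f = P N f := by
    intro f
    obtain ⟨M, hM⟩ := exists_laplaceEval_eq_zero hq f
    refine ⟨M, fun N hN => ?_⟩
    rw [pizzetti_apply, (hasSum_pizzetti hq f fun k hk => hM k (hN.trans hk)).tsum_eq, hP]
    simp only [LinearMap.sum_apply, LinearMap.smul_apply, smul_eq_mul]
  have hP3 : ∀ τ : OrthGroup q m ⊗[ℂ] Poly q m, ∃ M, ∀ N, M ≤ N →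
      LinearMap.lTensor (OrthGroup q m) (pizzetti q hq m) τ =
        LinearMap.lTensor (OrthGroup q m) (P N) τ := by
    intro τ
    induction τ using TensorProduct.induction_on with
    | zero => exact ⟨0, fun N _ => by simp⟩
    | tmul t f =>
      obtain ⟨M, hM⟩ := hP2 f
      exact ⟨M, fun N hN => by rw [LinearMap.lTensor_tmul, LinearMap.lTensor_tmul, hM N hN]⟩
    | add x y hx hy =>
      obtain ⟨M, hM⟩ := hx
      obtain ⟨M', hM'⟩ := hy
      refine ⟨max M M', fun N hN => ?_⟩
      rw [map_add, map_add, hM N (le_trans (le_max_left _ _) hN),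
        hM' N (le_trans (le_max_right _ _) hN)]
  intro f
  obtain ⟨M, hM⟩ := hP2 f
  obtain ⟨M', hM'⟩ := hP3 (coaction q m f)
  rw [hM' _ (le_max_right M M'), hM _ (le_max_left M M')]
  exact hP1 _ f

/-! ### Uniqueness of the invariant functional -/

theorem apply_eq_zero_of_mem_homog {J : Poly q m →ₗ[ℂ] ℂ} {n : ℤ}
    (h : ∀ w : List (Fin m), (w.length : ℤ) = n → J (word q m w) = 0) {f : Poly q m}
    (hf : f ∈ homog q m n) : J f = 0 := by
  have : homog q m n ≤ LinearMap.ker J := by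
    refine Submodule.span_le.mpr ?_
    rintro _ ⟨w, hw, rfl⟩
    exact h w hw
  exact this hf

/-- The two expressions for J(push v a) are compared. The term with 𝐱²∂^a v drops out: J absorbs 𝐱²,
and ∂^a v has smaller degree than v. -/
theorem IsCoinvariant.word_cons_eq {J : Poly q m →ₗ[ℂ] ℂ} (hJ : IsCoinvariant q m J)
    (hJ2 : ∀ f, J (normSq q m * f) = J f) (hq : 0 < q) (a : Fin m) (v : List (Fin m))
    (h : ∀ w : List (Fin m), w.length < v.length → J (word q m w) = 0) :
    J (word q m (a :: v)) =
      ((q ^ v.length * (zeta q m)⁻¹ * met q m a ^ 2 : ℝ) : ℂ) * J (word q m (v ++ [a])) := by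
  have h1 := hJ.push hq (word q m v) a
  have hv := word_mem_homog (q := q) v
  have h2 : J (partialD q hq m a (word q m v)) = 0 :=
    apply_eq_zero_of_mem_homog (fun w hw => h w (by omega)) (partialD_mem_homog hq a hv)
  rw [push_of_mem_homog hq hv, map_add, map_smul, map_smul, hJ2, h2, smul_zero, add_zero,
    smul_eq_mul] at h1
  have hq' : (q : ℂ) ≠ 0 := by exact_mod_cast hq.ne'
  rw [word_cons, word_append, word_cons, word_nil, mul_one]
  have e : ((q ^ (-(v.length : ℤ)) : ℝ) : ℂ) = ((q : ℂ) ^ v.length)⁻¹ := by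
    rw [zpow_neg, zpow_natCast]
    push_cast
    rfl
  rw [e, inv_mul_eq_iff_eq_mul₀ (pow_ne_zero _ hq')] at h1
  rw [h1]
  push_cast
  ring

/-- The letters of u rotate one at a time; every intermediate word has length d + 1, so the factor
q^d ζ⁻¹ stays the same. -/
theorem IsCoinvariant.word_append_eq {J : Poly q m →ₗ[ℂ] ℂ} (hJ : IsCoinvariant q m J)
    (hJ2 : ∀ f, J (normSq q m * f) = J f) (hq : 0 < q) {d : ℕ}
    (h : ∀ w : List (Fin m), w.length < d → J (word q m w) = 0) (u v : List (Fin m))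
    (huv : u.length + v.length = d + 1) :
    J (word q m (u ++ v)) =
      (((u.map fun a => q ^ d * (zeta q m)⁻¹ * met q m a ^ 2).prod : ℝ) : ℂ) *
        J (word q m (v ++ u)) := by
  induction u generalizing v with
  | nil => simp
  | cons a u ih =>
    have hd : (u ++ v).length = d := by
      rw [List.length_cons] at huv
      rw [List.length_append]
      omega
    rw [List.cons_append, hJ.word_cons_eq hJ2 hq a (u ++ v) (by rwa [hd]), hd,
      List.append_assoc, ih (v ++ [a]) (by simp at huv ⊢; omega), List.map_cons, List.prod_cons,
      List.append_assoc, List.singleton_append]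
    simp only [Complex.ofReal_mul]
    ring

theorem IsCoinvariant.eq_zero {J : Poly q m →ₗ[ℂ] ℂ} (hJ : IsCoinvariant q m J)
    (hJ2 : ∀ f, J (normSq q m * f) = J f) (hq : 0 < q) (hq1 : q < 1) (hm : 1 ≤ m)
    (h1 : J 1 = 0) : J = 0 := by
  have key : ∀ n, ∀ w : List (Fin m), w.length = n → J (word q m w) = 0 := by
    intro n
    induction n using Nat.strong_induction_on with
    | _ n ih =>
      intro w hw
      rcases n with _ | d
      · rw [List.length_eq_zero_iff.mp hw, word_nil, h1]
      -- With an empty second word all letters rotate and the same word returns.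
      have hrot := hJ.word_append_eq hJ2 hq (d := d) (fun v hv => ih v.length (by omega) v rfl)
        w [] (by simpa using hw)
      rw [List.append_nil, List.nil_append] at hrot
      -- For `d = 0` and `m = 1` the rotation factor is 1, so words of length one are treated by the
      -- torus element -1.
      rcases Nat.eq_zero_or_pos d with rfl | hd
      · obtain ⟨a, rfl⟩ := List.length_eq_one_iff.mp hw
        have h := hJ.torus (χ := fun _ => -1) (fun _ => by norm_num) [a]
        simp only [List.map_cons, List.map_nil, List.prod_cons, List.prod_nil, mul_one] at h
        push_cast at h
        linear_combination (-1 / 2 : ℂ) * h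
      -- The metric coefficients form a torus element, so their product over `w` can be removed in
      -- front of `J(w)`.
      · have htor := hJ.torus (χ := met q m) (met_mul_rev hq) w
        set r : ℝ := q ^ d * (zeta q m)⁻¹ with hr
        -- The truncated difference is the true one because `1 ≤ m`.
        have hz : (zeta q m)⁻¹ = q ^ (m - 1) := by
          rw [zeta, ← zpow_neg, ← zpow_natCast]
          congr 1
          omega
        have hr1 : r ^ (d + 1) < 1 := by
          rw [hr, hz, ← pow_add, ← pow_mul]
          exact pow_lt_one₀ hq.le hq1 (Nat.mul_ne_zero (by omega) (by omega))
        have hprod : (w.map fun a => r * met q m a ^ 2).prod =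
            r ^ (d + 1) * ((w.map (met q m)).prod) ^ 2 := by
          rw [← hw]
          clear hrot htor hw
          induction w with
          | nil => simp
          | cons a w ih =>
            simp only [List.map_cons, List.prod_cons, ih, List.length_cons]
            ring
        rw [hprod] at hrot
        have h3 : ((1 - r ^ (d + 1) : ℝ) : ℂ) * J (word q m w) = 0 := by
          push_cast at hrot htor ⊢
          have e : ((w.map (met q m)).prod : ℂ) ^ 2 * J (word q m w) = J (word q m w) := by
            rw [pow_two, mul_assoc, htor, htor]
          linear_combination hrot + (r : ℂ) ^ (d + 1) * e
        refine (mul_eq_zero.mp h3).resolve_left ?_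
        have : 1 - r ^ (d + 1) ≠ 0 := by linarith
        exact_mod_cast this
  ext f
  exact poly_mem_of_word (S := LinearMap.ker J) (fun w => key _ w rfl) f

end QuantumEuclidean

end

theorem theorem4p1 (q : ℝ) (hq0 : 0 < q) (hq1 : q < 1) (m : ℕ) (hm : 1 ≤ m) :
    ∃ D : Fin m → Module.End ℂ (QuantumEuclidean.Poly q m),
      (QuantumEuclidean.IsPartialDerivatives q m D ∧
        ∀ D', QuantumEuclidean.IsPartialDerivatives q m D' → D' = D) ∧
      (∀ R : QuantumEuclidean.Poly q m,
        {k : ℕ | QuantumEuclidean.evalZero q m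
          ((QuantumEuclidean.laplacian q m D ^ k) R) ≠ 0}.Finite) ∧
      ∃ I : QuantumEuclidean.Poly q m →ₗ[ℂ] ℂ,
        (∀ R : QuantumEuclidean.Poly q m,
          HasSum (fun k : ℕ => (QuantumEuclidean.pizzettiCoeff q m k : ℂ) *
            QuantumEuclidean.evalZero q m ((QuantumEuclidean.laplacian q m D ^ k) R)) (I R)) ∧
        I ≠ 0 ∧
        ∀ J : QuantumEuclidean.Poly q m →ₗ[ℂ] ℂ,
          (QuantumEuclidean.IsCoinvariant q m J ∧
            ∀ R : QuantumEuclidean.Poly q m, J (QuantumEuclidean.normSq q m * R) = J R) ↔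
          ∃ c : ℂ, J = c • I := by
  have h1 : QuantumEuclidean.pizzetti q hq0 m 1 ≠ 0 := by
    rw [QuantumEuclidean.pizzetti_one]
    exact_mod_cast QuantumEuclidean.pizzettiCoeff_zero_ne_zero hq0 hq1 hm
  refine ⟨QuantumEuclidean.partialD q hq0 m,
    ⟨QuantumEuclidean.isPartialDerivatives_partialD hq0, fun D' hD' =>
      hD'.eq (QuantumEuclidean.isPartialDerivatives_partialD hq0)⟩,
    fun R => ?_, QuantumEuclidean.pizzetti q hq0 m,
    fun R => (QuantumEuclidean.summable_pizzetti hq0 R).hasSum,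
    fun h => h1 (by rw [h, LinearMap.zero_apply]),
    fun J => ⟨?_, ?_⟩⟩
  · obtain ⟨N, hN⟩ := QuantumEuclidean.exists_laplaceEval_eq_zero hq0 R
    refine (Set.finite_lt_nat N).subset fun k hk => ?_
    by_contra hkN
    exact hk (hN k (not_lt.mp hkN))
  · rintro ⟨hJ, hJ2⟩
    -- The constant is forced by the values at 1; the difference vanishes there, hence everywhere by
    -- `IsCoinvariant.eq_zero`.
    refine ⟨J 1 / QuantumEuclidean.pizzetti q hq0 m 1, ?_⟩
    set c := J 1 / QuantumEuclidean.pizzetti q hq0 m 1 with hc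
    have hK : QuantumEuclidean.IsCoinvariant q m (J - c • QuantumEuclidean.pizzetti q hq0 m) :=
      Submodule.sub_mem (QuantumEuclidean.coinvariants q m) hJ
        (Submodule.smul_mem _ c (QuantumEuclidean.isCoinvariant_pizzetti hq0))
    refine sub_eq_zero.mp (hK.eq_zero (fun f => ?_) hq0 hq1 hm ?_)
    · simp only [LinearMap.sub_apply, LinearMap.smul_apply, hJ2,
        QuantumEuclidean.pizzetti_normSq_mul hq0 hq1 hm]
    · rw [LinearMap.sub_apply, LinearMap.smul_apply, smul_eq_mul, hc, div_mul_cancel₀ _ h1,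
        sub_self]
  · rintro ⟨c, rfl⟩
    refine ⟨Submodule.smul_mem (QuantumEuclidean.coinvariants q m) c
      (QuantumEuclidean.isCoinvariant_pizzetti hq0), fun R => ?_⟩
    rw [LinearMap.smul_apply, LinearMap.smul_apply,
      QuantumEuclidean.pizzetti_normSq_mul hq0 hq1 hm]
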